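/- Let $m,k\ge 1$ be integers, $N=m+k$, $\alpha>0$, and write points of $\mathbb R^N=\mathbb R^m\times\mathbb R^k$ as $(z,t)$. Put $X_i=\partial_{z_i}$ $(1\le i\le m)$, $X_{m+j}=\frac{|z|^\alpha}{2}\partial_{t_j}$ $(1\le j\le k)$, $|\nabla_\alpha f|^2=\sum_{j=1}^N (X_jf)^2$, $$\mathcal B_\alpha f=\sum_{j=1}^N X_j^2f=\Delta_z f+\frac{|z|^{2\alpha}}{4}\Delta_t f .$$ For open $\Omega\subset\mathbb R^N$ let $\Gamma^1_\alpha(\Omega)$ be the set of $f\in C(\Omega)$ whose weak derivatives $X_jf$, $1\le j\le N$, are continuous in $\Omega$, and let $\Gamma^2_\alpha(\Omega)$ be the set of $f\in\Gamma^1_\alpha(\Omega)$ with $X_jf\in\Gamma^1_\alpha(\Omega)$ for all $j$. A solution of $\mathcal B_\alpha u=0$ in $\Omega$ is a function $u\in\Gamma^2_\alpha(\Omega)$ with $\mathcal B_\alpha u=0$ in $\Omega$. Let further $\delta_\lambda(z,t)=(\lambda z,\lambda^{\alpha+1}t)$ for $\lambda>0$, $Q=m+(\alpha+1)k$, $$Z_\alpha=\sum_{i=1}^m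 z_i\partial_{z_i}+(\alpha+1)\sum_{j=1}^k t_j\partial_{t_j},\qquad \rho_\alpha(z,t)=\left(|z|^{2(\alpha+1)}+4(\alpha+1)^2|t|^2\right)^{\frac{1}{2(\alpha+1)}},$$ $B_r=\{\rho_\alpha<r\}$, $S_r=\partial B_r$, $\psi_\alpha=|\nabla_\alpha\rho_\alpha|^2$, and let $H_{N-1}$ be the $(N-1)$-dimensional Hausdorff measure of $\mathbb R^N$, normalized so that it is surface area. Let $R>0$, let $u$ be a solution of $\mathcal B_\alpha u=0$ in $B_R$, let $\kappa\ge 0$ be real, and for $0<r<R$ define $$\mathcal W_\kappa(u,r)=\frac{1}{r^{Q-2+2\kappa}}\int_{B_r}|\nabla_\alpha u|^2\,dz\,dt-\frac{\kappa}{r^{Q-1+2\kappa}}\int_{S_r}u^2\,\frac{\psi_\alpha}{|\nabla\rho_\alpha|}\,dH_{N-1}.$$ Then, for every $r\in(0,R)$, these integrals and the one below converge, $\mathcal W_\kappa(u,\cdot)$ is differentiable at $r$, and $$\frac{d}{dr}\mathcal W_\kappa(u,r)=\frac{2}{r^{Q+2\kappa}}\int_{S_r}(Z_\alpha u-\kappa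 u)^2\,\frac{\psi_\alpha}{|\nabla\rho_\alpha|}\,dH_{N-1}.$$ Consequently $r\mapsto\mathcal W_\kappa(u,r)$ is nondecreasing on $(0,R)$, and it is constant on $(0,R)$ if and only if $u$ is homogeneous of degree $\kappa$ in $B_R$, i.e. $u(\delta_\lambda(z,t))=\lambda^\kappa u(z,t)$ whenever $\lambda>0$ and both $(z,t)$ and $\delta_\lambda(z,t)$ lie in $B_R$. -/

import Mathlib

open MeasureTheory Set
open scoped ContDiff

noncomputable section

namespace Baouendi

/-- The space `ℝ^N = ℝ^m × ℝ^k` with its Euclidean norm and Lebesgue measure: the coordinates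
`Sum.inl i` are those of `z ∈ ℝ^m`, the coordinates `Sum.inr j` those of `t ∈ ℝ^k`. -/
abbrev Space (m k : ℕ) : Type := EuclideanSpace ℝ (Fin m ⊕ Fin k)

variable {m k : ℕ}

/-- The component `z ∈ ℝ^m` of the point `(z, t)`. -/
def zPart (p : Space m k) : EuclideanSpace ℝ (Fin m) := WithLp.toLp 2 fun i => p (Sum.inl i)

/-- The component `t ∈ ℝ^k` of the point `(z, t)`. -/
def tPart (p : Space m k) : EuclideanSpace ℝ (Fin k) := WithLp.toLp 2 fun j => p (Sum.inr j)

/-- The classical partial derivative of `f` in the coordinate `j`. -/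
def partialD (j : Fin m ⊕ Fin k) (f : Space m k → ℝ) (p : Space m k) : ℝ :=
  lineDeriv ℝ f p (EuclideanSpace.single j 1)

/-- The coefficient of the vector field `X_j`: it is `1` for a `z`-coordinate and `|z|^α / 2` for
a `t`-coordinate, i.e. `X_j = ∂_{z_j}` and `X_{m+j} = (|z|^α / 2) ∂_{t_j}`. -/
def coeff (α : ℝ) : Fin m ⊕ Fin k → Space m k → ℝ
  | Sum.inl _, _ => 1
  | Sum.inr _, p => ‖zPart p‖ ^ α / 2

/-- The vector field `X_j` acting on functions through classical derivatives. -/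
def classicalX (α : ℝ) (j : Fin m ⊕ Fin k) (f : Space m k → ℝ) (p : Space m k) : ℝ :=
  coeff α j p * partialD j f p

/-- `g` is the weak derivative `X_j f` on `Ω`. The formal adjoint of `X_j` is `-X_j`, as the
coefficient of `X_j` does not depend on the `j`-th coordinate. -/
def IsWeakX (α : ℝ) (Ω : Set (Space m k)) (j : Fin m ⊕ Fin k) (f g : Space m k → ℝ) : Prop :=
  ∀ φ : Space m k → ℝ, ContDiff ℝ ∞ φ → HasCompactSupport φ → tsupport φ ⊆ Ω →
    ∫ p in Ω, f p * classicalX α j φ p = -∫ p in Ω, g p * φ p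

/-- A continuous weak derivative on an open set is unique. -/
theorem IsWeakX.eqOn {α : ℝ} {Ω : Set (Space m k)} (hΩ : IsOpen Ω) {j : Fin m ⊕ Fin k}
    {f g₁ g₂ : Space m k → ℝ} (h₁ : IsWeakX α Ω j f g₁) (h₂ : IsWeakX α Ω j f g₂)
    (c₁ : ContinuousOn g₁ Ω) (c₂ : ContinuousOn g₂ Ω) : EqOn g₁ g₂ Ω := by
  have key : ∀ g : Space m k → ℝ, ContinuousOn g Ω → ∀ φ : Space m k → ℝ, Continuous φ →
      HasCompactSupport φ → tsupport φ ⊆ Ω → IntegrableOn (fun p => g p * φ p) Ω := by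
    intro g hg φ hφ hc hs
    have h1 : IntegrableOn (fun p => g p * φ p) (tsupport φ) :=
      ((hg.mono hs).mul hφ.continuousOn).integrableOn_compact hc
    have h2 : Integrable (fun p => g p * φ p) := by
      rw [← integrableOn_iff_integrable_of_support_subset (s := tsupport φ)]
      · exact h1
      · intro p hp
        exact subset_tsupport φ (right_ne_zero_of_mul hp)
    exact h2.integrableOn
  have ae : ∀ᵐ p ∂(volume : Measure (Space m k)), p ∈ Ω → (g₁ p - g₂ p) = 0 := by
    refine hΩ.ae_eq_zero_of_integral_contDiff_smul_eq_zero
      ((c₁.sub c₂).locallyIntegrableOn hΩ.measurableSet) ?_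
    intro φ hφ hc hs
    have e : ∫ p in Ω, φ p • (g₁ p - g₂ p) = 0 := by
      have : ∀ p, φ p • (g₁ p - g₂ p) = g₁ p * φ p - g₂ p * φ p := by
        intro p; rw [smul_eq_mul]; ring
      simp_rw [this]
      rw [integral_sub (key g₁ c₁ φ hφ.continuous hc hs) (key g₂ c₂ φ hφ.continuous hc hs)]
      linarith [h₁ φ hφ hc hs, h₂ φ hφ hc hs]
    rw [← e]
    symm
    apply setIntegral_eq_integral_of_forall_compl_eq_zero
    intro p hp
    have : φ p = 0 := by
      by_contra h
      exact hp (hs (subset_tsupport φ h))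
    simp [this]
  refine Measure.eqOn_open_of_ae_eq (μ := volume) ?_ hΩ c₁ c₂
  filter_upwards [(ae_restrict_iff' hΩ.measurableSet).2 ae] with p hp
  linarith

open Classical in
/-- The function `X_j f` on `Ω`: the continuous weak derivative of `f`, which is unique on `Ω` when
`Ω` is open. (If there is none, the value is `0`; this is not used for functions of class
`Γ^1_α`.) -/
def weakX (α : ℝ) (Ω : Set (Space m k)) (j : Fin m ⊕ Fin k) (f : Space m k → ℝ) :
    Space m k → ℝ :=
  if h : ∃ g, ContinuousOn g Ω ∧ IsWeakX α Ω j f g then h.choose else 0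

/-- The class `Γ^1_α(Ω)`: `f` and all its weak derivatives `X_j f` are continuous on `Ω`. -/
def Gamma1 (α : ℝ) (Ω : Set (Space m k)) (f : Space m k → ℝ) : Prop :=
  ContinuousOn f Ω ∧ ∀ j, ∃ g, ContinuousOn g Ω ∧ IsWeakX α Ω j f g

/-- The class `Γ^2_α(Ω)`: `f` and all `X_j f` belong to `Γ^1_α(Ω)`. -/
def Gamma2 (α : ℝ) (Ω : Set (Space m k)) (f : Space m k → ℝ) : Prop :=
  Gamma1 α Ω f ∧ ∀ j, Gamma1 α Ω (weakX α Ω j f)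

/-- The Baouendi operator `𝓑_α f = ∑_j X_j (X_j f) = Δ_z f + (|z|^{2α} / 4) Δ_t f` on `Ω`. -/
def operator (α : ℝ) (Ω : Set (Space m k)) (f : Space m k → ℝ) (p : Space m k) : ℝ :=
  ∑ j, weakX α Ω j (weakX α Ω j f) p

/-- `f` is a solution of `𝓑_α f = 0` in `Ω`. -/
def IsSolution (α : ℝ) (Ω : Set (Space m k)) (f : Space m k → ℝ) : Prop :=
  Gamma2 α Ω f ∧ ∀ p ∈ Ω, operator α Ω f p = 0

/-- The squared length `|∇_α f|² = ∑_j (X_j f)² = |∇_z f|² + (|z|^{2α} / 4) |∇_t f|²` on `Ω`. -/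
def alphaGradSq (α : ℝ) (Ω : Set (Space m k)) (f : Space m k → ℝ) (p : Space m k) : ℝ :=
  ∑ j, weakX α Ω j f p ^ 2

/-- The non-isotropic dilation `δ_λ (z, t) = (λ z, λ^{α+1} t)`. -/
def dil (α l : ℝ) (p : Space m k) : Space m k :=
  WithLp.toLp 2 fun j => Sum.elim (fun _ => l) (fun _ => l ^ (α + 1)) j * p j

/-- `f` is `δ_λ`-homogeneous of degree `κ` in `Ω`. -/
def IsHomogeneousOn (α κ : ℝ) (Ω : Set (Space m k)) (f : Space m k → ℝ) : Prop :=
  ∀ p ∈ Ω, ∀ l : ℝ, 0 < l → dil α l p ∈ Ω → f (dil α l p) = l ^ κ * f p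

/-- The generator `Z_α f = ∑ z_i ∂_{z_i} f + (α + 1) ∑ t_j ∂_{t_j} f` of the dilations, through
classical derivatives. A function of class `Γ^1_α` is `C^1` where `z ≠ 0`, and the points of a
sphere `S_r` with `z = 0` form a null set for the `(N-1)`-dimensional Hausdorff measure. -/
def genZ (α : ℝ) (f : Space m k → ℝ) (p : Space m k) : ℝ :=
  ∑ i : Fin m, p (Sum.inl i) * partialD (Sum.inl i) f p +
    (α + 1) * ∑ j : Fin k, p (Sum.inr j) * partialD (Sum.inr j) f p

/-- The homogeneous dimension `Q = m + (α + 1) k`. -/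
def homDim (m k : ℕ) (α : ℝ) : ℝ := m + (α + 1) * k

/-- The pseudo-gauge `ρ_α (z, t) = (|z|^{2(α+1)} + 4 (α+1)² |t|²)^{1/(2(α+1))}`. -/
def gauge (α : ℝ) (p : Space m k) : ℝ :=
  (‖zPart p‖ ^ (2 * (α + 1)) + 4 * (α + 1) ^ 2 * ‖tPart p‖ ^ 2) ^ (1 / (2 * (α + 1)))

/-- The pseudo-ball `B_r`. -/
def pball (m k : ℕ) (α r : ℝ) : Set (Space m k) := {p | gauge α p < r}

/-- The pseudo-sphere `S_r = ∂ B_r`. -/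
def psphere (m k : ℕ) (α r : ℝ) : Set (Space m k) := frontier (pball m k α r)

/-- The function `ψ_α = |∇_α ρ_α|²`. (The gauge is of class `C^1` away from the origin.) -/
def psi (α : ℝ) (p : Space m k) : ℝ := ∑ j, classicalX α j (gauge α) p ^ 2

/-- The weight `ψ_α / |∇ ρ_α|`, where `∇` is the Euclidean gradient. -/
def weight (α : ℝ) (p : Space m k) : ℝ := psi α p / ‖gradient (gauge α) p‖

/-- The `(N-1)`-dimensional Hausdorff measure on `ℝ^N`, `N = m + k`, with the normalization for
which the `d`-dimensional Hausdorff measure on `ℝ^d` is Lebesgue measure. -/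
def surfaceMeasure (m k : ℕ) : Measure (Space m k) :=
  Measure.euclideanHausdorffMeasure (m + k - 1)

/-- The Dirichlet integral `D(u, r) = ∫_{B_r} |∇_α u|² dz dt` of a function `u` on `B_R`. -/
def dirichlet (α R : ℝ) (u : Space m k → ℝ) (r : ℝ) : ℝ :=
  ∫ p in pball m k α r, alphaGradSq α (pball m k α R) u p

/-- The height `H(u, r) = ∫_{S_r} u² ψ_α / |∇ ρ_α| dH_{N-1}`. -/
def height (α : ℝ) (u : Space m k → ℝ) (r : ℝ) : ℝ :=
  ∫ p in psphere m k α r, u p ^ 2 * weight α p ∂(surfaceMeasure m k)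

/-- The Weiss functional `𝓦_κ(u, r) = r^{-(Q-2+2κ)} D(u, r) - κ r^{-(Q-1+2κ)} H(u, r)` of a
function `u` on `B_R`. -/
def weiss (α R κ : ℝ) (u : Space m k → ℝ) (r : ℝ) : ℝ :=
  1 / r ^ (homDim m k α - 2 + 2 * κ) * dirichlet α R u r
    - κ / r ^ (homDim m k α - 1 + 2 * κ) * height α u r

end Baouendi

end

/-! Write points as `δ_s ξ` with `ρ_α(ξ) = 1`, and let `τ` be the measure for which Lebesgue measure
becomes `s^(Q-1) ds dτ(ξ)`. Put `Φ(s,t) = ∫ u(δ_s ξ) (Z_α u)(δ_t ξ) |z(ξ)|^(2α) dτ` and `h(s) = ∫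
u(δ_s ξ)^2 |z(ξ)|^(2α) dτ`. Since `ψ_α` is constant along dilation orbits, the height is `s^(Q-1)
h(s)`. Green's identity (`Solves.green`) turns the Dirichlet integral into `s^(Q-2) Φ(s,s)`. Hence
the Weiss functional is `s^(-2κ) (Φ(s,s) - κ h(s))`, and `Q` has disappeared.

As `s ∂_s u(δ_s ξ) = (Z_α u)(δ_s ξ)`, one has `h'(s) = (2/s) Φ(s,s)`. The derivative of `Φ(s,s)` is
found without differentiating `Z_α u`. Both `u ∘ δ_s` and `u ∘ δ_t` are solutions beyond the unit
pseudo-ball, so Green's identity for this pair gives `Φ(s,t) = Φ(t,s)` (`Solves.integral_symm`).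
Therefore `Φ(s,s) - Φ(t,t)` is the integral of `(u(δ_s ξ) - u(δ_t ξ)) (Z_α u(δ_s ξ) + Z_α u(δ_t ξ))
|z|^(2α)`, and its difference quotient tends to `(2/t) ∫ (Z_α u)(δ_t ξ)^2 |z|^(2α) dτ`
(`RadialFamily.hasDerivAt_integral_diag`). The terms combine to the square of `Z_α u - κ u`. If the
functional is constant, then `Z_α u = κ u`, which is Euler's equation and integrates along the
orbits to homogeneity.

Two inputs are technical. The Hausdorff measure on a level set of the gauge, with density
`1/|∇ρ_α|`, is the image of `τ` up to the factor `s^(Q-1)` (`levelMeasure_restrict_psphere`); this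
is proved by computing volumes of thin shells in two ways. On the set `z = 0` the fields degenerate
and weak derivatives need not be classical; that set is null, and the product `|z|^α Z_α u` extends
continuously across it, so the estimates are made for this product. -/

noncomputable section

namespace Baouendi
variable {m k : ℕ}

open Filter Topology Metric Convolution ContinuousLinearMap

/-! ### Continuous weak partial derivatives are classical derivatives. -/

section Mollification

variable {ι : Type*} [Fintype ι]

/-- The continuous linear form with coordinates `v`. -/
def coordForm : (ι → ℝ) →ₗ[ℝ] (EuclideanSpace ℝ ι →L[ℝ] ℝ) where
  toFun v := ∑ j, v j • (EuclideanSpace.proj j : EuclideanSpace ℝ ι →L[ℝ] ℝ)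
  map_add' v w := by simp [add_smul, Finset.sum_add_distrib]
  map_smul' c v := by simp [mul_smul, Finset.smul_sum]

theorem coordForm_apply (v : ι → ℝ) (x : EuclideanSpace ℝ ι) :
    coordForm v x = ∑ j, v j * x j := by
  simp [coordForm]

theorem coordForm_single [DecidableEq ι] (v : ι → ℝ) (j : ι) :
    coordForm v (EuclideanSpace.single j 1) = v j := by
  simp [coordForm_apply]

theorem continuous_coordForm : Continuous (coordForm (ι := ι)) :=
  LinearMap.continuous_of_finiteDimensional _

theorem eq_coordForm [DecidableEq ι] (L : EuclideanSpace ℝ ι →L[ℝ] ℝ) :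
    L = coordForm fun j => L (EuclideanSpace.single j 1) := by
  refine ContinuousLinearMap.coe_injective ((EuclideanSpace.basisFun ι ℝ).toBasis.ext fun j => ?_)
  simp [coordForm_single]

/-- The map from coordinates to linear forms is linear on a finite-dimensional space, hence
uniformly continuous; so uniform convergence of each partial derivative is uniform convergence of
the differentials. -/
theorem hasFDerivAt_of_tendstoUniformlyOn_partials {s : Set (EuclideanSpace ℝ ι)} (hs : IsOpen s)
    {f : EuclideanSpace ℝ ι → ℝ} {d : ι → EuclideanSpace ℝ ι → ℝ}
    {fn : ℕ → EuclideanSpace ℝ ι → ℝ} {dn : ι → ℕ → EuclideanSpace ℝ ι → ℝ}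
    (hd : ∀ j, TendstoUniformlyOn (dn j) (d j) atTop s)
    (hfd : ∀ n, ∀ x ∈ s, HasFDerivAt (fn n) (coordForm fun j => dn j n x) x)
    (hf : TendstoUniformlyOn fn f atTop s) {p : EuclideanSpace ℝ ι} (hp : p ∈ s) :
    HasFDerivAt f (coordForm fun j => d j p) p := by
  refine hasFDerivAt_of_tendstoUniformlyOn (l := atTop) (f := fn)
    (f' := fun n x => coordForm fun j => dn j n x) (g' := fun x => coordForm fun j => d j x)
    hs ?_ hfd (fun x hx => hf.tendsto_at hx) hp
  have huc : UniformContinuous (coordForm (ι := ι)) :=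
    (LinearMap.toContinuousLinearMap (coordForm (ι := ι))).uniformContinuous
  have h1 : TendstoUniformlyOn (fun n x j => dn j n x) (fun x j => d j x) atTop s := by
    rw [Metric.tendstoUniformlyOn_iff]
    intro ε hε
    have := fun j => Metric.tendstoUniformlyOn_iff.1 (hd j) ε hε
    filter_upwards [eventually_all.2 this] with n hn x hx
    exact (dist_pi_lt_iff hε).2 fun j => hn j x hx
  exact huc.comp_tendstoUniformlyOn h1

/-- The functions of a mollifying sequence with radii at most `δ`. -/
def mollifier (E : Type*) [NormedAddCommGroup E] {δ : ℝ} (hδ : 0 < δ) (n : ℕ) :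
    ContDiffBump (0 : E) where
  rIn := δ / (n + 2) / 2
  rOut := δ / (n + 2)
  rIn_pos := by positivity
  rIn_lt_rOut := by
    have : 0 < δ / (n + 2) := by positivity
    linarith

/-- The mollifiers have radius at most `δ`, so around a point of `ball p δ` they only see
`closedBall p (2 * δ)`, where `g` is uniformly continuous and the indicator has no effect. -/
theorem tendstoUniformlyOn_mollifier {δ : ℝ} (hδ : 0 < δ) {p : EuclideanSpace ℝ ι}
    {g : EuclideanSpace ℝ ι → ℝ} (hg : ContinuousOn g (closedBall p (2 * δ))) :
    TendstoUniformlyOn (fun n => ((mollifier _ hδ n).normed volume ⋆[lsmul ℝ ℝ]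
      (closedBall p (2 * δ)).indicator g : EuclideanSpace ℝ ι → ℝ)) g atTop (ball p δ) := by
  set K := closedBall p (2 * δ)
  have hK : IsCompact K := isCompact_closedBall _ _
  rw [Metric.tendstoUniformlyOn_iff]
  intro ε hε
  have huc := hK.uniformContinuousOn_of_continuous hg
  rw [Metric.uniformContinuousOn_iff] at huc
  obtain ⟨η, hη, h⟩ := huc (ε / 2) (by positivity)
  have h0 : Tendsto (fun n : ℕ => δ / ((n : ℝ) + 2)) atTop (𝓝 0) :=
    tendsto_const_nhds.div_atTop (tendsto_atTop_add_const_right _ _ tendsto_natCast_atTop_atTop)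
  filter_upwards [h0.eventually (gt_mem_nhds hη)] with n hn x hx
  have hxK : x ∈ K := by
    have : dist x p < δ := hx
    exact mem_closedBall.2 (by linarith)
  have hle : δ / ((n : ℝ) + 2) ≤ δ := by
    apply div_le_self hδ.le
    have : (0 : ℝ) ≤ n := Nat.cast_nonneg n
    linarith
  rw [dist_comm]
  refine lt_of_le_of_lt ?_ (half_lt_self hε)
  have key := (mollifier (EuclideanSpace ℝ ι) hδ n).dist_normed_convolution_le
    (μ := volume) (x₀ := x) (ε := ε / 2) (g := K.indicator g)
    ((aestronglyMeasurable_indicator_iff measurableSet_closedBall).2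
      (hg.aestronglyMeasurable measurableSet_closedBall)) ?_
  · rwa [indicator_of_mem hxK] at key
  · intro y hy
    have hy' : dist y x < δ / (n + 2) := hy
    have hyK : y ∈ K := by
      have : dist x p < δ := hx
      have := dist_triangle y x p
      exact mem_closedBall.2 (by linarith)
    rw [indicator_of_mem hxK, indicator_of_mem hyK]
    exact (h y hyK x hxK (hy'.trans hn)).le

/-- A continuous function with continuous weak partial derivatives is differentiable. -/
theorem hasFDerivAt_of_weak_partials [DecidableEq ι] {Ω : Set (EuclideanSpace ℝ ι)} (hΩ : IsOpen Ω)
    {f : EuclideanSpace ℝ ι → ℝ} {d : ι → EuclideanSpace ℝ ι → ℝ} (hf : ContinuousOn f Ω)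
    (hd : ∀ j, ContinuousOn (d j) Ω)
    (h : ∀ j, ∀ φ : EuclideanSpace ℝ ι → ℝ, ContDiff ℝ ∞ φ → HasCompactSupport φ →
      tsupport φ ⊆ Ω → ∫ x in Ω, f x * lineDeriv ℝ φ x (EuclideanSpace.single j 1)
        = -∫ x in Ω, d j x * φ x) {p : EuclideanSpace ℝ ι} (hp : p ∈ Ω) :
    HasFDerivAt f (coordForm fun j => d j p) p := by
  obtain ⟨δ, hδ, hδΩ⟩ : ∃ δ > 0, closedBall p (2 * δ) ⊆ Ω := by
    obtain ⟨r, hr, h⟩ := Metric.nhds_basis_closedBall.mem_iff.1 (hΩ.mem_nhds hp)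
    exact ⟨r / 2, by positivity, by rwa [mul_div_cancel₀ _ two_ne_zero]⟩
  set K := closedBall p (2 * δ) with hKdef
  have hK : IsCompact K := isCompact_closedBall _ _
  have hKm : MeasurableSet K := measurableSet_closedBall
  have hint : ∀ g : EuclideanSpace ℝ ι → ℝ, ContinuousOn g Ω → Integrable (K.indicator g) :=
    fun g hg => ((hg.mono hδΩ).integrableOn_compact hK).integrable_indicator hKm
  set fn : ℕ → EuclideanSpace ℝ ι → ℝ := fun n =>
    (mollifier _ hδ n).normed volume ⋆[lsmul ℝ ℝ] K.indicator f with hfn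
  set dn : ι → ℕ → EuclideanSpace ℝ ι → ℝ := fun j n =>
    (mollifier _ hδ n).normed volume ⋆[lsmul ℝ ℝ] K.indicator (d j) with hdn
  refine hasFDerivAt_of_tendstoUniformlyOn_partials (s := ball p δ) isOpen_ball
    (fun j => tendstoUniformlyOn_mollifier hδ ((hd j).mono hδΩ)) (fun n x hx => ?_)
    (tendstoUniformlyOn_mollifier hδ (hf.mono hδΩ)) (mem_ball_self hδ)
  set ψ := (mollifier (EuclideanSpace ℝ ι) hδ n).normed volume with hψ
  have hψc : HasCompactSupport ψ := (mollifier _ hδ n).hasCompactSupport_normed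
  have hψs : ContDiff ℝ ∞ ψ := (mollifier _ hδ n).contDiff_normed
  have hswap : ∀ g : EuclideanSpace ℝ ι → ℝ, ∀ y,
      (ψ ⋆[lsmul ℝ ℝ] g) y = ∫ t, g t * ψ (y - t) := by
    intro g y
    rw [convolution_lsmul_swap]
    simp [mul_comm]
  have hswap' : ∀ g : EuclideanSpace ℝ ι → ℝ, (ψ ⋆[lsmul ℝ ℝ] g) = g ⋆[lsmul ℝ ℝ] ψ := by
    intro g
    ext y
    rw [hswap]
    simp [convolution_def]
  have hder := hψc.hasFDerivAt_convolution_right (lsmul ℝ ℝ) (hint f hf).locallyIntegrable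
    (hψs.of_le (by simp)) x
  rw [hswap' (K.indicator f)]
  suffices hL : (coordForm fun j => dn j n x) =
      (K.indicator f ⋆[(lsmul ℝ ℝ).precompR _, volume] fderiv ℝ ψ) x by
    rw [hL]
    exact hder
  symm
  rw [eq_coordForm ((K.indicator f ⋆[(lsmul ℝ ℝ).precompR _, volume] fderiv ℝ ψ) x)]
  congr 1
  ext j
  rw [convolution_precompR_apply (lsmul ℝ ℝ) (hint f hf).locallyIntegrable (hψc.fderiv ℝ)
    (hψs.continuous_fderiv (by simp))]
  -- The derivative of the convolution at `x` is minus the integral of `f` against `∂_j φ`; testing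
  -- the weak identity with `φ` turns it into the mollification of `d j`.
  set φ : EuclideanSpace ℝ ι → ℝ := fun y => ψ (x - y) with hφ
  have hsupp : ∀ y, φ y ≠ 0 → y ∈ ball x (δ / 2) := by
    intro y hy
    have h1 : x - y ∈ Function.support ψ := hy
    rw [hψ, ContDiffBump.support_normed_eq] at h1
    have h2 : ‖x - y‖ < (mollifier (EuclideanSpace ℝ ι) hδ n).rOut := by simpa using h1
    change _ < δ / ((n : ℝ) + 2) at h2
    have hle : δ / ((n : ℝ) + 2) ≤ δ / 2 := by
      have : (0 : ℝ) ≤ n := Nat.cast_nonneg n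
      gcongr
      linarith
    rw [mem_ball, dist_comm, dist_eq_norm]
    linarith
  have hballK : closedBall x (δ / 2) ⊆ K := by
    intro y hy
    have h1 : dist x p < δ := hx
    have h2 : dist y x ≤ δ / 2 := hy
    have := dist_triangle y x p
    exact mem_closedBall.2 (by linarith)
  have htsupp : tsupport φ ⊆ closedBall x (δ / 2) :=
    closure_minimal (fun y hy => ball_subset_closedBall (hsupp y hy)) isClosed_closedBall
  have hφs : ContDiff ℝ ∞ φ := hψs.comp (contDiff_const.sub contDiff_id)
  have hφc : HasCompactSupport φ :=
    HasCompactSupport.of_support_subset_isCompact (isCompact_closedBall x (δ / 2))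
      (fun y hy => ball_subset_closedBall (hsupp y hy))
  have hline : ∀ y, lineDeriv ℝ φ y (EuclideanSpace.single j 1)
      = -(fderiv ℝ ψ (x - y) (EuclideanSpace.single j 1)) := by
    intro y
    have h1 : HasFDerivAt φ ((fderiv ℝ ψ (x - y)).comp (-ContinuousLinearMap.id ℝ _)) y :=
      ((hψs.differentiable (by simp)) (x - y)).hasFDerivAt.comp y ((hasFDerivAt_id y).const_sub x)
    rw [h1.differentiableAt.lineDeriv_eq_fderiv, h1.fderiv]
    simp
  have hmain := h j φ hφs hφc (htsupp.trans (hballK.trans hδΩ))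
  have hred : ∀ g θ : EuclideanSpace ℝ ι → ℝ, (∀ y, y ∉ K → θ y = 0) →
      ∫ y, K.indicator g y * θ y = ∫ y in Ω, g y * θ y := by
    intro g θ hθ
    rw [setIntegral_eq_integral_of_forall_compl_eq_zero]
    · congr 1
      ext y
      by_cases hy : y ∈ K
      · simp [hy]
      · simp [hy, hθ y hy]
    · intro y hy
      rw [hθ y (fun h => hy (hδΩ h)), mul_zero]
  have hz : ∀ y, y ∉ K → φ y = 0 := by
    intro y hy
    by_contra hne
    exact hy (hballK (ball_subset_closedBall (hsupp y hne)))
  have hz' : ∀ y, y ∉ K → lineDeriv ℝ φ y (EuclideanSpace.single j 1) = 0 := by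
    intro y hy
    have : y ∉ tsupport φ := fun h => hy (hballK (htsupp h))
    rw [(hφs.differentiable (by simp) y).lineDeriv_eq_fderiv]
    rw [notMem_tsupport_iff_eventuallyEq] at this
    rw [this.fderiv_eq]
    simp
  show (K.indicator f ⋆[lsmul ℝ ℝ] fun a => fderiv ℝ ψ a (EuclideanSpace.single j 1)) x
    = (ψ ⋆[lsmul ℝ ℝ] K.indicator (d j)) x
  rw [hswap, hred (d j) φ hz, ← neg_eq_iff_eq_neg.2 hmain, ← hred f _ hz', ← integral_neg,
    convolution_def]
  congr 1
  ext y
  rw [hline]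
  simp

end Mollification

end Baouendi

namespace Baouendi
variable {m k : ℕ}

open Filter Topology Metric ContinuousLinearMap

/-! ### The gauge, its derivatives and the function `ψ_α`. -/

section Gauge

@[simp] theorem zPart_apply (p : Space m k) (i : Fin m) : zPart p i = p (Sum.inl i) := rfl
@[simp] theorem tPart_apply (p : Space m k) (j : Fin k) : tPart p j = p (Sum.inr j) := rfl

/-- `zPart` as a continuous linear map. -/
def zLin : Space m k →L[ℝ] EuclideanSpace ℝ (Fin m) :=
  LinearMap.toContinuousLinearMap
    { toFun := zPart, map_add' := fun _ _ => rfl, map_smul' := fun _ _ => rfl }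

/-- `tPart` as a continuous linear map. -/
def tLin : Space m k →L[ℝ] EuclideanSpace ℝ (Fin k) :=
  LinearMap.toContinuousLinearMap
    { toFun := tPart, map_add' := fun _ _ => rfl, map_smul' := fun _ _ => rfl }

theorem zLin_apply (p : Space m k) : zLin p = zPart p := rfl
theorem tLin_apply (p : Space m k) : tLin p = tPart p := rfl

@[fun_prop] theorem continuous_zPart : Continuous (zPart : Space m k → _) := zLin.continuous
@[fun_prop] theorem continuous_tPart : Continuous (tPart : Space m k → _) := tLin.continuous

theorem zPart_eq_zero_and_tPart_eq_zero_iff {p : Space m k} :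
    zPart p = 0 ∧ tPart p = 0 ↔ p = 0 := by
  constructor
  · rintro ⟨h1, h2⟩
    ext j
    rcases j with i | j
    · exact congrArg (fun v => v i) h1
    · exact congrArg (fun v => v j) h2
  · rintro rfl
    exact ⟨rfl, rfl⟩

theorem norm_zPart_sq (p : Space m k) : ‖zPart p‖ ^ 2 = ∑ i, p (Sum.inl i) ^ 2 := by
  simp [EuclideanSpace.norm_sq_eq]

theorem norm_tPart_sq (p : Space m k) : ‖tPart p‖ ^ 2 = ∑ j, p (Sum.inr j) ^ 2 := by
  simp [EuclideanSpace.norm_sq_eq]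

/-- The power `ρ_α ^ (2 (α + 1))` of the gauge. -/
def gaugePow (α : ℝ) (p : Space m k) : ℝ :=
  ‖zPart p‖ ^ (2 * (α + 1)) + 4 * (α + 1) ^ 2 * ‖tPart p‖ ^ 2

theorem gauge_def (α : ℝ) (p : Space m k) : gauge α p = gaugePow α p ^ (1 / (2 * (α + 1))) := rfl

theorem gaugePow_nonneg (α : ℝ) (p : Space m k) : 0 ≤ gaugePow α p := by
  unfold gaugePow; positivity

theorem gauge_nonneg (α : ℝ) (p : Space m k) : 0 ≤ gauge α p :=
  Real.rpow_nonneg (gaugePow_nonneg α p) _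

variable {α : ℝ}

theorem gauge_rpow (hα : 0 < α) (p : Space m k) : gauge α p ^ (2 * (α + 1)) = gaugePow α p := by
  rw [gauge_def, ← Real.rpow_mul (gaugePow_nonneg α p), one_div_mul_cancel (by positivity),
    Real.rpow_one]

theorem gaugePow_pos (hα : 0 < α) {p : Space m k} (hp : p ≠ 0) : 0 < gaugePow α p := by
  rcases (gaugePow_nonneg α p).lt_or_eq with h | h
  · exact h
  exfalso
  apply hp
  have h1 : 0 ≤ ‖zPart p‖ ^ (2 * (α + 1)) := by positivity
  have h2 : 0 ≤ 4 * (α + 1) ^ 2 * ‖tPart p‖ ^ 2 := by positivity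
  unfold gaugePow at h
  have e1 : ‖zPart p‖ ^ (2 * (α + 1)) = 0 := by linarith
  have e2 : 4 * (α + 1) ^ 2 * ‖tPart p‖ ^ 2 = 0 := by linarith
  rw [Real.rpow_eq_zero (norm_nonneg _) (by positivity), norm_eq_zero] at e1
  have : 4 * (α + 1) ^ 2 ≠ 0 := by positivity
  simp only [mul_eq_zero, this, false_or, pow_eq_zero_iff two_ne_zero, norm_eq_zero] at e2
  exact zPart_eq_zero_and_tPart_eq_zero_iff.1 ⟨e1, e2⟩

theorem gauge_pos (hα : 0 < α) {p : Space m k} (hp : p ≠ 0) : 0 < gauge α p :=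
  Real.rpow_pos_of_pos (gaugePow_pos hα hp) _

theorem gauge_zero (hα : 0 < α) : gauge α (0 : Space m k) = 0 := by
  have hz : zPart (0 : Space m k) = 0 := rfl
  have ht : tPart (0 : Space m k) = 0 := rfl
  rw [gauge_def, gaugePow, hz, ht, norm_zero, norm_zero, Real.zero_rpow (by positivity)]
  simp only [ne_eq, OfNat.ofNat_ne_zero, not_false_eq_true, zero_pow, mul_zero, add_zero]
  rw [Real.zero_rpow (by positivity)]

theorem gauge_pos_iff (hα : 0 < α) {p : Space m k} : 0 < gauge α p ↔ p ≠ 0 := by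
  refine ⟨?_, gauge_pos hα⟩
  rintro h rfl
  rw [gauge_zero hα] at h
  exact h.false

theorem continuous_gaugePow (hα : 0 < α) : Continuous (gaugePow α : Space m k → ℝ) := by
  unfold gaugePow
  have : Continuous fun p : Space m k => ‖zPart p‖ ^ (2 * (α + 1)) :=
    (continuous_zPart.norm).rpow_const fun _ => Or.inr (by positivity)
  fun_prop

theorem continuous_gauge (hα : 0 < α) : Continuous (gauge α : Space m k → ℝ) :=
  (continuous_gaugePow hα).rpow_const fun _ => Or.inr (by positivity)

/-- The classical partial derivatives of the gauge. -/
def gaugeD (α : ℝ) (p : Space m k) : Fin m ⊕ Fin k → ℝ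
  | Sum.inl i => gauge α p ^ (-2 * α - 1) * (‖zPart p‖ ^ (2 * α) * p (Sum.inl i))
  | Sum.inr j => gauge α p ^ (-2 * α - 1) * (4 * (α + 1) * p (Sum.inr j))

theorem hasFDerivAt_gaugePow (hα : 0 < α) (p : Space m k) :
    HasFDerivAt (gaugePow α) (coordForm fun j => Sum.elim
      (fun i => 2 * (α + 1) * (‖zPart p‖ ^ (2 * α) * p (Sum.inl i)))
      (fun j => 2 * (α + 1) * (4 * (α + 1) * p (Sum.inr j))) j) p := by
  -- The exponent exceeds `1`, so this power of the norm is differentiable also where `z = 0`.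
  have h1 := (hasFDerivAt_norm_rpow (zPart p) (p := 2 * (α + 1)) (by linarith)).comp p
    (zLin (m := m) (k := k)).hasFDerivAt
  have h2 := ((hasStrictFDerivAt_norm_sq (tPart p)).hasFDerivAt.comp p
    (tLin (m := m) (k := k)).hasFDerivAt).const_mul (4 * (α + 1) ^ 2)
  refine (h1.add h2).congr_fderiv ?_
  rw [eq_coordForm (_ + _)]
  congr 1
  ext j
  have e : 2 * (α + 1) - 2 = 2 * α := by ring
  rcases j with i | j
  · have a : zLin (EuclideanSpace.single (Sum.inl i) 1 : Space m k) = EuclideanSpace.single i 1 := by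
      ext i'; simp [zLin_apply]
    have b : tLin (EuclideanSpace.single (Sum.inl i) 1 : Space m k) = 0 := by
      ext i'; simp [tLin_apply]
    have c : inner ℝ (zPart p) (EuclideanSpace.single i 1) = p (Sum.inl i) := by
      simp [EuclideanSpace.inner_single_right]
    simp [a, b, c, e]
    ring
  · have a : tLin (EuclideanSpace.single (Sum.inr j) 1 : Space m k) = EuclideanSpace.single j 1 := by
      ext i'; simp [tLin_apply]
    have b : zLin (EuclideanSpace.single (Sum.inr j) 1 : Space m k) = 0 := by
      ext i'; simp [zLin_apply]
    have c : inner ℝ (tPart p) (EuclideanSpace.single j 1) = p (Sum.inr j) := by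
      simp [EuclideanSpace.inner_single_right]
    simp [a, b, c]
    ring

theorem hasFDerivAt_gauge (hα : 0 < α) {p : Space m k} (hp : p ≠ 0) :
    HasFDerivAt (gauge α) (coordForm (gaugeD α p)) p := by
  have h := (hasFDerivAt_gaugePow hα p).rpow_const (p := 1 / (2 * (α + 1)))
    (Or.inl (gaugePow_pos hα hp).ne')
  refine h.congr_fderiv ?_
  rw [← map_smul]
  congr 1
  have hg := gaugePow_pos hα hp
  have e : gaugePow α p ^ (1 / (2 * (α + 1)) - 1) = gauge α p ^ (-2 * α - 1) := by
    rw [gauge_def, ← Real.rpow_mul hg.le]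
    congr 1
    field_simp
    ring
  have hα1 : α + 1 ≠ 0 := by positivity
  ext j
  rcases j with i | j
  · simp only [Pi.smul_apply, Sum.elim_inl, gaugeD, e, smul_eq_mul]
    field_simp
  · simp only [Pi.smul_apply, Sum.elim_inr, gaugeD, e, smul_eq_mul]
    field_simp

theorem partialD_gauge (hα : 0 < α) {p : Space m k} (hp : p ≠ 0) (j : Fin m ⊕ Fin k) :
    partialD j (gauge α) p = gaugeD α p j := by
  have h := hasFDerivAt_gauge hα hp
  rw [partialD, h.differentiableAt.lineDeriv_eq_fderiv, h.fderiv, coordForm_single]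

theorem continuousOn_gaugeD (hα : 0 < α) :
    ContinuousOn (gaugeD α : Space m k → _) {0}ᶜ := by
  have h : ContinuousOn (fun p : Space m k => gauge α p ^ (-2 * α - 1)) {0}ᶜ :=
    (continuous_gauge hα).continuousOn.rpow_const fun p hp => Or.inl (gauge_pos hα hp).ne'
  have hz : Continuous (fun p : Space m k => ‖zPart p‖ ^ (2 * α)) :=
    continuous_zPart.norm.rpow_const fun _ => Or.inr (by positivity)
  refine continuousOn_pi.2 fun j => ?_
  rcases j with i | j
  · refine h.mul (Continuous.continuousOn ?_)
    fun_prop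
  · refine h.mul (Continuous.continuousOn ?_)
    fun_prop

/-- Strictness, a consequence of the continuity of the derivative, is what makes the map of
`exists_flattening` almost isometric near a point. -/
theorem hasStrictFDerivAt_gauge (hα : 0 < α) {p : Space m k} (hp : p ≠ 0) :
    HasStrictFDerivAt (gauge α) (coordForm (gaugeD α p)) p := by
  refine hasStrictFDerivAt_of_hasFDerivAt_of_continuousAt
    (f' := fun x => coordForm (gaugeD α x)) ?_ ?_
  · filter_upwards [isOpen_compl_singleton.mem_nhds hp] with x hx
    exact hasFDerivAt_gauge hα hx
  · exact continuous_coordForm.continuousAt.comp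
      ((continuousOn_gaugeD hα).continuousAt (isOpen_compl_singleton.mem_nhds hp))

/-- The Euclidean gradient of the gauge. -/
def gaugeGrad (α : ℝ) (p : Space m k) : Space m k := WithLp.toLp 2 (gaugeD α p)

theorem gradient_gauge (hα : 0 < α) {p : Space m k} (hp : p ≠ 0) :
    gradient (gauge α) p = gaugeGrad α p := by
  refine HasGradientAt.gradient ?_
  rw [hasGradientAt_iff_hasFDerivAt]
  refine (hasFDerivAt_gauge hα hp).congr_fderiv ?_
  ext x
  rw [coordForm_apply, InnerProductSpace.toDual_apply_apply, PiLp.inner_apply]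
  simp [gaugeGrad, mul_comm]

theorem coordForm_gaugeD_apply (p x : Space m k) :
    coordForm (gaugeD α p) x = inner ℝ (gaugeGrad α p) x := by
  rw [coordForm_apply, PiLp.inner_apply]
  simp [gaugeGrad, mul_comm]

theorem continuousOn_gaugeGrad (hα : 0 < α) :
    ContinuousOn (gaugeGrad α : Space m k → _) {0}ᶜ :=
  (PiLp.continuous_toLp 2 _).comp_continuousOn (continuousOn_gaugeD hα)

theorem gaugeGrad_ne_zero (hα : 0 < α) {p : Space m k} (hp : p ≠ 0) : gaugeGrad α p ≠ 0 := by
  intro h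
  apply hp
  have hg : gauge α p ^ (-2 * α - 1) ≠ 0 := (Real.rpow_pos_of_pos (gauge_pos hα hp) _).ne'
  have h0 : ∀ j, gaugeD α p j = 0 := fun j => congrArg (fun v : Space m k => v j) h
  ext j
  rcases j with i | j
  · have := h0 (Sum.inl i)
    simp only [gaugeD, mul_eq_zero, hg, false_or] at this
    rcases this with h1 | h1
    · rw [Real.rpow_eq_zero (norm_nonneg _) (by positivity), norm_eq_zero] at h1
      exact congrArg (fun v => v i) h1
    · exact h1
  · have := h0 (Sum.inr j)
    have hα1 : 4 * (α + 1) ≠ 0 := by positivity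
    simp only [gaugeD, mul_eq_zero, hg, false_or, hα1] at this
    exact this

theorem coeff_inr_sq (p : Space m k) (j : Fin k) :
    coeff α (Sum.inr j) p ^ 2 = ‖zPart p‖ ^ (2 * α) / 4 := by
  simp only [coeff, div_pow]
  rw [← Real.rpow_natCast, ← Real.rpow_mul (norm_nonneg _)]
  norm_num [mul_comm]

/-- With the common factor `ρ_α^(-4α-2) |z|^(2α)` taken out, the squares of the `X_j ρ_α` add up to
`|z|^(2(α+1)) + 4(α+1)^2 |t|^2 = ρ_α^(2(α+1))`. -/
theorem psi_eq (hα : 0 < α) {p : Space m k} (hp : p ≠ 0) :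
    psi α p = gauge α p ^ (-2 * α) * ‖zPart p‖ ^ (2 * α) := by
  have hg := gauge_pos hα hp
  have h1 : psi α p = ∑ j, (coeff α j p) ^ 2 * gaugeD α p j ^ 2 := by
    unfold psi classicalX
    simp_rw [partialD_gauge hα hp, mul_pow]
  have hz : (‖zPart p‖ ^ (2 * α)) * ‖zPart p‖ ^ 2 = ‖zPart p‖ ^ (2 * (α + 1)) := by
    rw [← Real.rpow_natCast, ← Real.rpow_add_of_nonneg (norm_nonneg _) (by positivity)
      (by positivity)]
    congr 1
    push_cast
    ring
  rw [h1, Fintype.sum_sum_type]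
  simp_rw [coeff_inr_sq]
  simp only [coeff, gaugeD, mul_pow, one_pow, one_mul]
  simp_rw [← Finset.mul_sum]
  rw [← norm_zPart_sq, ← norm_tPart_sq]
  have e : gauge α p ^ (-2 * α) = (gauge α p ^ (-2 * α - 1)) ^ 2 * gaugePow α p := by
    rw [← gauge_rpow hα, ← Real.rpow_natCast, ← Real.rpow_mul hg.le, ← Real.rpow_add hg]
    congr 1
    push_cast
    ring
  rw [e, gaugePow, ← hz]
  ring

end Gauge

/-! ### Dilations, their Jacobian, and pseudo-balls. -/

section Dilation

variable {α : ℝ}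

@[simp] theorem dil_inl (l : ℝ) (p : Space m k) (i : Fin m) :
    dil α l p (Sum.inl i) = l * p (Sum.inl i) := rfl
@[simp] theorem dil_inr (l : ℝ) (p : Space m k) (j : Fin k) :
    dil α l p (Sum.inr j) = l ^ (α + 1) * p (Sum.inr j) := rfl

theorem zPart_dil (l : ℝ) (p : Space m k) : zPart (dil α l p) = l • zPart p := rfl
theorem tPart_dil (l : ℝ) (p : Space m k) : tPart (dil α l p) = l ^ (α + 1) • tPart p := rfl

theorem dil_one (p : Space m k) : dil α 1 p = p := by
  ext j
  rcases j with i | j <;> simp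

theorem dil_dil {s : ℝ} (hs : 0 ≤ s) {t : ℝ} (ht : 0 ≤ t) (p : Space m k) :
    dil α s (dil α t p) = dil α (s * t) p := by
  ext j
  rcases j with i | j
  · simp [mul_assoc]
  · simp [Real.mul_rpow hs ht, mul_assoc]

theorem dil_sub (l : ℝ) (p q : Space m k) : dil α l (p - q) = dil α l p - dil α l q := by
  ext j
  rcases j with i | j
  · simp [mul_sub]
  · simp [mul_sub]

theorem norm_zPart_dil {l : ℝ} (hl : 0 ≤ l) (p : Space m k) :
    ‖zPart (dil α l p)‖ = l * ‖zPart p‖ := by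
  rw [zPart_dil, norm_smul, Real.norm_of_nonneg hl]

theorem gauge_dil (hα : 0 < α) {l : ℝ} (hl : 0 ≤ l) (p : Space m k) :
    gauge α (dil α l p) = l * gauge α p := by
  have h : gaugePow α (dil α l p) = l ^ (2 * (α + 1)) * gaugePow α p := by
    rw [gaugePow, norm_zPart_dil hl, tPart_dil, norm_smul,
      Real.norm_of_nonneg (Real.rpow_nonneg hl _), Real.mul_rpow hl (norm_nonneg _), mul_pow,
      ← Real.rpow_natCast (l ^ (α + 1)), ← Real.rpow_mul hl, gaugePow]
    push_cast
    rw [mul_comm (α + 1) 2]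
    ring
  rw [gauge_def, h, Real.mul_rpow (Real.rpow_nonneg hl _) (gaugePow_nonneg _ _), gauge_def,
    ← Real.rpow_mul hl, mul_one_div_cancel (by positivity), Real.rpow_one]

theorem continuous_dil_uncurry (hα : 0 < α) :
    Continuous fun x : ℝ × Space m k => dil α x.1 x.2 := by
  refine (PiLp.continuous_toLp 2 _).comp (continuous_pi fun j => ?_)
  rcases j with i | j
  · simp only [Sum.elim_inl]
    fun_prop
  · simp only [Sum.elim_inr]
    have : Continuous fun x : ℝ × Space m k => x.1 ^ (α + 1) :=
      continuous_fst.rpow_const fun _ => Or.inr (by positivity)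
    fun_prop

theorem continuous_dil (l : ℝ) : Continuous (dil α l : Space m k → _) := by
  refine (PiLp.continuous_toLp 2 _).comp (continuous_pi fun j => ?_)
  fun_prop

/-- The dilation as a homeomorphism. -/
def dilHomeo (α : ℝ) {l : ℝ} (hl : 0 < l) : Space m k ≃ₜ Space m k where
  toFun := dil α l
  invFun := dil α l⁻¹
  left_inv p := by
    rw [dil_dil (inv_pos.2 hl).le hl.le, inv_mul_cancel₀ hl.ne', dil_one]
  right_inv p := by
    rw [dil_dil hl.le (inv_pos.2 hl).le, mul_inv_cancel₀ hl.ne', dil_one]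
  continuous_toFun := continuous_dil l
  continuous_invFun := continuous_dil _

/-- The dilation is diagonal with determinant `l^m · l^((α+1)k) = l^Q`. -/
theorem volume_preimage_dil {l : ℝ} (hl : 0 < l) (A : Set (Space m k)) :
    volume (dil α l ⁻¹' A) = ENNReal.ofReal (l ^ (-homDim m k α)) * volume A := by
  set b := (EuclideanSpace.basisFun (Fin m ⊕ Fin k) ℝ).toBasis
  set L : Space m k →ₗ[ℝ] Space m k :=
    Matrix.toLin b b (Matrix.diagonal (Sum.elim (fun _ => l) (fun _ => l ^ (α + 1)))) with hLdef
  have hL : ∀ p, L p = dil α l p := by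
    intro p
    ext j
    rw [hLdef, Matrix.toLin_apply]
    rcases j with i | j <;> simp [Matrix.mulVec_diagonal, dil, b, Pi.single_apply]
  have hdet : LinearMap.det L = l ^ homDim m k α := by
    rw [hLdef, LinearMap.det_toLin, Matrix.det_diagonal, Fintype.prod_sum_type]
    simp only [Sum.elim_inl, Sum.elim_inr, Finset.prod_const, Finset.card_univ, Fintype.card_fin]
    rw [homDim, Real.rpow_add hl (m : ℝ), Real.rpow_natCast, Real.rpow_mul hl.le,
      Real.rpow_natCast (l ^ (α + 1))]
  have hpos : 0 < l ^ homDim m k α := Real.rpow_pos_of_pos hl _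
  have := Measure.addHaar_preimage_linearMap (volume : Measure (Space m k)) (f := L)
    (by rw [hdet]; exact hpos.ne') A
  rw [hdet, abs_of_pos (inv_pos.2 hpos), ← Real.rpow_neg hl.le] at this
  rw [← this]
  congr 1
  ext p
  simp [hL]

theorem isOpen_pball (hα : 0 < α) (r : ℝ) : IsOpen (pball m k α r) :=
  isOpen_lt (continuous_gauge hα) continuous_const

theorem psphere_eq (hα : 0 < α) {r : ℝ} (hr : 0 < r) :
    psphere m k α r = {p | gauge α p = r} := by
  refine Subset.antisymm (frontier_lt_subset_eq (continuous_gauge hα) continuous_const) ?_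
  intro p hp
  have hp' : gauge α p = r := hp
  rw [psphere, (isOpen_pball hα r).frontier_eq]
  refine ⟨?_, fun h => (show gauge α p < r from h).ne hp'⟩
  -- A point of the level set is the limit of its dilates with `l < 1`, which lie in the open
  -- pseudo-ball.
  have h1 : Tendsto (fun l : ℝ => dil α l p) (𝓝[<] 1) (𝓝 p) := by
    have : Continuous fun l : ℝ => dil α l p :=
      (continuous_dil_uncurry hα).comp (continuous_id.prodMk continuous_const)
    have h := this.tendsto 1
    rw [dil_one] at h
    exact h.mono_left nhdsWithin_le_nhds
  refine mem_closure_of_tendsto h1 ?_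
  filter_upwards [Ioo_mem_nhdsLT (zero_lt_one (α := ℝ))] with l hl
  show gauge α (dil α l p) < r
  rw [gauge_dil hα hl.1.le, hp']
  nlinarith [hl.2]

theorem isCompact_gauge_le (hα : 0 < α) (r : ℝ) : IsCompact {p : Space m k | gauge α p ≤ r} := by
  refine Metric.isCompact_of_isClosed_isBounded
    (isClosed_le (continuous_gauge hα) continuous_const) ?_
  rcases lt_or_ge r 0 with hr | hr
  · convert Bornology.isBounded_empty
    ext p
    simp only [mem_ofPred_eq, mem_empty_iff_false, iff_false, not_le]
    exact hr.trans_le (gauge_nonneg α p)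
  set C := r ^ (2 * (α + 1)) with hC
  have hb : ∀ p : Space m k, gauge α p ≤ r → gaugePow α p ≤ C := fun p hp => by
    rw [← gauge_rpow hα]
    exact Real.rpow_le_rpow (gauge_nonneg _ _) hp (by positivity)
  refine (isBounded_iff_forall_norm_le).2 ⟨√(r ^ 2 + C), fun p hp => ?_⟩
  have h1 := hb p hp
  apply Real.le_sqrt_of_sq_le
  have h2 : ‖p‖ ^ 2 = ‖zPart p‖ ^ 2 + ‖tPart p‖ ^ 2 := by
    rw [EuclideanSpace.norm_sq_eq, Fintype.sum_sum_type, norm_zPart_sq, norm_tPart_sq]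
    simp
  have hz : ‖zPart p‖ ≤ r := by
    have h0 : 0 ≤ 4 * (α + 1) ^ 2 * ‖tPart p‖ ^ 2 := by positivity
    have : ‖zPart p‖ ^ (2 * (α + 1)) ≤ r ^ (2 * (α + 1)) := by
      unfold gaugePow at h1
      linarith
    exact (Real.rpow_le_rpow_iff (norm_nonneg _) hr (by positivity)).1 this
  have ht : ‖tPart p‖ ^ 2 ≤ C := by
    have h0 : 0 ≤ ‖zPart p‖ ^ (2 * (α + 1)) := by positivity
    unfold gaugePow at h1
    nlinarith [sq_nonneg ‖tPart p‖, mul_nonneg hα.le (sq_nonneg ‖tPart p‖),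
      mul_nonneg (sq_nonneg α) (sq_nonneg ‖tPart p‖)]
  rw [h2]
  gcongr

/-- As `m ≥ 1`, the set `z = 0` is a proper linear subspace. -/
theorem volume_zPart_eq_zero (hm : 1 ≤ m) : volume {p : Space m k | zPart p = 0} = 0 := by
  have : {p : Space m k | zPart p = 0} = (LinearMap.ker (zLin (m := m) (k := k)).toLinearMap :
      Submodule ℝ (Space m k)) := by
    ext p; simp [zLin_apply]
  rw [this]
  refine Measure.addHaar_submodule _ _ fun h => ?_
  have h1 : (EuclideanSpace.single (Sum.inl ⟨0, hm⟩) 1 : Space m k) ∈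
      LinearMap.ker (zLin (m := m) (k := k)).toLinearMap := by rw [h]; trivial
  have h2 : zPart (EuclideanSpace.single (Sum.inl ⟨0, hm⟩) 1 : Space m k) ⟨0, hm⟩ = 0 := by
    have : zPart (EuclideanSpace.single (Sum.inl ⟨0, hm⟩) 1 : Space m k) = 0 := h1
    rw [this]; rfl
  simp at h2

theorem ae_zPart_ne_zero (hm : 1 ≤ m) : ∀ᵐ p : Space m k, zPart p ≠ 0 :=
  measure_eq_zero_iff_ae_notMem.1 (volume_zPart_eq_zero hm)

end Dilation

end Baouendi

namespace Baouendi
variable {m k : ℕ}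

open Filter Topology Metric

/-! ### Polar coordinates adapted to the dilations. -/

section Polar

variable {α : ℝ}

theorem homDim_pos (hm : 1 ≤ m) (hα : 0 < α) : 0 < homDim m k α := by
  have : (1 : ℝ) ≤ m := by exact_mod_cast hm
  have : 0 ≤ (α + 1) * k := by positivity
  unfold homDim
  linarith

/-- The point of the unit pseudo-sphere on the dilation orbit of `p`. -/
def unitPoint (α : ℝ) (p : Space m k) : Space m k := dil α (gauge α p)⁻¹ p

theorem unitPoint_dil (hα : 0 < α) {l : ℝ} (hl : 0 < l) (p : Space m k) :
    unitPoint α (dil α l p) = unitPoint α p := by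
  rw [unitPoint, gauge_dil hα hl.le, dil_dil (by have := gauge_nonneg α p; positivity) hl.le,
    unitPoint]
  congr 1
  field_simp

theorem gauge_unitPoint (hα : 0 < α) {p : Space m k} (hp : p ≠ 0) : gauge α (unitPoint α p) = 1 := by
  rw [unitPoint, gauge_dil hα (inv_nonneg.2 (gauge_nonneg _ _)),
    inv_mul_cancel₀ (gauge_pos hα hp).ne']

theorem dil_gauge_unitPoint (hα : 0 < α) {p : Space m k} (hp : p ≠ 0) :
    dil α (gauge α p) (unitPoint α p) = p := by
  have h := gauge_pos hα hp
  rw [unitPoint, dil_dil h.le (inv_nonneg.2 h.le), mul_inv_cancel₀ h.ne', dil_one]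

theorem measurable_unitPoint (hα : 0 < α) : Measurable (unitPoint α : Space m k → _) :=
  (continuous_dil_uncurry hα).measurable.comp
    ((continuous_gauge hα).measurable.inv.prodMk measurable_id)

/-- The surface part of Lebesgue measure in the polar coordinates of the dilations. -/
def polarMeasure (m k : ℕ) (α : ℝ) : Measure (Space m k) :=
  ENNReal.ofReal (homDim m k α) • (volume.restrict (pball m k α 1)).map (unitPoint α)

/-- The radial part of Lebesgue measure in the polar coordinates of the dilations. -/
def radialMeasure (m k : ℕ) (α : ℝ) : Measure ℝ :=
  (volume.restrict (Ioi 0)).withDensity fun s => ENNReal.ofReal (s ^ (homDim m k α - 1))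

theorem volume_pball_lt_top (hα : 0 < α) (r : ℝ) : volume (pball m k α r) < ⊤ :=
  (measure_mono (fun p (hp : gauge α p < r) => hp.le)).trans_lt
    (isCompact_gauge_le hα r).measure_lt_top

theorem isFiniteMeasure_polarMeasure (hα : 0 < α) : IsFiniteMeasure (polarMeasure m k α) := by
  have : IsFiniteMeasure (volume.restrict (pball m k α 1)) :=
    ⟨by rw [Measure.restrict_apply_univ]; exact volume_pball_lt_top hα 1⟩
  unfold polarMeasure
  exact Measure.smul_finite _ ENNReal.ofReal_ne_top

theorem polarMeasure_apply (hα : 0 < α) {A : Set (Space m k)} (hA : MeasurableSet A) :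
    polarMeasure m k α A =
      ENNReal.ofReal (homDim m k α) * volume (unitPoint α ⁻¹' A ∩ pball m k α 1) := by
  rw [polarMeasure, Measure.smul_apply, Measure.map_apply (measurable_unitPoint hα) hA,
    Measure.restrict_apply (measurable_unitPoint hα hA), smul_eq_mul]

/-- A preimage under `unitPoint` is a cone, invariant under dilations, so only the Jacobian `s^Q`
appears. -/
theorem volume_cone_inter_pball (hα : 0 < α) (A : Set (Space m k)) {s : ℝ} (hs : 0 < s) :
    volume (unitPoint α ⁻¹' A ∩ pball m k α s) =
      ENNReal.ofReal (s ^ homDim m k α) * volume (unitPoint α ⁻¹' A ∩ pball m k α 1) := by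
  have h : dil α s ⁻¹' (unitPoint α ⁻¹' A ∩ pball m k α s) =
      unitPoint α ⁻¹' A ∩ pball m k α 1 := by
    ext p
    simp only [mem_preimage, mem_inter_iff, unitPoint_dil hα hs, pball, mem_ofPred_eq,
      gauge_dil hα hs.le]
    rw [mul_lt_iff_lt_one_right hs]
  rw [← h, volume_preimage_dil hs, ← mul_assoc, ← ENNReal.ofReal_mul (by positivity),
    ← Real.rpow_add hs, add_neg_cancel, Real.rpow_zero, ENNReal.ofReal_one, one_mul]

theorem radialMeasure_Ioo (hm : 1 ≤ m) (hα : 0 < α) {a b : ℝ} (ha : 0 ≤ a) (hab : a ≤ b) :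
    radialMeasure m k α (Ioo a b) =
      ENNReal.ofReal ((b ^ homDim m k α - a ^ homDim m k α) / homDim m k α) := by
  have hQ := homDim_pos (k := k) hm hα
  have hsub : Ioo a b ⊆ Ioi 0 := fun x hx => ha.trans_lt hx.1
  rw [radialMeasure, withDensity_apply _ measurableSet_Ioo, Measure.restrict_restrict
    measurableSet_Ioo, inter_eq_left.2 hsub,
    ← ofReal_integral_eq_lintegral_ofReal]
  · rw [← integral_Ioc_eq_integral_Ioo, ← intervalIntegral.integral_of_le hab, integral_rpow]
    · rw [sub_add_cancel]
    · left; linarith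
  · have := (intervalIntegral.intervalIntegrable_rpow' (a := a) (b := b)
      (r := homDim m k α - 1) (by linarith)).1
    exact this.mono_set Ioo_subset_Ioc_self
  · filter_upwards [ae_restrict_mem measurableSet_Ioo] with x hx
    exact Real.rpow_nonneg (hsub hx).le _

theorem radialMeasure_Iio (b : ℝ) :
    radialMeasure m k α (Iio b) = radialMeasure m k α (Ioo 0 b) := by
  have h0 : radialMeasure m k α (Iic 0) = 0 := by
    rw [radialMeasure, withDensity_apply _ measurableSet_Iic, Measure.restrict_restrict
      measurableSet_Iic, Iic_inter_Ioi, Ioc_self, Measure.restrict_empty, lintegral_zero_measure]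
  refine le_antisymm ?_ (measure_mono fun x hx => hx.2)
  calc radialMeasure m k α (Iio b) ≤ radialMeasure m k α (Iic 0 ∪ Ioo 0 b) := by
        refine measure_mono fun x hx => ?_
        rcases le_or_gt x 0 with h | h
        · exact Or.inl h
        · exact Or.inr ⟨h, hx⟩
    _ ≤ _ := (measure_union_le _ _).trans (by rw [h0, zero_add])

theorem volume_singleton_zero (hm : 1 ≤ m) : volume ({0} : Set (Space m k)) = 0 :=
  measure_mono_null (fun p hp => by rw [mem_singleton_iff.1 hp]; rfl) (volume_zPart_eq_zero hm)

theorem ae_ne_zero (hm : 1 ≤ m) : ∀ᵐ p : Space m k, p ≠ 0 :=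
  measure_eq_zero_iff_ae_notMem.1 (volume_singleton_zero hm)

instance : SFinite (radialMeasure m k α) := by unfold radialMeasure; infer_instance

theorem sigmaFinite_radialMeasure : SigmaFinite (radialMeasure m k α) := by
  unfold radialMeasure
  exact SigmaFinite.withDensity_ofReal _

/-- Lebesgue measure in the polar coordinates of the dilations. -/
theorem map_polar_volume (hm : 1 ≤ m) (hα : 0 < α) :
    (volume : Measure (Space m k)).map (fun p => (unitPoint α p, gauge α p)) =
      (polarMeasure m k α).prod (radialMeasure m k α) := by
  have := isFiniteMeasure_polarMeasure (m := m) (k := k) hα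
  have := sigmaFinite_radialMeasure (m := m) (k := k) (α := α)
  have hgm : Measurable (gauge α : Space m k → ℝ) := (continuous_gauge hα).measurable
  have hum : Measurable (unitPoint α : Space m k → _) := measurable_unitPoint hα
  have hQ := homDim_pos (k := k) hm hα
  symm
  refine Measure.prod_eq fun A B hA hB => ?_
  rw [Measure.map_apply (hum.prodMk hgm) (hA.prod hB)]
  -- With `A` fixed these are measures in the radial variable alone. They need only be compared on
  -- the π-system of half-lines, where the claim is the scaling of cones.
  have key : (volume.restrict (unitPoint α ⁻¹' A)).map (gauge α) =
      polarMeasure m k α A • radialMeasure m k α := by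
    have hIio : ∀ b : ℝ, (volume.restrict (unitPoint α ⁻¹' A)).map (gauge α) (Iio b) =
        (polarMeasure m k α A • radialMeasure m k α) (Iio b) := by
      intro b
      rw [Measure.map_apply hgm measurableSet_Iio, Measure.restrict_apply (hgm measurableSet_Iio),
        Measure.smul_apply, radialMeasure_Iio]
      have e : gauge α ⁻¹' Iio b ∩ unitPoint α ⁻¹' A = unitPoint α ⁻¹' A ∩ pball m k α b :=
        inter_comm _ _
      rw [e]
      rcases le_or_gt b 0 with hb | hb
      · have : pball m k α b = ∅ := by
          ext p
          simp only [pball, mem_ofPred_eq, mem_empty_iff_false, iff_false, not_lt]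
          exact hb.trans (gauge_nonneg α p)
        rw [this, Ioo_eq_empty (not_lt.2 hb)]
        simp
      · rw [volume_cone_inter_pball hα A hb, radialMeasure_Ioo hm hα le_rfl hb.le,
          polarMeasure_apply hα hA, Real.zero_rpow hQ.ne', sub_zero, smul_eq_mul, mul_right_comm,
          ← ENNReal.ofReal_mul hQ.le, mul_div_cancel₀ _ hQ.ne']
    refine Measure.ext_of_generateFrom_of_iUnion (range Iio) (fun n : ℕ => Iio (n : ℝ))
      (borel_eq_generateFrom_Iio ℝ ▸ BorelSpace.measurable_eq) isPiSystem_Iio ?_ ?_ ?_ ?_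
    · exact iUnion_eq_univ_iff.2 fun x => exists_nat_gt x
    · exact fun n => mem_range_self _
    · intro n
      rw [Measure.map_apply hgm measurableSet_Iio]
      refine ne_of_lt (lt_of_le_of_lt ?_ (volume_pball_lt_top (m := m) (k := k) hα n))
      exact Measure.restrict_apply_le _ _
    · rintro _ ⟨b, rfl⟩
      exact hIio b
  have h := congrArg (fun μ => μ B) key
  simp only [Measure.smul_apply, smul_eq_mul] at h
  rw [← h, Measure.map_apply hgm hB, Measure.restrict_apply (hgm hB), inter_comm]
  rfl

theorem volume_polar_rect (hm : 1 ≤ m) (hα : 0 < α) {A : Set (Space m k)} (hA : MeasurableSet A)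
    {B : Set ℝ} (hB : MeasurableSet B) :
    volume (unitPoint α ⁻¹' A ∩ gauge α ⁻¹' B) =
      polarMeasure m k α A * radialMeasure m k α B := by
  have := sigmaFinite_radialMeasure (m := m) (k := k) (α := α)
  rw [← Measure.prod_prod, ← map_polar_volume hm hα, Measure.map_apply
    ((measurable_unitPoint hα).prodMk (continuous_gauge hα).measurable) (hA.prod hB)]
  rfl

/-- Integration in the polar coordinates of the dilations. -/
theorem integral_polar (hm : 1 ≤ m) (hα : 0 < α) {f : Space m k → ℝ} (hf : Measurable f)
    (hi : Integrable f) :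
    ∫ p, f p = ∫ s in Ioi 0, s ^ (homDim m k α - 1) *
      ∫ ξ, f (dil α s ξ) ∂(polarMeasure m k α) := by
  have := isFiniteMeasure_polarMeasure (m := m) (k := k) hα
  have hΦ : Measurable fun p : Space m k => (unitPoint α p, gauge α p) :=
    (measurable_unitPoint hα).prodMk (continuous_gauge hα).measurable
  set g : Space m k × ℝ → ℝ := fun x => f (dil α x.2 x.1) with hg
  have hgm : Measurable g :=
    hf.comp ((continuous_dil_uncurry hα).measurable.comp (measurable_snd.prodMk measurable_fst))
  have hfg : f =ᵐ[volume] fun p => g (unitPoint α p, gauge α p) := by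
    filter_upwards [ae_ne_zero hm] with p hp
    rw [hg]
    simp only [dil_gauge_unitPoint hα hp]
  have hgi : Integrable g ((polarMeasure m k α).prod (radialMeasure m k α)) := by
    rw [← map_polar_volume hm hα, integrable_map_measure hgm.aestronglyMeasurable hΦ.aemeasurable]
    exact hi.congr hfg
  rw [integral_congr_ae hfg, ← integral_map hΦ.aemeasurable hgm.aestronglyMeasurable,
    map_polar_volume hm hα, integral_prod_symm _ hgi, radialMeasure,
    integral_withDensity_eq_integral_toReal_smul (by fun_prop) (by simp)]
  refine setIntegral_congr_fun measurableSet_Ioi fun s hs => ?_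
  simp only [smul_eq_mul]
  rw [ENNReal.toReal_ofReal (Real.rpow_nonneg (le_of_lt hs) _)]

/-- Fubini in polar coordinates. It serves to pass from statements valid almost everywhere on every
pseudo-sphere to statements valid almost everywhere in a pseudo-ball. -/
theorem volume_eq_zero_of_polar (hm : 1 ≤ m) (hα : 0 < α) {N : Set (Space m k)}
    (hN : MeasurableSet N) (h : ∀ s > 0, polarMeasure m k α (dil α s ⁻¹' N) = 0) :
    volume N = 0 := by
  have := isFiniteMeasure_polarMeasure (m := m) (k := k) hα
  have hΦ : Measurable fun p : Space m k => (unitPoint α p, gauge α p) :=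
    (measurable_unitPoint hα).prodMk (continuous_gauge hα).measurable
  have hg : Measurable fun x : Space m k × ℝ => dil α x.2 x.1 :=
    (continuous_dil_uncurry hα).measurable.comp (measurable_snd.prodMk measurable_fst)
  have e : volume N = volume ((fun p : Space m k => (unitPoint α p, gauge α p)) ⁻¹'
      ((fun x : Space m k × ℝ => dil α x.2 x.1) ⁻¹' N)) := by
    refine measure_congr ?_
    filter_upwards [ae_ne_zero hm] with p hp
    refine propext ?_
    show p ∈ N ↔ dil α (gauge α p) (unitPoint α p) ∈ N
    rw [dil_gauge_unitPoint hα hp]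
  rw [e, ← Measure.map_apply hΦ (hg hN), map_polar_volume hm hα, Measure.prod_apply_symm (hg hN),
    radialMeasure, lintegral_withDensity_eq_lintegral_mul₀ (by fun_prop)
      (measurable_measure_prodMk_right (hg hN)).aemeasurable]
  refine (setLIntegral_congr_fun measurableSet_Ioi fun s hs => ?_).trans
    (lintegral_zero (μ := volume.restrict (Ioi (0 : ℝ))))
  simp only [Pi.mul_apply]
  rw [show (fun x => (x, s)) ⁻¹' ((fun x : Space m k × ℝ => dil α x.2 x.1) ⁻¹' N)
    = dil α s ⁻¹' N from rfl, h s hs, mul_zero]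

/-- The polar measure is a multiple of the image under `unitPoint` of Lebesgue measure on the unit
pseudo-ball, so its null sets can be recognized from the cones over them. -/
theorem ae_polarMeasure_of_ae (hα : 0 < α) {P : Space m k → Prop} (hP : MeasurableSet {p | P p})
    (h : ∀ᵐ p : Space m k, P (unitPoint α p)) : ∀ᵐ ξ ∂(polarMeasure m k α), P ξ := by
  refine Measure.ae_smul_measure ?_ _
  rw [ae_map_iff (measurable_unitPoint hα).aemeasurable hP]
  exact ae_restrict_of_ae h

theorem ae_polarMeasure_gauge (hm : 1 ≤ m) (hα : 0 < α) :
    ∀ᵐ ξ ∂(polarMeasure m k α), gauge α ξ = 1 := by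
  refine ae_polarMeasure_of_ae hα (measurableSet_eq_fun (continuous_gauge hα).measurable
    measurable_const) ?_
  filter_upwards [ae_ne_zero hm] with p hp using gauge_unitPoint hα hp

theorem ae_polarMeasure_zPart (hm : 1 ≤ m) (hα : 0 < α) :
    ∀ᵐ ξ ∂(polarMeasure m k α), zPart ξ ≠ 0 := by
  refine ae_polarMeasure_of_ae hα
    (isOpen_compl_singleton.preimage continuous_zPart).measurableSet ?_
  filter_upwards [ae_zPart_ne_zero hm, ae_ne_zero hm] with p hp hp0
  rw [unitPoint, zPart_dil]
  exact smul_ne_zero (inv_ne_zero (gauge_pos hα hp0).ne') hp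

end Polar

end Baouendi

namespace Baouendi
variable {m k : ℕ}

open Filter Topology Metric
open scoped NNReal ENNReal

/-! ### Slicing by parallel hyperplanes. -/

section Slices

variable {E : Type*} [NormedAddCommGroup E] [InnerProductSpace ℝ E] [FiniteDimensional ℝ E]
  [MeasurableSpace E] [BorelSpace E]

/-- Fubini's theorem for the hyperplanes orthogonal to a unit vector. -/
theorem volume_eq_lintegral_slices {d : ℕ} (hd : Module.finrank ℝ E = d + 1) {n : E}
    (hn : ‖n‖ = 1) {S : Set E} (hS : MeasurableSet S) :
    volume S = ∫⁻ c : ℝ, μHE[d] (S ∩ {x | inner ℝ n x = c}) := by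
  -- In an orthonormal basis beginning with `n` the claim is Fubini on `ℝ × ℝ^d`: each slice is an
  -- isometric copy of `ℝ^d`, where `μHE[d]` is Lebesgue measure.
  obtain ⟨b, hb⟩ : ∃ b : OrthonormalBasis (Fin (d + 1)) ℝ E, b 0 = n := by
    have hv : Orthonormal ℝ (({0} : Set (Fin (d + 1))).domRestrict fun _ => n) := by
      constructor
      · intro i; exact hn
      · intro i j hij
        exact absurd (Subsingleton.elim i j) hij
    obtain ⟨b, hb⟩ := hv.exists_orthonormalBasis_extension_of_card_eq (by simpa using hd)
    exact ⟨b, hb 0 rfl⟩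
  set J : ℝ × (Fin d → ℝ) → E := fun x =>
    b.repr.symm (WithLp.toLp 2 ((MeasurableEquiv.piFinSuccAbove (fun _ => ℝ) 0).symm x)) with hJ
  have hJp : MeasurePreserving J volume volume :=
    b.measurePreserving_repr_symm.comp ((PiLp.volume_preserving_toLp (Fin (d + 1))).comp
      (volume_preserving_piFinSuccAbove (fun _ => ℝ) (0 : Fin (d + 1))).symm)
  rw [← hJp.measure_preimage hS.nullMeasurableSet, Measure.volume_eq_prod,
    Measure.prod_apply (hJp.measurable hS)]
  refine lintegral_congr fun c => ?_
  have hiso : Isometry fun w : EuclideanSpace ℝ (Fin d) => J (c, WithLp.ofLp w) := by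
    refine b.repr.symm.isometry.comp ?_
    refine Isometry.of_dist_eq fun x y => ?_
    simp [EuclideanSpace.dist_eq, Fin.sum_univ_succ]
  have hpre : volume (Prod.mk c ⁻¹' (J ⁻¹' S)) =
      volume ((fun w : EuclideanSpace ℝ (Fin d) => J (c, WithLp.ofLp w)) ⁻¹' S) := by
    exact ((PiLp.volume_preserving_ofLp (Fin d)).measure_preimage (s := Prod.mk c ⁻¹' (J ⁻¹' S))
      (measurable_prodMk_left (hJp.measurable hS)).nullMeasurableSet).symm
  rw [hpre, ← EuclideanSpace.euclideanHausdorffMeasure_eq_volume,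
    hiso.euclideanHausdorffMeasure_preimage]
  congr 2
  ext x
  have hin : inner ℝ n x = b.repr x 0 := by rw [b.repr_apply_apply, hb]
  simp only [mem_range, mem_ofPred_eq, hin]
  constructor
  · rintro ⟨w, rfl⟩
    simp [hJ]
  · intro hx
    refine ⟨WithLp.toLp 2 fun i => b.repr x i.succ, ?_⟩
    rw [hJ]
    simp only
    rw [LinearIsometryEquiv.symm_apply_eq]
    ext i
    refine Fin.cases ?_ (fun i => ?_) i
    · simp [hx]
    · simp

end Slices

/-! ### Almost isometric maps and Hausdorff measure. -/

section Bilipschitz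

/-- `f` distorts distances on `s` at most by the factor `K`. -/
def BilipOn {X Y : Type*} [PseudoMetricSpace X] [PseudoMetricSpace Y] (K : ℝ≥0) (f : X → Y)
    (s : Set X) : Prop :=
  ∀ x ∈ s, ∀ y ∈ s, dist (f x) (f y) ≤ K * dist x y ∧ dist x y ≤ K * dist (f x) (f y)

variable {X Y Z : Type*} [MetricSpace X] [MetricSpace Y] [MetricSpace Z]

theorem BilipOn.mono {K : ℝ≥0} {f : X → Y} {s t : Set X} (h : BilipOn K f s) (hst : t ⊆ s) :
    BilipOn K f t := fun x hx y hy => h x (hst hx) y (hst hy)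

theorem BilipOn.injOn {K : ℝ≥0} {f : X → Y} {s : Set X} (h : BilipOn K f s) : InjOn f s := by
  intro x hx y hy hxy
  have := (h x hx y hy).2
  rw [hxy, dist_self, mul_zero] at this
  exact dist_le_zero.1 this

/-- A perturbation of the identity with Lipschitz constant `1 - 1/K` shrinks distances at most by
the factor `1/K` and stretches them at most by `2 - 1/K`, which is at most `K` because `(K - 1)^2 ≥
0`. -/
theorem bilipOn_of_near_id {E : Type*} [NormedAddCommGroup E] {K : ℝ≥0} (hK : 1 < K) {f : E → E}
    {s : Set E} (h : ∀ x ∈ s, ∀ y ∈ s, ‖f x - f y - (x - y)‖ ≤ (1 - 1 / K) * ‖x - y‖) :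
    BilipOn K f s := by
  intro x hx y hy
  have h1 := h x hx y hy
  have hK' : (1 : ℝ) < K := by exact_mod_cast hK
  rw [dist_eq_norm, dist_eq_norm]
  have h2 : ‖f x - f y‖ ≤ ‖x - y‖ + ‖f x - f y - (x - y)‖ := by
    simpa using norm_add_le (x - y) (f x - f y - (x - y))
  have h3 : ‖x - y‖ ≤ ‖f x - f y‖ + ‖f x - f y - (x - y)‖ := by
    simpa using norm_sub_le (f x - f y) (f x - f y - (x - y))
  have hn := norm_nonneg (x - y)
  have e : (K : ℝ) * (1 / K) = 1 := by field_simp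
  have hK2 : 2 - 1 / (K : ℝ) ≤ K := by
    have : (2 - 1 / (K : ℝ)) * K ≤ K * K := by nlinarith [sq_nonneg ((K : ℝ) - 1)]
    exact le_of_mul_le_mul_right this (by linarith)
  constructor
  · nlinarith
  · have h4 : 1 / (K : ℝ) * ‖x - y‖ ≤ ‖f x - f y‖ := by linarith
    calc ‖x - y‖ = K * (1 / (K : ℝ) * ‖x - y‖) := by rw [← mul_assoc, e, one_mul]
      _ ≤ _ := by gcongr

variable [MeasurableSpace X] [BorelSpace X] [MeasurableSpace Y] [BorelSpace Y]

theorem euclideanHausdorffMeasure_image_le_of_dist {K : ℝ≥0} {f : X → Y} {s : Set X} (d : ℕ)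
    (h : ∀ x ∈ s, ∀ y ∈ s, dist (f x) (f y) ≤ K * dist x y) :
    μHE[d] (f '' s) ≤ (K : ℝ≥0∞) ^ d * μHE[d] s := by
  have h1 : LipschitzOnWith K f s := LipschitzOnWith.of_dist_le_mul h
  have h2 := h1.hausdorffMeasure_image_le (d := d) (Nat.cast_nonneg d)
  rw [ENNReal.rpow_natCast] at h2
  simp only [Measure.euclideanHausdorffMeasure_def, Measure.smul_apply, ENNReal.smul_def,
    smul_eq_mul]
  rw [mul_left_comm]
  gcongr

theorem BilipOn.image_le {K : ℝ≥0} {f : X → Y} {s : Set X} (h : BilipOn K f s) (d : ℕ) :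
    μHE[d] (f '' s) ≤ (K : ℝ≥0∞) ^ d * μHE[d] s :=
  euclideanHausdorffMeasure_image_le_of_dist d fun x hx y hy => (h x hx y hy).1

/-- The inverse of `f` on the image is again `K`-Lipschitz. -/
theorem BilipOn.le_image {K : ℝ≥0} {f : X → Y} {s : Set X} (h : BilipOn K f s) (d : ℕ) :
    μHE[d] s ≤ (K : ℝ≥0∞) ^ d * μHE[d] (f '' s) := by
  rcases s.eq_empty_or_nonempty with rfl | ⟨x₀, hx₀⟩
  · simp
  have : Nonempty X := ⟨x₀⟩
  have hinv : LeftInvOn (Function.invFunOn f s) f s := h.injOn.leftInvOn_invFunOn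
  have e : Function.invFunOn f s '' (f '' s) = s := hinv.image_image
  conv_lhs => rw [← e]
  refine euclideanHausdorffMeasure_image_le_of_dist d ?_
  rintro _ ⟨x, hx, rfl⟩ _ ⟨y, hy, rfl⟩
  rw [hinv hx, hinv hy]
  exact (h x hx y hy).2

end Bilipschitz

/-! ### From local to global comparison of measures. -/

section Comparison

variable {X : Type*} [TopologicalSpace X] [SecondCountableTopology X] [MeasurableSpace X]
  [OpensMeasurableSpace X]

/-- By second countability, countably many of the neighbourhoods cover `S`; they cut `A` into
disjoint measurable pieces whose estimates are added, with no loss in the constant. -/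
theorem measure_le_mul_of_locally {μ ν : Measure X} {c : ℝ≥0∞} {S : Set X}
    (h : ∀ p ∈ S, ∃ U ∈ 𝓝 p, ∀ A ⊆ U ∩ S, MeasurableSet A → μ A ≤ c * ν A)
    {A : Set X} (hAS : A ⊆ S) (hA : MeasurableSet A) : μ A ≤ c * ν A := by
  choose! U hU hle using h
  obtain ⟨t, htS, htc, hcov⟩ := TopologicalSpace.countable_cover_nhdsWithin
    (f := fun p => interior (U p)) (s := S)
    fun p hp => mem_nhdsWithin_of_mem_nhds (interior_mem_nhds.2 (hU p hp))
  rcases t.eq_empty_or_nonempty with rfl | hne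
  · have : A = ∅ := subset_empty_iff.1 (hAS.trans (by simpa using hcov))
    simp [this]
  obtain ⟨e, rfl⟩ := htc.exists_eq_range hne
  set V : ℕ → Set X := fun n => A ∩ interior (U (e n)) with hV
  have hVm : ∀ n, MeasurableSet (V n) := fun n => hA.inter isOpen_interior.measurableSet
  have hAV : A = ⋃ n, disjointed V n := by
    rw [iUnion_disjointed, ← inter_iUnion]
    refine (inter_eq_left.2 (hAS.trans ?_)).symm
    simpa using hcov
  have hdm : ∀ n, MeasurableSet (disjointed V n) := fun n => MeasurableSet.disjointed hVm n
  rw [hAV, measure_iUnion (disjoint_disjointed V) hdm, measure_iUnion (disjoint_disjointed V) hdm,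
    ← ENNReal.tsum_mul_left]
  refine ENNReal.tsum_le_tsum fun n => hle (e n) (htS (mem_range_self n)) _ ?_ (hdm n)
  intro x hx
  have := disjointed_subset V n hx
  exact ⟨interior_subset this.2, hAS this.1⟩

/-- A local comparison with ratio `K^N` for every `K > 1` becomes exact as `K` tends to `1`. This is
why the bounds below only have to be tracked up to powers of `K`. -/
theorem measure_le_of_locally {μ ν : Measure X} {S : Set X} (N : ℕ)
    (h : ∀ K : ℝ≥0, 1 < K → ∀ p ∈ S, ∃ U ∈ 𝓝 p, ∀ A ⊆ U ∩ S, MeasurableSet A →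
      μ A ≤ (K : ℝ≥0∞) ^ N * ν A)
    {A : Set X} (hAS : A ⊆ S) (hA : MeasurableSet A) : μ A ≤ ν A := by
  have h1 : ∀ K : ℝ≥0, 1 < K → μ A ≤ (K : ℝ≥0∞) ^ N * ν A := fun K hK =>
    measure_le_mul_of_locally (h K hK) hAS hA
  have h2 : Tendsto (fun K : ℝ≥0 => (K : ℝ≥0∞) ^ N * ν A) (𝓝[>] 1) (𝓝 (1 * ν A)) := by
    refine ENNReal.Tendsto.mul_const ?_ (Or.inl one_ne_zero)
    have : Continuous fun K : ℝ≥0 => (K : ℝ≥0∞) ^ N := by fun_prop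
    have h := this.tendsto 1
    simp only [ENNReal.coe_one, one_pow] at h
    exact h.mono_left nhdsWithin_le_nhds
  rw [one_mul] at h2
  refine ge_of_tendsto h2 ?_
  filter_upwards [self_mem_nhdsWithin] with K hK using h1 K hK

end Comparison

end Baouendi

namespace Baouendi
variable {m k : ℕ}

open Filter Topology Metric
open scoped NNReal ENNReal

/-! ### Hausdorff measure on level sets of the gauge in polar coordinates. -/

section Surface

variable {α : ℝ}

/-- `F` replaces the component of `x - p₀` along the unit normal `n` by `(ρ_α(x) - ρ_α(p₀)) /
|∇ρ_α(p₀)|`. Level sets of the gauge thus go into hyperplanes orthogonal to `n`, and the strict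
derivative of `F` at `p₀` is the identity, so `F` is `K`-bi-Lipschitz near `p₀`. -/
theorem exists_flattening (hα : 0 < α) {p₀ : Space m k} (hp₀ : p₀ ≠ 0) {K : ℝ≥0} (hK : 1 < K) :
    ∃ (n : Space m k) (F : Space m k → Space m k), ‖n‖ = 1 ∧ Continuous F ∧
      (∀ x, inner ℝ n (F x) = (gauge α x - gauge α p₀) / ‖gaugeGrad α p₀‖) ∧
      ∃ V ∈ 𝓝 p₀, BilipOn K F V := by
  set G := gaugeGrad α p₀
  set g := ‖G‖ with hg
  have hgpos : 0 < g := norm_pos_iff.2 (gaugeGrad_ne_zero hα hp₀)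
  set n : Space m k := g⁻¹ • G with hn
  have hn1 : ‖n‖ = 1 := by
    rw [hn, norm_smul, Real.norm_of_nonneg (inv_pos.2 hgpos).le, ← hg, inv_mul_cancel₀ hgpos.ne']
  set F : Space m k → Space m k := fun x =>
    (x - p₀) + ((gauge α x - gauge α p₀) / g - inner ℝ n (x - p₀)) • n with hF
  have hcg := continuous_gauge (m := m) (k := k) hα
  refine ⟨n, F, hn1, by fun_prop, fun x => ?_, ?_⟩
  · rw [hF]
    simp only
    rw [inner_add_right, inner_smul_right, real_inner_self_eq_norm_sq, hn1]
    ring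
  have hd : HasStrictFDerivAt F (ContinuousLinearMap.id ℝ (Space m k)) p₀ := by
    have h1 : HasStrictFDerivAt (fun x : Space m k => x - p₀) (ContinuousLinearMap.id ℝ _) p₀ :=
      (hasStrictFDerivAt_id p₀).sub_const p₀
    have h2 : HasStrictFDerivAt (fun x : Space m k => (gauge α x - gauge α p₀) / g)
        (g⁻¹ • coordForm (gaugeD α p₀)) p₀ := by
      have := ((hasStrictFDerivAt_gauge hα hp₀).sub_const (gauge α p₀)).mul_const g⁻¹
      simpa only [div_eq_mul_inv] using this
    have h3 : HasStrictFDerivAt (fun x : Space m k => inner ℝ n (x - p₀)) (innerSL ℝ n) p₀ :=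
      (innerSL ℝ n).hasStrictFDerivAt.comp p₀ h1
    have h4 := h1.add ((h2.sub h3).smul_const n)
    refine h4.congr_fderiv ?_
    ext1 x
    have : g⁻¹ * inner ℝ G x = inner ℝ n x := by
      rw [hn, inner_smul_left]; rfl
    change g⁻¹ * inner ℝ (gaugeGrad α p₀) x = inner ℝ n x at this
    simp [coordForm_gaugeD_apply, this]
  have hε : 0 < (1 : ℝ) - 1 / K := by
    have : (1 : ℝ) < K := by exact_mod_cast hK
    rw [sub_pos, div_lt_one (by linarith)]
    exact this
  have hlo := hd.isLittleO
  have hb := hlo.def hε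
  rw [nhds_prod_eq] at hb
  obtain ⟨V, hV, hVb⟩ := mem_prod_same_iff.1 hb
  exact ⟨V, hV, bilipOn_of_near_id hK fun x hx y hy => by
    simpa using hVb (mk_mem_prod hx hy)⟩

theorem norm_dil_sub_le (l : ℝ) (v : Space m k) :
    ‖dil α l v - v‖ ≤ (|l - 1| + |l ^ (α + 1) - 1|) * ‖v‖ := by
  set C := |l - 1| + |l ^ (α + 1) - 1|
  have hC : 0 ≤ C := by positivity
  refine le_of_sq_le_sq ?_ (by positivity) |>.trans_eq rfl
  rw [mul_pow, EuclideanSpace.norm_sq_eq, EuclideanSpace.norm_sq_eq, Finset.mul_sum]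
  refine Finset.sum_le_sum fun j _ => ?_
  rw [← mul_pow]
  refine pow_le_pow_left₀ (norm_nonneg _) ?_ 2
  rcases j with i | j
  · have : (dil α l v - v) (Sum.inl i) = (l - 1) * v (Sum.inl i) := by simp; ring
    rw [this, norm_mul, Real.norm_eq_abs (l - 1)]
    gcongr
    exact le_add_of_nonneg_right (abs_nonneg _)
  · have : (dil α l v - v) (Sum.inr j) = (l ^ (α + 1) - 1) * v (Sum.inr j) := by simp; ring
    rw [this, norm_mul, Real.norm_eq_abs (l ^ (α + 1) - 1)]
    gcongr
    exact le_add_of_nonneg_left (abs_nonneg _)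

/-- Since dilations are linear, their distance to the identity is controlled on the whole space by
`|l - 1| + |l^(α+1) - 1|`. -/
theorem eventually_bilipOn_dil (hα : 0 < α) {K : ℝ≥0} (hK : 1 < K) :
    ∀ᶠ l : ℝ in 𝓝 1, BilipOn K (dil α l : Space m k → _) univ := by
  have hε : 0 < (1 : ℝ) - 1 / K := by
    have : (1 : ℝ) < K := by exact_mod_cast hK
    rw [sub_pos, div_lt_one (by linarith)]
    exact this
  have hc : Continuous fun l : ℝ => |l - 1| + |l ^ (α + 1) - 1| := by
    have : Continuous fun l : ℝ => l ^ (α + 1) :=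
      continuous_id.rpow_const fun _ => Or.inr (by positivity)
    fun_prop
  have ht := hc.tendsto 1
  simp only [sub_self, abs_zero, Real.one_rpow, add_zero] at ht
  filter_upwards [ht.eventually (gt_mem_nhds hε)] with l hl
  refine bilipOn_of_near_id hK fun x _ y _ => ?_
  rw [← dil_sub]
  exact (norm_dil_sub_le l _).trans (by gcongr)

theorem homDim_sub_one_nonneg (hm : 1 ≤ m) (hα : 0 < α) : 0 ≤ homDim m k α - 1 := by
  have : (1 : ℝ) ≤ m := by exact_mod_cast hm
  have : 0 ≤ (α + 1) * k := by positivity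
  unfold homDim
  linarith

/-- The density `s^(Q-1)` is nondecreasing because `Q ≥ 1`, and over this interval, of length `r η`,
it grows at most by the factor `(1 + η)^(Q-1)`. -/
theorem radialMeasure_bounds (hm : 1 ≤ m) (hα : 0 < α) {r η : ℝ} (hr : 0 < r) (hη : 0 < η)
    {K : ℝ≥0} (hK : (1 + η) ^ (homDim m k α - 1) ≤ K) :
    ENNReal.ofReal (r ^ (homDim m k α - 1)) * ENNReal.ofReal (r * η) ≤
      radialMeasure m k α (Ioo r (r * (1 + η))) ∧
    radialMeasure m k α (Ioo r (r * (1 + η))) ≤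
      K * (ENNReal.ofReal (r ^ (homDim m k α - 1)) * ENNReal.ofReal (r * η)) := by
  have hQ := homDim_sub_one_nonneg (k := k) hm hα
  have hv : volume (Ioo r (r * (1 + η))) = ENNReal.ofReal (r * η) := by
    rw [Real.volume_Ioo]; congr 1; ring
  have hsub : Ioo r (r * (1 + η)) ⊆ Ioi 0 := fun x hx => hr.trans hx.1
  rw [radialMeasure, withDensity_apply _ measurableSet_Ioo, Measure.restrict_restrict
    measurableSet_Ioo, inter_eq_left.2 hsub, ← hv, ← setLIntegral_const]
  constructor
  · refine setLIntegral_mono' measurableSet_Ioo fun s hs => ?_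
    exact ENNReal.ofReal_le_ofReal (Real.rpow_le_rpow hr.le hs.1.le hQ)
  · rw [setLIntegral_const, ← mul_assoc, ← setLIntegral_const]
    refine setLIntegral_mono' measurableSet_Ioo fun s hs => ?_
    rw [← ENNReal.ofReal_coe_nnreal, ← ENNReal.ofReal_mul K.coe_nonneg]
    refine ENNReal.ofReal_le_ofReal ?_
    calc s ^ (homDim m k α - 1) ≤ (r * (1 + η)) ^ (homDim m k α - 1) :=
          Real.rpow_le_rpow (hsub hs).le hs.2.le hQ
      _ = (1 + η) ^ (homDim m k α - 1) * r ^ (homDim m k α - 1) := by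
          rw [Real.mul_rpow hr.le (by positivity), mul_comm]
      _ ≤ _ := by gcongr

/-- The coarea measure on level sets of the gauge. -/
def levelMeasure (m k : ℕ) (α : ℝ) : Measure (Space m k) :=
  (surfaceMeasure m k).withDensity fun p => ENNReal.ofReal ‖gaugeGrad α p‖⁻¹

theorem levelMeasure_bounds {g : ℝ} (hg : 0 < g) {K : ℝ≥0} {A : Set (Space m k)}
    (hA : MeasurableSet A)
    (h : ∀ x ∈ A, 0 < ‖gaugeGrad α x‖ ∧ ‖gaugeGrad α x‖ ≤ K * g ∧ g ≤ K * ‖gaugeGrad α x‖) :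
    surfaceMeasure m k A * ENNReal.ofReal g⁻¹ ≤ K * levelMeasure m k α A ∧
    levelMeasure m k α A ≤ K * (surfaceMeasure m k A * ENNReal.ofReal g⁻¹) := by
  rw [levelMeasure, withDensity_apply _ hA]
  constructor
  · rw [← lintegral_const_mul' _ _ ENNReal.coe_ne_top, mul_comm, ← setLIntegral_const]
    refine setLIntegral_mono' hA fun x hx => ?_
    obtain ⟨h0, h1, -⟩ := h x hx
    rw [← ENNReal.ofReal_coe_nnreal, ← ENNReal.ofReal_mul K.coe_nonneg]
    refine ENNReal.ofReal_le_ofReal ?_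
    rw [inv_le_iff_one_le_mul₀ hg, mul_right_comm, ← div_eq_mul_inv, one_le_div h0]
    exact h1
  · rw [mul_comm (surfaceMeasure m k A), ← mul_assoc, ← setLIntegral_const]
    refine setLIntegral_mono' hA fun x hx => ?_
    obtain ⟨h0, -, h1⟩ := h x hx
    rw [← ENNReal.ofReal_coe_nnreal, ← ENNReal.ofReal_mul K.coe_nonneg]
    refine ENNReal.ofReal_le_ofReal ?_
    rw [inv_le_iff_one_le_mul₀ h0, mul_right_comm, ← div_eq_mul_inv, one_le_div hg]
    exact h1

/-- The shell of the dilates `δ_s A`, `1 < s < 1 + η`, of a subset `A` of the level set `r`. -/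
def shell (α r η : ℝ) (A : Set (Space m k)) : Set (Space m k) :=
  unitPoint α ⁻¹' (dil α r ⁻¹' A) ∩ gauge α ⁻¹' Ioo r (r * (1 + η))

/-- The shell is a union of dilates of `A`, and the gauge tells on which dilate a point lies. The
Fubini slices of the flattened shell are identified in this way. -/
theorem shell_inter_level (hα : 0 < α) {r η : ℝ} (hr : 0 < r) {A : Set (Space m k)}
    (hA : A ⊆ {p | gauge α p = r}) {s : ℝ} (hs : s ∈ Ioo 1 (1 + η)) :
    shell α r η A ∩ {p | gauge α p = s * r} = dil α s '' A := by
  have hs0 : 0 < s := zero_lt_one.trans hs.1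
  ext p
  constructor
  · rintro ⟨⟨h1, -⟩, h2⟩
    have h2 : gauge α p = s * r := h2
    have hp : p ≠ 0 := (gauge_pos_iff hα).1 (by rw [h2]; positivity)
    refine ⟨_, h1, ?_⟩
    rw [dil_dil hs0.le hr.le, ← h2, dil_gauge_unitPoint hα hp]
  · rintro ⟨a, ha, rfl⟩
    have hga : gauge α a = r := hA ha
    have ha0 : a ≠ 0 := (gauge_pos_iff hα).1 (by rw [hga]; exact hr)
    have hg : gauge α (dil α s a) = s * r := by rw [gauge_dil hα hs0.le, hga]
    refine ⟨⟨?_, ?_⟩, hg⟩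
    · show dil α r (unitPoint α (dil α s a)) ∈ A
      rw [unitPoint_dil hα hs0, ← hga, dil_gauge_unitPoint hα ha0]
      exact ha
    · show gauge α (dil α s a) ∈ Ioo r (r * (1 + η))
      rw [hg]
      exact (⟨by nlinarith [hs.1], by nlinarith [hs.2]⟩ : s * r ∈ Ioo r (r * (1 + η)))

theorem exists_mem_of_mem_shell (hα : 0 < α) {r η : ℝ} (hr : 0 < r) {A : Set (Space m k)}
    (hA : A ⊆ {p | gauge α p = r}) {p : Space m k} (hp : p ∈ shell α r η A) :
    ∃ s ∈ Ioo 1 (1 + η), gauge α p = s * r ∧ ∃ a ∈ A, dil α s a = p := by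
  have hg : gauge α p ∈ Ioo r (r * (1 + η)) := hp.2
  have hs : gauge α p / r ∈ Ioo 1 (1 + η) :=
    ⟨(one_lt_div hr).2 hg.1, (div_lt_iff₀ hr).2 (by linarith [hg.2])⟩
  have he : gauge α p = gauge α p / r * r := by field_simp
  refine ⟨_, hs, he, ?_⟩
  have : p ∈ shell α r η A ∩ {p' | gauge α p' = gauge α p / r * r} := ⟨hp, he⟩
  rw [shell_inter_level hα hr hA hs] at this
  exact this

/-- Fubini in the direction `n`: the slice of the flattened shell at height `c` is the image under
`F` of a dilate of `A`. Dilation and `F` each change its measure at most by `K^d`, where `d = m + k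
- 1`, and `c` runs through an interval of length `r η / g`. -/
theorem volume_flattened_shell (hm : 1 ≤ m) (hα : 0 < α) {r η g : ℝ} (hr : 0 < r)
    (hg : 0 < g) {A : Set (Space m k)} (hA : A ⊆ {p | gauge α p = r})
    {K : ℝ≥0} {n : Space m k} (hn : ‖n‖ = 1) {F : Space m k → Space m k}
    (hFn : ∀ x, inner ℝ n (F x) = (gauge α x - r) / g)
    (hB : MeasurableSet (F '' shell α r η A))
    (hbil : ∀ s ∈ Ioo 1 (1 + η), BilipOn K (dil α s) A ∧ BilipOn K F (dil α s '' A)) :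
    volume (F '' shell α r η A) ≤ (K : ℝ≥0∞) ^ (2 * (m + k - 1)) * surfaceMeasure m k A *
        ENNReal.ofReal (r * η / g) ∧
    surfaceMeasure m k A * ENNReal.ofReal (r * η / g) ≤
      (K : ℝ≥0∞) ^ (2 * (m + k - 1)) * volume (F '' shell α r η A) := by
  set d := m + k - 1 with hd
  have hfin : Module.finrank ℝ (Space m k) = d + 1 := by
    rw [finrank_euclideanSpace, Fintype.card_sum, Fintype.card_fin, Fintype.card_fin]
    omega
  rw [volume_eq_lintegral_slices hfin hn hB]
  -- Height `c` corresponds to the gauge value `r + g c`, that is, to the dilation factor `1 + g c /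
  -- r`.
  have hs : ∀ c ∈ Ioo 0 (r * η / g), 1 + g * c / r ∈ Ioo 1 (1 + η) := by
    intro c hc
    have h1 : g * c < r * η := by rw [mul_comm]; exact (lt_div_iff₀ hg).1 hc.2
    have h2 : 0 < g * c / r := div_pos (mul_pos hg hc.1) hr
    have h3 : g * c / r < η := (div_lt_iff₀ hr).2 (by linarith)
    constructor <;> linarith
  have hslice : ∀ c ∈ Ioo 0 (r * η / g), F '' shell α r η A ∩ {x | inner ℝ n x = c} =
      F '' (dil α (1 + g * c / r) '' A) := by
    intro c hc
    rw [← shell_inter_level hα hr hA (hs c hc), ← image_inter_preimage]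
    congr 2
    ext x
    show inner ℝ n (F x) = c ↔ gauge α x = (1 + g * c / r) * r
    rw [hFn, div_eq_iff hg.ne', add_mul, div_mul_cancel₀ _ hr.ne', sub_eq_iff_eq_add]
    constructor <;> intro h <;> linarith
  have hempty : ∀ c ∉ Ioo 0 (r * η / g), F '' shell α r η A ∩ {x | inner ℝ n x = c} = ∅ := by
    intro c hc
    refine eq_empty_of_forall_notMem ?_
    rintro _ ⟨⟨x, hx, rfl⟩, hxc⟩
    have hxc : inner ℝ n (F x) = c := hxc
    rw [hFn] at hxc
    have hgx : gauge α x ∈ Ioo r (r * (1 + η)) := hx.2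
    refine hc ⟨?_, ?_⟩
    · rw [← hxc]; exact div_pos (by linarith [hgx.1]) hg
    · rw [← hxc]; gcongr; linarith [hgx.2]
  have hup : ∀ c ∈ Ioo 0 (r * η / g), μHE[d] (F '' shell α r η A ∩ {x | inner ℝ n x = c}) ≤
      (K : ℝ≥0∞) ^ (2 * d) * surfaceMeasure m k A := by
    intro c hc
    obtain ⟨h1, h2⟩ := hbil _ (hs c hc)
    rw [hslice c hc, two_mul, pow_add, mul_assoc]
    exact (h2.image_le d).trans (mul_le_mul_right (h1.image_le d) _)
  have hlow : ∀ c ∈ Ioo 0 (r * η / g), surfaceMeasure m k A ≤ (K : ℝ≥0∞) ^ (2 * d) *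
      μHE[d] (F '' shell α r η A ∩ {x | inner ℝ n x = c}) := by
    intro c hc
    obtain ⟨h1, h2⟩ := hbil _ (hs c hc)
    rw [hslice c hc, two_mul, pow_add, mul_assoc]
    exact (h1.le_image d).trans (mul_le_mul_right (h2.le_image d) _)
  have hvol : volume (Ioo 0 (r * η / g)) = ENNReal.ofReal (r * η / g) := by
    rw [Real.volume_Ioo, sub_zero]
  have hsupp : ∫⁻ c : ℝ, μHE[d] (F '' shell α r η A ∩ {x | inner ℝ n x = c}) =
      ∫⁻ c in Ioo 0 (r * η / g), μHE[d] (F '' shell α r η A ∩ {x | inner ℝ n x = c}) := by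
    rw [← lintegral_indicator measurableSet_Ioo]
    refine lintegral_congr fun c => ?_
    by_cases hc : c ∈ Ioo 0 (r * η / g)
    · rw [indicator_of_mem hc]
    · rw [indicator_of_notMem hc, hempty c hc, measure_empty]
  rw [hsupp, ← hvol, ← setLIntegral_const, ← setLIntegral_const (Ioo 0 (r * η / g)) (surfaceMeasure m k A),
    ← lintegral_const_mul' _ _ (ENNReal.pow_ne_top ENNReal.coe_ne_top)]
  exact ⟨setLIntegral_mono' measurableSet_Ioo hup, setLIntegral_mono' measurableSet_Ioo hlow⟩

theorem measurableSet_shell (hα : 0 < α) {r η : ℝ} {A : Set (Space m k)} (hA : MeasurableSet A) :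
    MeasurableSet (shell α r η A) :=
  ((measurable_unitPoint hα) ((continuous_dil r).measurable hA)).inter
    ((continuous_gauge hα).measurable measurableSet_Ioo)

/-- The measure on the level set `r` of the gauge obtained from polar coordinates. -/
def polarLevelMeasure (m k : ℕ) (α r : ℝ) : Measure (Space m k) :=
  ENNReal.ofReal (r ^ (homDim m k α - 1)) • (polarMeasure m k α).map (dil α r)

theorem volume_shell_bounds (hm : 1 ≤ m) (hα : 0 < α) {r η : ℝ} (hr : 0 < r) (hη : 0 < η)
    {K : ℝ≥0} (hK : (1 + η) ^ (homDim m k α - 1) ≤ K) {A : Set (Space m k)}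
    (hA : MeasurableSet A) :
    polarLevelMeasure m k α r A * ENNReal.ofReal (r * η) ≤ volume (shell α r η A) ∧
    volume (shell α r η A) ≤
      K * (polarLevelMeasure m k α r A * ENNReal.ofReal (r * η)) := by
  have hmd := (continuous_dil (m := m) (k := k) (α := α) r).measurable
  obtain ⟨h1, h2⟩ := radialMeasure_bounds (k := k) hm hα hr hη hK
  rw [shell, volume_polar_rect hm hα (hmd hA) measurableSet_Ioo, polarLevelMeasure,
    Measure.smul_apply, Measure.map_apply hmd hA, smul_eq_mul, mul_right_comm, mul_comm _
    (polarMeasure m k α (dil α r ⁻¹' A)), mul_left_comm (K : ℝ≥0∞)]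
  exact ⟨mul_le_mul_right h1 _, mul_le_mul_right h2 _⟩

/-- The volume of a thin shell over `A` is computed twice: in polar coordinates it is about `r η`
times the polar measure of `A`, and after flattening it is about `r η / g` times the Hausdorff
measure of `A`. With `d = m + k - 1`, the errors are `K^(2d)` from the slices, `K^(d+1)` from the
volume of the flattened shell, one `K` from the radial density and one from replacing `|∇ρ_α|` by
its value `g` at `p₀`. -/
theorem locally_comparable (hm : 1 ≤ m) (hα : 0 < α) {r : ℝ} (hr : 0 < r) {p₀ : Space m k}
    (hp₀ : gauge α p₀ = r) {K : ℝ≥0} (hK : 1 < K) :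
    ∃ U ∈ 𝓝 p₀, ∀ A ⊆ U ∩ {p | gauge α p = r}, MeasurableSet A →
      polarLevelMeasure m k α r A ≤
        (K : ℝ≥0∞) ^ (3 * (m + k - 1) + 3) * levelMeasure m k α A ∧
      levelMeasure m k α A ≤
        (K : ℝ≥0∞) ^ (3 * (m + k - 1) + 3) * polarLevelMeasure m k α r A := by
  have hK1 : (1 : ℝ) < K := by exact_mod_cast hK
  have hp : p₀ ≠ 0 := (gauge_pos_iff hα).1 (by rw [hp₀]; exact hr)
  have hgpos : 0 < ‖gaugeGrad α p₀‖ := norm_pos_iff.2 (gaugeGrad_ne_zero hα hp)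
  obtain ⟨n, F, hn, hFc, hFn, V, hV, hFV⟩ := exists_flattening hα hp hK
  rw [hp₀] at hFn
  set g := ‖gaugeGrad α p₀‖ with hg
  have hVev : ∀ᶠ x : ℝ × Space m k in 𝓝 1 ×ˢ 𝓝 p₀, dil α x.1 x.2 ∈ V := by
    have h := (continuous_dil_uncurry (m := m) (k := k) hα).tendsto (1, p₀)
    rw [nhds_prod_eq] at h
    simp only [dil_one] at h
    exact h hV
  obtain ⟨W, hW, U₁, hU₁, hWU⟩ := mem_prod_iff.1 hVev
  have hpow : ∀ᶠ l : ℝ in 𝓝 1, l ^ (homDim m k α - 1) < K := by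
    have hc : Continuous fun l : ℝ => l ^ (homDim m k α - 1) :=
      continuous_id.rpow_const fun _ => Or.inr (homDim_sub_one_nonneg hm hα)
    have := hc.tendsto 1
    rw [Real.one_rpow] at this
    exact this.eventually (gt_mem_nhds hK1)
  obtain ⟨ε, hε, hball⟩ := Metric.eventually_nhds_iff_ball.1
    ((eventually_bilipOn_dil (m := m) (k := k) hα hK).and (hpow.and hW))
  have hgc : ContinuousAt (fun x : Space m k => ‖gaugeGrad α x‖) p₀ :=
    ((continuousOn_gaugeGrad hα).continuousAt (isOpen_compl_singleton.mem_nhds hp)).norm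
  have hU₂ : ∀ᶠ x in 𝓝 p₀, 0 < ‖gaugeGrad α x‖ ∧ ‖gaugeGrad α x‖ ≤ K * g ∧
      g ≤ K * ‖gaugeGrad α x‖ := by
    have h1 : ∀ᶠ x in 𝓝 p₀, ‖gaugeGrad α x‖ < K * g :=
      hgc.eventually (gt_mem_nhds (by nlinarith))
    have h2 : ∀ᶠ x in 𝓝 p₀, g / K < ‖gaugeGrad α x‖ :=
      hgc.eventually (lt_mem_nhds (by rw [div_lt_iff₀ (by linarith)]; nlinarith))
    filter_upwards [h1, h2] with x hx1 hx2
    refine ⟨lt_trans (by positivity) hx2, hx1.le, ?_⟩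
    rw [div_lt_iff₀ (by linarith)] at hx2
    linarith
  -- Half of `ε`, so that the endpoint `1 + η` still lies in the ball; the bound on the radial
  -- density is needed there.
  set η := ε / 2 with hη
  have hη0 : 0 < η := by positivity
  have hmem : ∀ s ∈ Ioc 1 (1 + η), s ∈ ball (1 : ℝ) ε := by
    intro s hs
    rw [mem_ball, Real.dist_eq, abs_of_pos (by linarith [hs.1])]
    linarith [hs.2]
  have hηK : (1 + η) ^ (homDim m k α - 1) ≤ K :=
    (hball _ (hmem _ ⟨by linarith, le_rfl⟩)).2.1.le
  refine ⟨U₁ ∩ {x | 0 < ‖gaugeGrad α x‖ ∧ ‖gaugeGrad α x‖ ≤ K * g ∧ g ≤ K * ‖gaugeGrad α x‖},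
    inter_mem hU₁ hU₂, fun A hA hAm => ?_⟩
  have hAr : A ⊆ {p | gauge α p = r} := fun a ha => (hA ha).2
  have hdV : ∀ s ∈ Ioo 1 (1 + η), dil α s '' A ⊆ V := by
    rintro s hs _ ⟨a, ha, rfl⟩
    exact hWU (mk_mem_prod (hball s (hmem s ⟨hs.1, hs.2.le⟩)).2.2 (hA ha).1.1)
  have hshV : shell α r η A ⊆ V := by
    intro p hp
    obtain ⟨s, hs, -, a, ha, rfl⟩ := exists_mem_of_mem_shell hα hr hAr hp
    exact hdV s hs (mem_image_of_mem _ ha)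
  have hFs : BilipOn K F (shell α r η A) := hFV.mono hshV
  have hBm : MeasurableSet (F '' shell α r η A) :=
    (measurableSet_shell hα hAm).image_of_continuousOn_injOn hFc.continuousOn hFs.injOn
  obtain ⟨a1, a2⟩ := volume_shell_bounds hm hα hr hη0 hηK hAm
  obtain ⟨b1, b2⟩ := volume_flattened_shell hm hα hr hgpos hAr hn hFn hBm fun s hs =>
    ⟨(hball s (hmem s ⟨hs.1, hs.2.le⟩)).1.mono (subset_univ _), hFV.mono (hdV s hs)⟩
  obtain ⟨c1, c2⟩ := levelMeasure_bounds hgpos hAm fun x hx => (hA hx).1.2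
  set d := m + k - 1 with hd
  have hfin : Module.finrank ℝ (Space m k) = d + 1 := by
    rw [finrank_euclideanSpace, Fintype.card_sum, Fintype.card_fin, Fintype.card_fin]
    omega
  have e1 := hFs.image_le (d + 1)
  have e2 := hFs.le_image (d + 1)
  rw [← hfin, InnerProductSpace.euclideanHausdorffMeasure_eq_volume, hfin] at e1 e2
  have hsplit : ENNReal.ofReal (r * η / g) = ENNReal.ofReal g⁻¹ * ENNReal.ofReal (r * η) := by
    rw [← ENNReal.ofReal_mul (inv_pos.2 hgpos).le, div_eq_inv_mul]
  have hx0 : ENNReal.ofReal (r * η) ≠ 0 := by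
    rw [ne_eq, ENNReal.ofReal_eq_zero, not_le]; positivity
  have hxt : ENNReal.ofReal (r * η) ≠ ⊤ := ENNReal.ofReal_ne_top
  have hK1' : (1 : ℝ≥0∞) ≤ K := by exact_mod_cast hK.le
  rw [hsplit, ← mul_assoc] at b1 b2
  constructor
  · rw [← ENNReal.mul_le_mul_iff_left hx0 hxt]
    calc polarLevelMeasure m k α r A * ENNReal.ofReal (r * η)
        ≤ (K : ℝ≥0∞) ^ (d + 1) * ((K : ℝ≥0∞) ^ (2 * d) * surfaceMeasure m k A *
          ENNReal.ofReal g⁻¹ * ENNReal.ofReal (r * η)) :=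
          a1.trans (e2.trans (mul_le_mul_right b1 _))
      _ = (K : ℝ≥0∞) ^ (3 * d + 1) * (surfaceMeasure m k A * ENNReal.ofReal g⁻¹) *
          ENNReal.ofReal (r * η) := by ring
      _ ≤ (K : ℝ≥0∞) ^ (3 * d + 1) * (K * levelMeasure m k α A) * ENNReal.ofReal (r * η) := by
          gcongr
      _ = (K : ℝ≥0∞) ^ (3 * d + 2) * levelMeasure m k α A * ENNReal.ofReal (r * η) := by ring
      _ ≤ _ := by
          gcongr
          norm_num
  · rw [← ENNReal.mul_le_mul_iff_left hx0 hxt]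
    calc levelMeasure m k α A * ENNReal.ofReal (r * η)
        ≤ K * (surfaceMeasure m k A * ENNReal.ofReal g⁻¹) * ENNReal.ofReal (r * η) := by gcongr
      _ = K * (surfaceMeasure m k A * ENNReal.ofReal g⁻¹ * ENNReal.ofReal (r * η)) := by ring
      _ ≤ K * ((K : ℝ≥0∞) ^ (2 * d) * ((K : ℝ≥0∞) ^ (d + 1) *
          (K * (polarLevelMeasure m k α r A * ENNReal.ofReal (r * η))))) := by
          exact mul_le_mul_right
            (b2.trans (mul_le_mul_right (e1.trans (mul_le_mul_right a2 _)) _)) _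
      _ = _ := by ring

theorem measurable_gaugeGrad (hα : 0 < α) : Measurable (gaugeGrad α : Space m k → _) := by
  refine (WithLp.measurable_toLp 2 _).comp (measurable_pi_lambda _ fun j => ?_)
  have hg : Measurable fun p : Space m k => gauge α p ^ (-2 * α - 1) :=
    (continuous_gauge hα).measurable.pow_const _
  have hz : Measurable fun p : Space m k => ‖zPart p‖ ^ (2 * α) :=
    continuous_zPart.norm.measurable.pow_const _
  rcases j with i | j
  · exact hg.mul (hz.mul (by fun_prop))
  · exact hg.mul (by fun_prop)

/-- The coarea measure on a level set of the gauge, in polar coordinates. -/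
theorem levelMeasure_restrict_psphere (hm : 1 ≤ m) (hα : 0 < α) {r : ℝ} (hr : 0 < r) :
    (levelMeasure m k α).restrict (psphere m k α r) = polarLevelMeasure m k α r := by
  have hS : MeasurableSet {p : Space m k | gauge α p = r} :=
    (isClosed_eq (continuous_gauge hα) continuous_const).measurableSet
  have hdm := (continuous_dil (m := m) (k := k) (α := α) r).measurable
  rw [psphere_eq hα hr]
  ext A hA
  -- The polar level measure is carried by the level set, so only subsets of the level set have to
  -- be compared.
  have hnull : polarLevelMeasure m k α r A =
      polarLevelMeasure m k α r (A ∩ {p | gauge α p = r}) := by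
    refine (measure_inter_conull ?_).symm
    have hae : ∀ᵐ p ∂(polarLevelMeasure m k α r), gauge α p = r := by
      refine Measure.ae_smul_measure ?_ _
      rw [ae_map_iff hdm.aemeasurable hS]
      filter_upwards [ae_polarMeasure_gauge hm hα] with p hp
      rw [gauge_dil hα hr.le, hp, mul_one]
    exact hae
  rw [Measure.restrict_apply hA, hnull]
  have hA' : MeasurableSet (A ∩ {p | gauge α p = r}) := hA.inter hS
  refine le_antisymm ?_ ?_
  · refine measure_le_of_locally (3 * (m + k - 1) + 3) (fun K hK p hp => ?_)
      inter_subset_right hA'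
    obtain ⟨U, hU, h⟩ := locally_comparable hm hα hr hp hK
    exact ⟨U, hU, fun B hB hBm => (h B hB hBm).2⟩
  · refine measure_le_of_locally (3 * (m + k - 1) + 3) (fun K hK p hp => ?_)
      inter_subset_right hA'
    obtain ⟨U, hU, h⟩ := locally_comparable hm hα hr hp hK
    exact ⟨U, hU, fun B hB hBm => (h B hB hBm).1⟩

end Surface

end Baouendi

namespace Baouendi
variable {m k : ℕ}

open Filter Topology Metric
open scoped NNReal ENNReal

/-! ### Weighted surface integrals in polar coordinates. -/

section SurfaceIntegral

variable {α : ℝ}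

theorem weight_eq (hα : 0 < α) {p : Space m k} (hp : p ≠ 0) :
    weight α p = ‖gaugeGrad α p‖⁻¹ * (gauge α p ^ (-2 * α) * ‖zPart p‖ ^ (2 * α)) := by
  rw [weight, psi_eq hα hp, gradient_gauge hα hp, div_eq_inv_mul]

theorem polarLevelMeasure_eq_withDensity (hm : 1 ≤ m) (hα : 0 < α) {r : ℝ} (hr : 0 < r) :
    ((surfaceMeasure m k).restrict (psphere m k α r)).withDensity
      (fun p => ENNReal.ofReal ‖gaugeGrad α p‖⁻¹) = polarLevelMeasure m k α r := by
  rw [← levelMeasure_restrict_psphere hm hα hr, levelMeasure, restrict_withDensity]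
  exact isClosed_frontier.measurableSet

theorem measurableSet_psphere (α r : ℝ) : MeasurableSet (psphere m k α r) :=
  isClosed_frontier.measurableSet

theorem measurableEmbedding_dil {r : ℝ} (hr : 0 < r) :
    MeasurableEmbedding (dil α r : Space m k → Space m k) :=
  (dilHomeo α hr).measurableEmbedding

theorem measurable_density (hα : 0 < α) :
    Measurable fun p : Space m k => ENNReal.ofReal ‖gaugeGrad α p‖⁻¹ :=
  (measurable_gaugeGrad hα).norm.inv.ennreal_ofReal

theorem mul_weight_eq_on_psphere (hα : 0 < α) {r : ℝ} (hr : 0 < r)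
    (f : Space m k → ℝ) : EqOn (fun p => f p * weight α p)
      (fun p => (ENNReal.ofReal ‖gaugeGrad α p‖⁻¹).toReal •
        (f p * (gauge α p ^ (-2 * α) * ‖zPart p‖ ^ (2 * α)))) (psphere m k α r) := by
  intro p hp
  rw [psphere_eq hα hr] at hp
  have hg : gauge α p = r := hp
  have hp0 : p ≠ 0 := (gauge_pos_iff hα).1 (by rw [hg]; exact hr)
  simp only [smul_eq_mul]
  rw [weight_eq hα hp0, ENNReal.toReal_ofReal (inv_nonneg.2 (norm_nonneg _))]
  ring

/-- The left side is `ψ_α(δ_r ξ)`: it is homogeneous of degree `0`, so the weight in polar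
coordinates does not depend on the radius. -/
theorem gauge_rpow_mul_norm_zPart_dil (hα : 0 < α) {r : ℝ} (hr : 0 < r) {p : Space m k}
    (hp : gauge α p = 1) :
    gauge α (dil α r p) ^ (-2 * α) * ‖zPart (dil α r p)‖ ^ (2 * α) = ‖zPart p‖ ^ (2 * α) := by
  rw [gauge_dil hα hr.le, hp, mul_one, norm_zPart_dil hr.le, Real.mul_rpow hr.le (norm_nonneg _),
    ← mul_assoc, ← Real.rpow_add hr, show -2 * α + 2 * α = 0 by ring, Real.rpow_zero, one_mul]

/-- Weighted surface integrals over a level set of the gauge, in polar coordinates. -/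
theorem integral_psphere_mul_weight (hm : 1 ≤ m) (hα : 0 < α) {r : ℝ} (hr : 0 < r)
    (f : Space m k → ℝ) :
    ∫ p in psphere m k α r, f p * weight α p ∂(surfaceMeasure m k) =
      r ^ (homDim m k α - 1) *
        ∫ ξ, f (dil α r ξ) * ‖zPart ξ‖ ^ (2 * α) ∂(polarMeasure m k α) := by
  -- The density is finite and the dilation is a measurable embedding, so both changes of measure
  -- hold for arbitrary `f`.
  rw [setIntegral_congr_fun (measurableSet_psphere α r) (mul_weight_eq_on_psphere hα hr f),
    ← integral_withDensity_eq_integral_toReal_smul (measurable_density hα) (by simp),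
    polarLevelMeasure_eq_withDensity hm hα hr, polarLevelMeasure, integral_smul_measure,
    (measurableEmbedding_dil hr).integral_map (μ := polarMeasure m k α),
    ENNReal.toReal_ofReal (Real.rpow_nonneg hr.le _), smul_eq_mul]
  congr 1
  refine integral_congr_ae ?_
  filter_upwards [ae_polarMeasure_gauge hm hα] with p hp
  rw [gauge_rpow_mul_norm_zPart_dil hα hr hp]

theorem integrableOn_psphere_mul_weight (hm : 1 ≤ m) (hα : 0 < α) {r : ℝ} (hr : 0 < r)
    (f : Space m k → ℝ)
    (h : Integrable (fun ξ => f (dil α r ξ) * ‖zPart ξ‖ ^ (2 * α)) (polarMeasure m k α)) :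
    IntegrableOn (fun p => f p * weight α p) (psphere m k α r) (surfaceMeasure m k) := by
  rw [integrableOn_congr_fun (mul_weight_eq_on_psphere hα hr f) (measurableSet_psphere α r),
    IntegrableOn, ← integrable_withDensity_iff_integrable_smul' (measurable_density hα) (by simp),
    polarLevelMeasure_eq_withDensity hm hα hr, polarLevelMeasure]
  refine Integrable.smul_measure ?_ ENNReal.ofReal_ne_top
  refine ((measurableEmbedding_dil hr).integrable_map_iff (μ := polarMeasure m k α)).2
    (h.congr ?_)
  filter_upwards [ae_polarMeasure_gauge hm hα] with p hp
  simp only [Function.comp_apply]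
  rw [gauge_rpow_mul_norm_zPart_dil hα hr hp]

end SurfaceIntegral

/-! ### Integration by parts for the fields `X_j`. -/

section Divergence

variable {α : ℝ}

theorem zPart_add (p q : Space m k) : zPart (p + q) = zPart p + zPart q := rfl
theorem zPart_smul (c : ℝ) (p : Space m k) : zPart (c • p) = c • zPart p := rfl

theorem coeff_add_smul_single (j : Fin m ⊕ Fin k) (p : Space m k) (s : ℝ) :
    coeff α j (p + s • EuclideanSpace.single j 1) = coeff α j p := by
  rcases j with i | j
  · rfl
  · have : zPart (EuclideanSpace.single (Sum.inr j) 1 : Space m k) = 0 := by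
      ext i; simp
    simp only [coeff]
    rw [zPart_add, zPart_smul, this, smul_zero, add_zero]

theorem continuous_coeff (hα : 0 < α) (j : Fin m ⊕ Fin k) :
    Continuous (coeff α j : Space m k → ℝ) := by
  rcases j with i | j
  · exact continuous_const
  · exact (continuous_zPart.norm.rpow_const fun _ => Or.inr hα.le).div_const 2

theorem coeff_ne_zero (j : Fin m ⊕ Fin k) {p : Space m k} (hp : zPart p ≠ 0) :
    coeff α j p ≠ 0 := by
  rcases j with i | j
  · exact one_ne_zero
  · have := Real.rpow_pos_of_pos (norm_pos_iff.2 hp) α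
    simp only [coeff]
    positivity

/-- A line in a `z`-direction meets `z = 0` in at most one point, and one in a `t`-direction
starting off this set never does. The fundamental theorem of calculus tolerates such exceptions. -/
theorem countable_line_zPart_eq_zero (j : Fin m ⊕ Fin k) {p : Space m k} (hp : zPart p ≠ 0) :
    {s : ℝ | zPart (p + s • EuclideanSpace.single j 1) = 0}.Countable := by
  rcases j with i | j
  · refine (countable_singleton (-p (Sum.inl i))).mono fun s hs => ?_
    have h := congrArg (fun v => v i) (show zPart _ = 0 from hs)
    simp at h
    rw [mem_singleton_iff]
    linarith
  · convert countable_empty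
    refine eq_empty_of_forall_notMem fun s hs => hp ?_
    have : zPart (EuclideanSpace.single (Sum.inr j) 1 : Space m k) = 0 := by
      ext i; simp
    have h : zPart _ = 0 := hs
    rwa [zPart_add, zPart_smul, this, smul_zero, add_zero] at h

/-- The integral of `X_j F` vanishes for a compactly supported continuous `F` which is
differentiable where `z ≠ 0` and for which `X_j F` is continuous. -/
theorem integral_X_eq_zero (hm : 1 ≤ m) (hα : 0 < α) (j : Fin m ⊕ Fin k) {F D K : Space m k → ℝ}
    (hF : Continuous F) (hFc : HasCompactSupport F) (hK : Continuous K)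
    (hKc : HasCompactSupport K)
    (hD : ∀ p, zPart p ≠ 0 → HasLineDerivAt ℝ F (D p) p (EuclideanSpace.single j 1))
    (hDK : ∀ p, zPart p ≠ 0 → coeff α j p * D p = K p) : ∫ p, K p = 0 := by
  set e : Space m k := EuclideanSpace.single j 1
  -- The coefficient is constant in the direction `e`, so `X_j F` is the derivative of `H` along
  -- `e`.
  set H : Space m k → ℝ := fun p => coeff α j p * F p with hH
  have hHc : Continuous H := (continuous_coeff hα j).mul hF
  have hHi : Integrable H := hHc.integrable_of_hasCompactSupport hFc.mul_left
  have hKi : Integrable K := hK.integrable_of_hasCompactSupport hKc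
  have hline : ∀ p, zPart p ≠ 0 → ∫ s in (0 : ℝ)..1, K (p + s • e) = H (p + e) - H p := by
    intro p hp
    have h := integral_eq_of_hasDerivAt_off_countable (fun s : ℝ => H (p + s • e))
      (fun s => K (p + s • e)) (a := 0) (b := 1) (countable_line_zPart_eq_zero j hp)
      (by fun_prop) ?_ ((by fun_prop : Continuous fun s : ℝ => K (p + s • e)).intervalIntegrable _ _)
    · simpa using h
    · rintro s ⟨-, hs⟩
      have h1 : HasDerivAt (fun t : ℝ => F (p + s • e + t • e)) (D (p + s • e)) (s - s) := by
        rw [sub_self]; exact hD _ hs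
      have h2 := h1.comp_sub_const s s
      have h3 : HasDerivAt (fun t : ℝ => coeff α j p * F (p + t • e))
          (coeff α j p * D (p + s • e)) s := by
        refine HasDerivAt.const_mul _ (h2.congr_of_eventuallyEq (Eventually.of_forall fun t => ?_))
        simp only
        congr 1
        module
      have hc : ∀ t : ℝ, coeff α j (p + t • e) = coeff α j p := coeff_add_smul_single j p
      rw [← hDK _ hs, hc]
      simp only [hH, hc]
      exact h3
  have hint : Integrable (fun x : Space m k × ℝ => K (x.1 + x.2 • e))
      (volume.prod (volume.restrict (Ioc 0 1))) := by
    have hcont : Continuous fun x : Space m k × ℝ => K (x.1 + x.2 • e) := by fun_prop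
    rw [integrable_prod_iff' hcont.aestronglyMeasurable]
    refine ⟨Eventually.of_forall fun s => hKi.comp_add_right (s • e), ?_⟩
    simp only
    have : ∀ s : ℝ, ∫ p, ‖K (p + s • e)‖ = ∫ p, ‖K p‖ := fun s =>
      integral_add_right_eq_self (fun p => ‖K p‖) (s • e)
    simp_rw [this]
    exact integrable_const _
  -- `K (p + s • e)` is integrated over `p` and `0 < s ≤ 1`. Integrating in `s` first leaves the
  -- difference of `H` and a translate, of integral zero; integrating in `p` first leaves `∫ K`.
  have hswap := integral_integral_swap (f := fun p (s : ℝ) => K (p + s • e)) hint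
  have hL : ∫ p, ∫ s in Ioc (0 : ℝ) 1, K (p + s • e) = 0 := by
    have : ∀ᵐ p, ∫ s in Ioc (0 : ℝ) 1, K (p + s • e) = H (p + e) - H p := by
      filter_upwards [ae_zPart_ne_zero hm] with p hp
      rw [← hline p hp, intervalIntegral.integral_of_le zero_le_one]
    rw [integral_congr_ae this, integral_sub (hHi.comp_add_right e) hHi,
      integral_add_right_eq_self, sub_self]
  have hR : ∫ s in Ioc (0 : ℝ) 1, ∫ p, K (p + s • e) = ∫ p, K p := by
    have : ∀ s : ℝ, ∫ p, K (p + s • e) = ∫ p, K p := fun s => integral_add_right_eq_self K (s • e)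
    simp_rw [this]
    simp
  rw [← hR, ← hswap, hL]

end Divergence

/-! ### Classical derivatives of solutions off `z = 0`. -/

section Regularity

variable {α : ℝ}

theorem contDiffAt_coeff_inv (j : Fin m ⊕ Fin k) {p : Space m k} (hp : zPart p ≠ 0) :
    ContDiffAt ℝ ∞ (fun x : Space m k => (coeff α j x)⁻¹) p := by
  refine ContDiffAt.inv ?_ (coeff_ne_zero j hp)
  rcases j with i | j
  · exact contDiffAt_const
  · have h1 : ContDiffAt ℝ ∞ (fun x : Space m k => ‖zPart x‖) p :=
      (contDiffAt_norm ℝ hp).comp p (zLin (m := m) (k := k)).contDiff.contDiffAt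
    exact (h1.rpow_const_of_ne (norm_ne_zero_iff.2 hp)).div_const 2

theorem isOpen_zPart_ne_zero : IsOpen {p : Space m k | zPart p ≠ 0} :=
  isOpen_compl_singleton.preimage continuous_zPart

/-- A function with continuous weak derivatives `X_j f` is differentiable where `z ≠ 0`. -/
theorem IsWeakX.hasFDerivAt (hα : 0 < α) {Ω : Set (Space m k)} (hΩ : IsOpen Ω)
    {f : Space m k → ℝ}
    {g : Fin m ⊕ Fin k → Space m k → ℝ} (hf : ContinuousOn f Ω) (hg : ∀ j, ContinuousOn (g j) Ω)
    (h : ∀ j, IsWeakX α Ω j f (g j)) {p : Space m k} (hp : p ∈ Ω) (hz : zPart p ≠ 0) :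
    HasFDerivAt f (coordForm fun j => g j p / coeff α j p) p := by
  set Ω' := Ω ∩ {p : Space m k | zPart p ≠ 0}
  have hΩ' : IsOpen Ω' := hΩ.inter isOpen_zPart_ne_zero
  refine hasFDerivAt_of_weak_partials (Ω := Ω') (d := fun j p => g j p / coeff α j p) hΩ'
    (hf.mono inter_subset_left) (fun j => ?_) (fun j φ hφ hc hs => ?_) ⟨hp, hz⟩
  · exact ((hg j).mono inter_subset_left).div (continuous_coeff hα j).continuousOn
      fun x hx => coeff_ne_zero j hx.2
  -- On the support of `φ` the coefficient is smooth and nonzero, and it is constant in the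
  -- direction `j`; hence `X_j θ = ∂_j φ`, and the weak `X_j` becomes a weak partial derivative.
  set θ : Space m k → ℝ := fun x => φ x * (coeff α j x)⁻¹ with hθ
  have hsub : tsupport θ ⊆ tsupport φ := tsupport_mul_subset_left
  have hθs : ContDiff ℝ ∞ θ := by
    refine contDiff_iff_contDiffAt.2 fun x => ?_
    by_cases hx : x ∈ tsupport θ
    · exact hφ.contDiffAt.mul (contDiffAt_coeff_inv j (hs (hsub hx)).2)
    · exact contDiffAt_const.congr_of_eventuallyEq (notMem_tsupport_iff_eventuallyEq.1 hx)
  have hd0 : ∀ x, x ∉ tsupport φ → lineDeriv ℝ φ x (EuclideanSpace.single j 1) = 0 := by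
    intro x hx
    rw [(hφ.differentiable (by simp) x).lineDeriv_eq_fderiv]
    rw [notMem_tsupport_iff_eventuallyEq] at hx
    rw [hx.fderiv_eq]
    simp
  have hX : ∀ x, classicalX α j θ x = lineDeriv ℝ φ x (EuclideanSpace.single j 1) := by
    intro x
    have h1 : partialD j θ x =
        lineDeriv ℝ φ x (EuclideanSpace.single j 1) * (coeff α j x)⁻¹ := by
      unfold partialD lineDeriv
      simp only [hθ, coeff_add_smul_single]
      rw [deriv_mul_const_field]
    rw [classicalX, h1]
    by_cases hx : x ∈ tsupport φ
    · have := coeff_ne_zero (α := α) j (hs hx).2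
      field_simp
    · rw [hd0 x hx]; simp
  have hw := h j θ hθs hc.mul_right (hsub.trans (hs.trans inter_subset_left))
  simp_rw [hX] at hw
  have hred : ∀ G : Space m k → ℝ, (∀ x, x ∉ tsupport φ → G x = 0) →
      ∫ x in Ω', G x = ∫ x in Ω, G x := by
    intro G hG
    rw [setIntegral_eq_integral_of_forall_compl_eq_zero fun x hx => hG x fun h => hx (hs h),
      setIntegral_eq_integral_of_forall_compl_eq_zero fun x hx => hG x fun h => hx (hs h).1]
  rw [hred _ fun x hx => by rw [hd0 x hx, mul_zero],
    hred _ fun x hx => by rw [image_eq_zero_of_notMem_tsupport hx, mul_zero], hw]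
  congr 1
  refine integral_congr_ae (Eventually.of_forall fun x => ?_)
  simp only [hθ]
  ring

/-- `v` is a function on `B_R` with continuous `X_j v = G j` and `X_j X_j v = L j`, these being
classical derivatives where `z ≠ 0`, and `∑_j X_j X_j v = 0`. -/
structure Solves (α R : ℝ) (v : Space m k → ℝ) (G L : Fin m ⊕ Fin k → Space m k → ℝ) :
    Prop where
  cont : ContinuousOn v (pball m k α R)
  contG : ∀ j, ContinuousOn (G j) (pball m k α R)
  contL : ∀ j, ContinuousOn (L j) (pball m k α R)
  hasFDerivAt : ∀ p ∈ pball m k α R, zPart p ≠ 0 →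
    HasFDerivAt v (coordForm fun j => G j p / coeff α j p) p
  hasLineDerivAt : ∀ j, ∀ p ∈ pball m k α R, zPart p ≠ 0 →
    HasLineDerivAt ℝ (G j) (L j p / coeff α j p) p (EuclideanSpace.single j 1)
  sum_eq_zero : ∀ p ∈ pball m k α R, ∑ j, L j p = 0

theorem weakX_spec {Ω : Set (Space m k)} {f : Space m k → ℝ} (h : Gamma1 α Ω f)
    (j : Fin m ⊕ Fin k) :
    ContinuousOn (weakX α Ω j f) Ω ∧ IsWeakX α Ω j f (weakX α Ω j f) := by
  have hj := h.2 j
  rw [weakX, dif_pos hj]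
  exact hj.choose_spec

/-- Of the second derivatives only the diagonal ones `X_j X_j u` are kept, each as a derivative
along a single coordinate line; Green's identity needs no more. -/
theorem IsSolution.solves (hα : 0 < α) {R : ℝ} {u : Space m k → ℝ}
    (hu : IsSolution α (pball m k α R) u) :
    Solves α R u (fun j => weakX α (pball m k α R) j u)
      (fun j => weakX α (pball m k α R) j (weakX α (pball m k α R) j u)) where
  cont := hu.1.1.1
  contG j := (weakX_spec hu.1.1 j).1
  contL j := (weakX_spec (hu.1.2 j) j).1
  hasFDerivAt p hp hz := IsWeakX.hasFDerivAt hα (isOpen_pball hα R) hu.1.1.1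
    (fun j => (weakX_spec hu.1.1 j).1) (fun j => (weakX_spec hu.1.1 j).2) hp hz
  hasLineDerivAt j p hp hz := by
    have h := IsWeakX.hasFDerivAt hα (isOpen_pball hα R) (hu.1.2 j).1
      (fun i => (weakX_spec (hu.1.2 j) i).1) (fun i => (weakX_spec (hu.1.2 j) i).2) hp hz
    have h' := h.hasLineDerivAt (EuclideanSpace.single j 1)
    rwa [coordForm_single] at h'
  sum_eq_zero p hp := hu.2 p hp

end Regularity

end Baouendi

namespace Baouendi
variable {m k : ℕ}

open Filter Topology Metric
open scoped NNReal ENNReal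

/-! ### Radial cutoffs and integrals over dilated sets. -/

section Cutoff

variable {α : ℝ}

/-- Nothing is known about `f` outside `B_R`, but the cutoff vanishes on the open set `ρ_α > b`,
which contains every point where `ρ_α ≥ R`. -/
theorem continuous_mul_cutoff (hα : 0 < α) {R b : ℝ} (hb : b < R) {f : Space m k → ℝ}
    (hf : ContinuousOn f (pball m k α R)) {χ : ℝ → ℝ} (hχ : Continuous χ)
    (hχb : ∀ s, b < s → χ s = 0) : Continuous fun p => f p * χ (gauge α p) := by
  have hg := continuous_gauge (m := m) (k := k) hα
  refine continuous_iff_continuousAt.2 fun p => ?_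
  rcases lt_or_ge (gauge α p) R with hp | hp
  · exact (hf.continuousAt ((isOpen_pball hα R).mem_nhds hp)).mul (hχ.comp hg).continuousAt
  · have : (fun p : Space m k => f p * χ (gauge α p)) =ᶠ[𝓝 p] fun _ => 0 := by
      filter_upwards [(isOpen_lt continuous_const hg).mem_nhds (hb.trans_le hp)] with x hx
      rw [hχb _ hx, mul_zero]
    exact continuousAt_const.congr this.symm

theorem hasCompactSupport_mul_cutoff (hα : 0 < α) {b : ℝ} (f : Space m k → ℝ) {χ : ℝ → ℝ}
    (hχb : ∀ s, b < s → χ s = 0) : HasCompactSupport fun p => f p * χ (gauge α p) := by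
  refine HasCompactSupport.of_support_subset_isCompact (isCompact_gauge_le hα b) fun p hp => ?_
  by_contra h
  exact hp (by simp only; rw [hχb _ (not_le.1 h), mul_zero])

/-- A continuous function on a pseudo-ball is bounded on smaller concentric pseudo-balls. -/
theorem exists_bound_of_continuousOn (hα : 0 < α) {R b : ℝ} (hb : b < R) {f : Space m k → ℝ}
    (hf : ContinuousOn f (pball m k α R)) : ∃ C, 0 ≤ C ∧ ∀ p, gauge α p ≤ b → |f p| ≤ C := by
  obtain ⟨C, hC⟩ := (isCompact_gauge_le (m := m) (k := k) hα b).exists_bound_of_continuousOn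
    (hf.mono fun p (hp : gauge α p ≤ b) => hp.trans_lt hb)
  exact ⟨max C 0, le_max_right _ _, fun p hp => (hC p hp).trans (le_max_left _ _)⟩

theorem aestronglyMeasurable_comp_dil (hα : 0 < α) {R : ℝ} {f : Space m k → ℝ}
    (hf : ContinuousOn f (pball m k α R)) {μ : Measure (Space m k)}
    (hμ : ∀ᵐ p ∂μ, gauge α p ≤ 1) {s : ℝ} (hs : s ∈ Ioo 0 R) :
    AEStronglyMeasurable (fun p => f (dil α s p)) μ := by
  obtain ⟨U, hUdef⟩ : ∃ U : Set (Space m k), U = dil α s ⁻¹' pball m k α R := ⟨_, rfl⟩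
  have hU : MeasurableSet U := by
    rw [hUdef]
    exact ((isOpen_pball hα R).preimage (continuous_dil s)).measurableSet
  have hμU : μ.restrict U = μ := by
    refine Measure.restrict_eq_self_of_ae_mem ?_
    filter_upwards [hμ] with p hp
    rw [hUdef]
    show gauge α (dil α s p) < R
    rw [gauge_dil hα hs.1.le]
    nlinarith [hs.1, hs.2]
  have hmaps : MapsTo (dil α s) U (pball m k α R) := fun p hp => by rwa [hUdef] at hp
  have hc : ContinuousOn (fun p => f (dil α s p)) U :=
    ContinuousOn.comp hf (continuous_dil s).continuousOn hmaps
  have := hc.aestronglyMeasurable (μ := μ) hU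
  rwa [hμU] at this

theorem continuousOn_integral_comp_dil (hα : 0 < α) {R : ℝ} {f : Space m k → ℝ}
    (hf : ContinuousOn f (pball m k α R)) {μ : Measure (Space m k)} [IsFiniteMeasure μ]
    (hμ : ∀ᵐ p ∂μ, gauge α p ≤ 1) :
    ContinuousOn (fun s => ∫ p, f (dil α s p) ∂μ) (Ioo 0 R) := by
  intro s₀ hs₀
  refine ContinuousAt.continuousWithinAt ?_
  obtain ⟨s₁, h1, h2⟩ := exists_between hs₀.2
  obtain ⟨C, -, hC⟩ := exists_bound_of_continuousOn hα h2 hf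
  have hnear : ∀ᶠ s in 𝓝 s₀, s ∈ Ioo 0 s₁ := Ioo_mem_nhds hs₀.1 h1
  refine continuousAt_of_dominated (bound := fun _ => C) ?_ ?_ (integrable_const _) ?_
  · filter_upwards [hnear] with s hs
    exact aestronglyMeasurable_comp_dil hα hf hμ ⟨hs.1, hs.2.trans h2⟩
  · filter_upwards [hnear] with s hs
    filter_upwards [hμ] with p hp
    refine hC _ ?_
    rw [gauge_dil hα hs.1.le]
    nlinarith [hs.1, hs.2]
  · filter_upwards [hμ] with p hp
    have hmem : dil α s₀ p ∈ pball m k α R := by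
      show gauge α (dil α s₀ p) < R
      rw [gauge_dil hα hs₀.1.le]
      nlinarith [hs₀.1, hs₀.2]
    have hd : Continuous fun s : ℝ => dil α s p :=
      (continuous_dil_uncurry hα).comp (continuous_id.prodMk continuous_const)
    exact ContinuousAt.comp (f := fun s : ℝ => dil α s p)
      (hf.continuousAt ((isOpen_pball hα R).mem_nhds hmem)) hd.continuousAt

theorem setIntegral_pball_eq (hα : 0 < α) (f : Space m k → ℝ) {s : ℝ} (hs : 0 < s) :
    ∫ p in pball m k α s, f p =
      s ^ homDim m k α * ∫ p in pball m k α 1, f (dil α s p) := by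
  have hpre : dil α s ⁻¹' pball m k α s = pball m k α 1 := by
    ext p
    simp only [mem_preimage, pball, mem_ofPred_eq, gauge_dil hα hs.le]
    rw [mul_lt_iff_lt_one_right hs]
  have hmap : (volume : Measure (Space m k)) =
      ENNReal.ofReal (s ^ homDim m k α) • volume.map (dil α s) := by
    ext A hA
    rw [Measure.smul_apply, Measure.map_apply (continuous_dil s).measurable hA,
      volume_preimage_dil hs, smul_eq_mul, ← mul_assoc, ← ENNReal.ofReal_mul (by positivity),
      ← Real.rpow_add hs, add_neg_cancel, Real.rpow_zero, ENNReal.ofReal_one, one_mul]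
  conv_lhs => rw [hmap]
  rw [Measure.restrict_smul, integral_smul_measure, ENNReal.toReal_ofReal (by positivity),
    (measurableEmbedding_dil hs).setIntegral_map, hpre, smul_eq_mul]

theorem ae_restrict_pball (hα : 0 < α) :
    ∀ᵐ p ∂(volume.restrict (pball m k α 1)), gauge α p ≤ 1 := by
  filter_upwards [ae_restrict_mem (isOpen_pball hα 1).measurableSet] with p hp
  exact (show gauge α p < 1 from hp).le

theorem isFiniteMeasure_restrict_pball (hα : 0 < α) (r : ℝ) :
    IsFiniteMeasure (volume.restrict (pball m k α r)) :=
  ⟨by rw [Measure.restrict_apply_univ]; exact volume_pball_lt_top hα r⟩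

theorem continuousOn_setIntegral_pball (hα : 0 < α) {R : ℝ} {f : Space m k → ℝ}
    (hf : ContinuousOn f (pball m k α R)) :
    ContinuousOn (fun s => ∫ p in pball m k α s, f p) (Ioo 0 R) := by
  have := isFiniteMeasure_restrict_pball (m := m) (k := k) hα 1
  have h := continuousOn_integral_comp_dil hα hf (ae_restrict_pball hα)
  refine ContinuousOn.congr ?_ fun s hs => setIntegral_pball_eq hα f hs.1
  refine ContinuousOn.mul ?_ h
  exact continuousOn_id.rpow_const fun s hs => Or.inl hs.1.ne'

end Cutoff

/-! ### The flux through pseudo-spheres. -/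

section Flux

variable {α : ℝ}

/-- The components of `ρ_α ^ (2 α + 1) ∇_α ρ_α`. -/
def fluxCoeff (α : ℝ) : Fin m ⊕ Fin k → Space m k → ℝ
  | Sum.inl i, p => ‖zPart p‖ ^ (2 * α) * p (Sum.inl i)
  | Sum.inr j, p => 2 * (α + 1) * (‖zPart p‖ ^ α * p (Sum.inr j))

/-- `ρ_α ^ (2 α + 1) ⟨G, ∇_α ρ_α⟩`. -/
def flux (α : ℝ) (G : Fin m ⊕ Fin k → Space m k → ℝ) (p : Space m k) : ℝ :=
  ∑ j, G j p * fluxCoeff α j p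

theorem continuous_fluxCoeff (hα : 0 < α) (j : Fin m ⊕ Fin k) :
    Continuous (fluxCoeff α j : Space m k → ℝ) := by
  have h1 : Continuous fun p : Space m k => ‖zPart p‖ ^ (2 * α) :=
    continuous_zPart.norm.rpow_const fun _ => Or.inr (by positivity)
  have h2 : Continuous fun p : Space m k => ‖zPart p‖ ^ α :=
    continuous_zPart.norm.rpow_const fun _ => Or.inr (by positivity)
  rcases j with i | j
  · exact h1.mul (by fun_prop)
  · exact continuous_const.mul (h2.mul (by fun_prop))

theorem coeff_mul_gaugeD (j : Fin m ⊕ Fin k) (p : Space m k) :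
    coeff α j p * gaugeD α p j = gauge α p ^ (-2 * α - 1) * fluxCoeff α j p := by
  rcases j with i | j
  · simp [coeff, gaugeD, fluxCoeff]
  · simp only [coeff, gaugeD, fluxCoeff]
    ring

/-- Both sides are `ρ_α^(2α+1) ⟨∇_α w, ∇_α ρ_α⟩`. The derivative `∂_t` is `2 |z|^(-α)` times the
field `X`, and the factor `|z|^(2α)` absorbs this singularity, so the right side is continuous
across `z = 0`. -/
theorem norm_rpow_mul_genZ {w : Space m k → ℝ} {G : Fin m ⊕ Fin k → Space m k → ℝ}
    {p : Space m k} (hz : zPart p ≠ 0)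
    (h : HasFDerivAt w (coordForm fun j => G j p / coeff α j p) p) :
    ‖zPart p‖ ^ (2 * α) * genZ α w p = flux α G p := by
  have hpd : ∀ j, partialD j w p = G j p / coeff α j p := by
    intro j
    rw [partialD, h.differentiableAt.lineDeriv_eq_fderiv, h.fderiv, coordForm_single]
  have hn := norm_pos_iff.2 hz
  have h2 : ‖zPart p‖ ^ (2 * α) = ‖zPart p‖ ^ α * ‖zPart p‖ ^ α := by
    rw [← Real.rpow_add hn]; congr 1; ring
  have hne : ‖zPart p‖ ^ α ≠ 0 := (Real.rpow_pos_of_pos hn _).ne'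
  rw [genZ, flux, Fintype.sum_sum_type, mul_add]
  simp_rw [hpd]
  congr 1
  · rw [Finset.mul_sum]
    refine Finset.sum_congr rfl fun i _ => ?_
    simp only [coeff, fluxCoeff]
    ring
  · rw [mul_left_comm, Finset.mul_sum, Finset.mul_sum]
    refine Finset.sum_congr rfl fun j _ => ?_
    simp only [coeff, fluxCoeff]
    rw [h2]
    field_simp

theorem Solves.continuousOn_flux (hα : 0 < α) {R : ℝ} {w : Space m k → ℝ}
    {G L : Fin m ⊕ Fin k → Space m k → ℝ} (h : Solves α R w G L) :
    ContinuousOn (flux α G) (pball m k α R) :=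
  continuousOn_finsetSum _ fun j _ => (h.contG j).mul (continuous_fluxCoeff hα j).continuousOn

end Flux

/-! ### Green's identity on pseudo-balls. -/

section Green

variable {α R : ℝ}

/-- The radial profile of a cutoff function with derivative `-s ^ (2 α + 1) θ(s)`. -/
def profile (α R : ℝ) (θ : ℝ → ℝ) (s : ℝ) : ℝ := ∫ y in s..R, y ^ (2 * α + 1) * θ y

theorem continuous_profile_integrand (hα : 0 < α) {θ : ℝ → ℝ} (hθ : Continuous θ) :
    Continuous fun y : ℝ => y ^ (2 * α + 1) * θ y :=
  (continuous_id.rpow_const fun _ => Or.inr (by positivity)).mul hθ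

theorem hasDerivAt_profile (hα : 0 < α) {θ : ℝ → ℝ} (hθ : Continuous θ) (s : ℝ) :
    HasDerivAt (profile α R θ) (-(s ^ (2 * α + 1) * θ s)) s := by
  have hc := continuous_profile_integrand hα hθ
  exact intervalIntegral.integral_hasDerivAt_left (hc.intervalIntegrable _ _)
    hc.stronglyMeasurable.stronglyMeasurableAtFilter hc.continuousAt

theorem profile_eq_zero {b : ℝ} (hb : b < R) {θ : ℝ → ℝ} (hθb : ∀ s, b < s → θ s = 0)
    {s : ℝ} (hs : b < s) : profile α R θ s = 0 := by
  refine intervalIntegral.integral_zero_ae (Eventually.of_forall fun y hy => ?_)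
  have : b < y := lt_of_le_of_lt (le_min hs.le hb.le) hy.1
  rw [hθb y this, mul_zero]

variable {v w : Space m k → ℝ} {Gv Lv Gw Lw : Fin m ⊕ Fin k → Space m k → ℝ}

/-- Green's identity tested with a radial cutoff. -/
theorem Solves.integral_mul_profile (hm : 1 ≤ m) (hα : 0 < α) (hv : Solves α R v Gv Lv)
    (hw : Solves α R w Gw Lw) {θ : ℝ → ℝ} (hθ : Continuous θ) {b : ℝ} (hb : b < R)
    (hθb : ∀ s, b < s → θ s = 0) :
    ∫ p, (∑ j, Gv j p * Gw j p) * profile α R θ (gauge α p) =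
      ∫ p, v p * flux α Gw p * θ (gauge α p) := by
  set φ := profile α R θ with hφ
  have hφd := hasDerivAt_profile (R := R) hα hθ
  have hφc : Continuous φ := continuous_iff_continuousAt.2 fun s => (hφd s).continuousAt
  have hφb : ∀ s, b < s → φ s = 0 := fun s hs => profile_eq_zero hb hθb hs
  -- This is `X_j (v · X_j w · φ(ρ_α))`. The factor `s^(2α+1)` in the derivative of the profile
  -- cancels the power `ρ_α^(-2α-1)` in `X_j ρ_α`, leaving the continuous `fluxCoeff`.
  set K : Fin m ⊕ Fin k → Space m k → ℝ := fun j p =>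
    (Gv j p * Gw j p + v p * Lw j p) * φ (gauge α p)
      - v p * (Gw j p * fluxCoeff α j p) * θ (gauge α p) with hK
  have hfl : ∀ j, ContinuousOn (fun p => v p * (Gw j p * fluxCoeff α j p)) (pball m k α R) :=
    fun j => hv.cont.mul ((hw.contG j).mul (continuous_fluxCoeff hα j).continuousOn)
  have hGL : ∀ j, ContinuousOn (fun p => Gv j p * Gw j p + v p * Lw j p) (pball m k α R) :=
    fun j => ((hv.contG j).mul (hw.contG j)).add (hv.cont.mul (hw.contL j))
  have c1 : ∀ j, Continuous fun p => (Gv j p * Gw j p + v p * Lw j p) * φ (gauge α p) :=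
    fun j => continuous_mul_cutoff hα hb (hGL j) hφc hφb
  have c2 : ∀ j, Continuous fun p => v p * (Gw j p * fluxCoeff α j p) * θ (gauge α p) :=
    fun j => continuous_mul_cutoff hα hb (hfl j) hθ hθb
  have s1 : ∀ j, HasCompactSupport fun p =>
      (Gv j p * Gw j p + v p * Lw j p) * φ (gauge α p) :=
    fun j => hasCompactSupport_mul_cutoff hα _ hφb
  have s2 : ∀ j, HasCompactSupport fun p => v p * (Gw j p * fluxCoeff α j p) * θ (gauge α p) :=
    fun j => hasCompactSupport_mul_cutoff hα _ hθb
  have hzero : ∀ j, ∫ p, K j p = 0 := by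
    intro j
    refine integral_X_eq_zero hm hα j (F := fun p => v p * Gw j p * φ (gauge α p))
      (D := fun p => K j p / coeff α j p)
      (continuous_mul_cutoff hα hb (hv.cont.mul (hw.contG j)) hφc hφb)
      (hasCompactSupport_mul_cutoff hα _ hφb) ((c1 j).sub (c2 j)) ((s1 j).sub (s2 j))
      (fun p hz => ?_) (fun p hz => mul_div_cancel₀ _ (coeff_ne_zero j hz))
    have hc := coeff_ne_zero (α := α) j hz
    have hp0 : p ≠ 0 := fun h => hz (by rw [h]; rfl)
    rcases lt_or_ge (gauge α p) R with hp | hp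
    · have d1 := (hv.hasFDerivAt p hp hz).hasLineDerivAt (EuclideanSpace.single j 1)
      have d2 := hw.hasLineDerivAt j p hp hz
      have d3 := (hasFDerivAt_gauge hα hp0).hasLineDerivAt (EuclideanSpace.single j 1)
      rw [coordForm_single] at d1 d3
      unfold HasLineDerivAt at d1 d2 d3 ⊢
      have d4 := HasDerivAt.comp (0 : ℝ) (h₂ := φ) (by simpa using hφd (gauge α p)) d3
      have d5 := (d1.mul d2).mul d4
      refine d5.congr_deriv ?_
      have hg := gauge_pos hα hp0
      have e1 : gaugeD α p j * gauge α p ^ (2 * α + 1) = fluxCoeff α j p / coeff α j p := by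
        rw [eq_div_iff hc, mul_right_comm, mul_comm (gaugeD α p j), coeff_mul_gaugeD, mul_right_comm,
          ← Real.rpow_add hg, show -2 * α - 1 + (2 * α + 1) = 0 by ring, Real.rpow_zero, one_mul]
      simp only [zero_smul, add_zero, Pi.mul_apply, Function.comp_apply, hK]
      rw [show v p * Gw j p * (-(gauge α p ^ (2 * α + 1) * θ (gauge α p)) * gaugeD α p j) =
        -(v p * Gw j p * θ (gauge α p)) * (gaugeD α p j * gauge α p ^ (2 * α + 1)) by ring, e1]
      field_simp
      ring
    · have hev : (fun p => v p * Gw j p * φ (gauge α p)) =ᶠ[𝓝 p] fun _ => 0 := by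
        filter_upwards [(isOpen_lt continuous_const (continuous_gauge hα)).mem_nhds
          (hb.trans_le hp)] with x hx
        rw [hφb _ hx, mul_zero]
      have hK0 : K j p = 0 := by
        simp only [hK]
        rw [hφb _ (hb.trans_le hp), hθb _ (hb.trans_le hp)]
        simp
      simp only [hK0, zero_div]
      have h0 : HasFDerivAt (fun _ : Space m k => (0 : ℝ)) (0 : Space m k →L[ℝ] ℝ) p :=
        hasFDerivAt_const 0 p
      have h1 := (h0.congr_of_eventuallyEq hev).hasLineDerivAt (EuclideanSpace.single j (1 : ℝ))
      simpa using h1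
  have i1 : ∀ j, Integrable fun p => (Gv j p * Gw j p + v p * Lw j p) * φ (gauge α p) :=
    fun j => (c1 j).integrable_of_hasCompactSupport (s1 j)
  have i2 : ∀ j, Integrable fun p => v p * (Gw j p * fluxCoeff α j p) * θ (gauge α p) :=
    fun j => (c2 j).integrable_of_hasCompactSupport (s2 j)
  have hsum : ∑ j, ∫ p, (Gv j p * Gw j p + v p * Lw j p) * φ (gauge α p) =
      ∑ j, ∫ p, v p * (Gw j p * fluxCoeff α j p) * θ (gauge α p) := by
    refine Finset.sum_congr rfl fun j _ => ?_
    have := hzero j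
    rw [hK, integral_sub (i1 j) (i2 j)] at this
    linarith
  rw [← integral_finsetSum _ fun j _ => i1 j, ← integral_finsetSum _ fun j _ => i2 j] at hsum
  convert hsum using 1
  · refine integral_congr_ae (Eventually.of_forall fun p => ?_)
    simp only
    rw [← Finset.sum_mul, Finset.sum_add_distrib, ← Finset.mul_sum]
    rcases lt_or_ge (gauge α p) R with hp | hp
    -- The equation enters here: the terms `v · X_j X_j w` add up to zero.
    · rw [hw.sum_eq_zero p hp, mul_zero, add_zero]
    · rw [hφb _ (hb.trans_le hp), mul_zero, mul_zero]
  · refine integral_congr_ae (Eventually.of_forall fun p => ?_)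
    simp only
    rw [← Finset.sum_mul, ← Finset.mul_sum, flux]

/-- Layer-cake formula for integrals against a radial profile. -/
theorem integral_mul_profile_eq (hα : 0 < α) {f : Space m k → ℝ}
    (hf : ContinuousOn f (pball m k α R)) {θ : ℝ → ℝ} (hθ : Continuous θ) {b : ℝ}
    (hb : b < R) (hθb : ∀ s, b < s → θ s = 0) :
    ∫ p, f p * profile α R θ (gauge α p) =
      ∫ y in Ioo 0 R, y ^ (2 * α + 1) * θ y * ∫ p in pball m k α y, f p := by
  set κ : ℝ → ℝ := fun y => y ^ (2 * α + 1) * θ y with hκ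
  have hκc : Continuous κ := continuous_profile_integrand hα hθ
  have hκb : ∀ y, b < y → κ y = 0 := fun y hy => by simp only [hκ]; rw [hθb y hy, mul_zero]
  set B := pball m k α b
  have hBm : MeasurableSet B := (isOpen_pball hα b).measurableSet
  have hfB : Integrable (B.indicator f) := by
    rw [integrable_indicator_iff hBm]
    exact ((hf.mono fun p (hp : gauge α p ≤ b) => hp.trans_lt hb).integrableOn_compact
      (isCompact_gauge_le hα b)).mono_set fun p (hp : gauge α p < b) => hp.le
  have hκi : Integrable κ (volume.restrict (Ioo 0 R)) :=
    (hκc.integrableOn_Icc (a := 0) (b := R)).mono_set Ioo_subset_Icc_self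
  -- The profile at `ρ_α(p)` is an integral over `ρ_α(p) < y < R`; Fubini on `T` exchanges it with
  -- the integral over `p`.
  set T : Set (Space m k × ℝ) := {x | gauge α x.1 < x.2} with hT
  have hTm : MeasurableSet T :=
    (isOpen_lt ((continuous_gauge hα).comp continuous_fst) continuous_snd).measurableSet
  have hprod : Integrable (T.indicator fun x : Space m k × ℝ => B.indicator f x.1 * κ x.2)
      (volume.prod (volume.restrict (Ioo 0 R))) := (hfB.mul_prod hκi).indicator hTm
  have hswap := integral_integral_swap
    (f := fun p y => T.indicator (fun x : Space m k × ℝ => B.indicator f x.1 * κ x.2) (p, y)) hprod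
  have hleft : ∀ p, ∫ y in Ioo 0 R,
      T.indicator (fun x : Space m k × ℝ => B.indicator f x.1 * κ x.2) (p, y) =
      f p * profile α R θ (gauge α p) := by
    intro p
    by_cases hp : p ∈ B
    · have hpb : gauge α p < b := hp
      have e : ∀ y, T.indicator (fun x : Space m k × ℝ => B.indicator f x.1 * κ x.2) (p, y) =
          f p * (Ioi (gauge α p)).indicator κ y := by
        intro y
        by_cases hy : gauge α p < y
        · rw [indicator_of_mem (show (p, y) ∈ T from hy), indicator_of_mem (mem_Ioi.2 hy),
            indicator_of_mem hp]
        · rw [indicator_of_notMem (show (p, y) ∉ T from hy), indicator_of_notMem (by simpa using hy),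
            mul_zero]
      simp_rw [e]
      rw [integral_const_mul]
      congr 1
      have hset : Ioo 0 R ∩ Ioi (gauge α p) = Ioo (gauge α p) R := by
        ext y
        exact ⟨fun h => ⟨h.2, h.1.2⟩, fun h => ⟨⟨(gauge_nonneg α p).trans_lt h.1, h.2⟩, h.1⟩⟩
      rw [setIntegral_indicator measurableSet_Ioi, profile, hset,
        intervalIntegral.integral_of_le (hpb.trans hb).le, integral_Ioc_eq_integral_Ioo]
    · have hpb : b ≤ gauge α p := not_lt.1 hp
      have e : profile α R θ (gauge α p) = 0 := by
        rcases hpb.lt_or_eq with h | h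
        · exact profile_eq_zero hb hθb h
        · refine intervalIntegral.integral_zero_ae (Eventually.of_forall fun y hy => ?_)
          have : b < y := lt_of_le_of_lt (le_min hpb hb.le) hy.1
          rw [hθb y this, mul_zero]
      rw [e, mul_zero]
      refine integral_eq_zero_of_ae (Eventually.of_forall fun y => ?_)
      by_cases hy : (p, y) ∈ T
      · simp [indicator_of_mem hy, indicator_of_notMem hp]
      · simp [indicator_of_notMem hy]
  have hright : ∀ y ∈ Ioo 0 R, ∫ p,
      T.indicator (fun x : Space m k × ℝ => B.indicator f x.1 * κ x.2) (p, y) =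
      κ y * ∫ p in pball m k α y, f p := by
    intro y hy
    rcases le_or_gt y b with hyb | hyb
    · rw [← integral_indicator (isOpen_pball hα y).measurableSet, ← integral_const_mul]
      congr 1
      ext p
      by_cases hp : gauge α p < y
      · rw [indicator_of_mem (show (p, y) ∈ T from hp),
          indicator_of_mem (show p ∈ B from hp.trans_le hyb),
          indicator_of_mem (show p ∈ pball m k α y from hp), mul_comm]
      · rw [indicator_of_notMem (show (p, y) ∉ T from hp),
          indicator_of_notMem (show p ∉ pball m k α y from hp), mul_zero]
    · rw [hκb y hyb, zero_mul]
      refine integral_eq_zero_of_ae (Eventually.of_forall fun p => ?_)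
      by_cases hp : (p, y) ∈ T
      · simp [indicator_of_mem hp, hκb y hyb]
      · simp [indicator_of_notMem hp]
  simp_rw [hleft] at hswap
  rw [hswap]
  exact setIntegral_congr_fun measurableSet_Ioo hright

theorem integrableOn_mul_of_tsupport_subset {U : Set ℝ} {θ h : ℝ → ℝ} (hθ : Continuous θ)
    (hc : HasCompactSupport θ) (hs : tsupport θ ⊆ U) (hh : ContinuousOn h U) :
    IntegrableOn (fun s => θ s * h s) U := by
  have h1 : IntegrableOn (fun s => θ s * h s) (tsupport θ) :=
    (hθ.continuousOn.mul (hh.mono hs)).integrableOn_compact hc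
  refine Integrable.integrableOn ?_
  rw [← integrableOn_iff_integrable_of_support_subset (s := tsupport θ)]
  · exact h1
  · exact fun p hp => subset_tsupport θ (left_ne_zero_of_mul hp)

theorem exists_lt_of_tsupport_subset_Ioo {R : ℝ} {θ : ℝ → ℝ} (hc : HasCompactSupport θ)
    (hs : tsupport θ ⊆ Ioo 0 R) : ∃ b < R, ∀ s, b < s → θ s = 0 := by
  rcases (tsupport θ).eq_empty_or_nonempty with he | hne
  · refine ⟨R - 1, by linarith, fun s _ => ?_⟩
    exact image_eq_zero_of_notMem_tsupport (by rw [he]; exact notMem_empty s)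
  · obtain ⟨b, hb, hmax⟩ := hc.isCompact.exists_isGreatest hne
    exact ⟨b, (hs hb).2, fun s hbs => image_eq_zero_of_notMem_tsupport fun h =>
      (hmax h).not_gt hbs⟩

/-- In polar coordinates the factor `θ (gauge α p)` is the constant `θ s` on each pseudo-sphere and
leaves the inner integral. -/
theorem integral_mul_comp_gauge (hm : 1 ≤ m) (hα : 0 < α) {f : Space m k → ℝ}
    (hf : ContinuousOn f (pball m k α R)) {θ : ℝ → ℝ} (hθ : Continuous θ) {b : ℝ} (hb : b < R)
    (hθb : ∀ s, b < s → θ s = 0) :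
    ∫ p, f p * θ (gauge α p) = ∫ s in Ioo 0 R, s ^ (homDim m k α - 1) *
      (θ s * ∫ ξ, f (dil α s ξ) ∂(polarMeasure m k α)) := by
  have hc := continuous_mul_cutoff hα hb hf hθ hθb
  rw [integral_polar hm hα hc.measurable
    (hc.integrable_of_hasCompactSupport (hasCompactSupport_mul_cutoff hα f hθb))]
  have e : ∀ s ∈ Ioi (0 : ℝ), s ^ (homDim m k α - 1) *
      ∫ ξ, f (dil α s ξ) * θ (gauge α (dil α s ξ)) ∂(polarMeasure m k α) =
      s ^ (homDim m k α - 1) * (θ s * ∫ ξ, f (dil α s ξ) ∂(polarMeasure m k α)) := by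
    intro s hs
    have hae : (fun ξ => f (dil α s ξ) * θ (gauge α (dil α s ξ))) =ᵐ[polarMeasure m k α]
        fun ξ => θ s * f (dil α s ξ) := by
      filter_upwards [ae_polarMeasure_gauge hm hα] with ξ hξ
      rw [gauge_dil hα (le_of_lt hs), hξ, mul_one, mul_comm]
    rw [integral_congr_ae hae, integral_const_mul]
  rw [setIntegral_congr_fun measurableSet_Ioi e]
  refine setIntegral_eq_of_subset_of_forall_sdiff_eq_zero measurableSet_Ioi
    (fun s hs => hs.1) fun s hs => ?_
  have : R ≤ s := not_lt.1 fun h => hs.2 ⟨hs.1, h⟩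
  rw [hθb s (hb.trans_le this), zero_mul, mul_zero]

/-- Green's identity on pseudo-balls. -/
theorem Solves.green (hm : 1 ≤ m) (hα : 0 < α) (hv : Solves α R v Gv Lv)
    (hw : Solves α R w Gw Lw) {s : ℝ} (hs : s ∈ Ioo 0 R) :
    ∫ p in pball m k α s, ∑ j, Gv j p * Gw j p = s ^ (homDim m k α - 2) *
      ∫ ξ, v (dil α s ξ) * genZ α w (dil α s ξ) * ‖zPart ξ‖ ^ (2 * α) ∂(polarMeasure m k α) := by
  have := isFiniteMeasure_polarMeasure (m := m) (k := k) hα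
  have hτ : ∀ᵐ ξ ∂(polarMeasure m k α), gauge α ξ ≤ 1 :=
    (ae_polarMeasure_gauge hm hα).mono fun ξ h => h.le
  have hf : ContinuousOn (fun p => v p * flux α Gw p) (pball m k α R) :=
    hv.cont.mul (hw.continuousOn_flux hα)
  have hgg : ContinuousOn (fun p => ∑ j, Gv j p * Gw j p) (pball m k α R) :=
    continuousOn_finsetSum _ fun j _ => (hv.contG j).mul (hw.contG j)
  set A : ℝ → ℝ := fun s => ∫ ξ, v (dil α s ξ) * flux α Gw (dil α s ξ) ∂(polarMeasure m k α)
  set B : ℝ → ℝ := fun s => ∫ p in pball m k α s, ∑ j, Gv j p * Gw j p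
  have hA : ContinuousOn A (Ioo 0 R) := continuousOn_integral_comp_dil hα hf hτ
  have hB : ContinuousOn B (Ioo 0 R) := continuousOn_setIntegral_pball hα hgg
  have h1 : ContinuousOn (fun s => s ^ (2 * α + 1) * B s) (Ioo 0 R) :=
    (continuousOn_id.rpow_const fun s hs => Or.inl hs.1.ne').mul hB
  have h2 : ContinuousOn (fun s => s ^ (homDim m k α - 1) * A s) (Ioo 0 R) :=
    (continuousOn_id.rpow_const fun s hs => Or.inl hs.1.ne').mul hA
  -- The identities tested with all radial `θ` supported in `(0, R)` determine the difference almost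
  -- everywhere; continuity of both sides then gives every radius.
  have hae : ∀ᵐ s : ℝ, s ∈ Ioo 0 R →
      s ^ (2 * α + 1) * B s - s ^ (homDim m k α - 1) * A s = 0 := by
    refine isOpen_Ioo.ae_eq_zero_of_integral_contDiff_smul_eq_zero
      ((h1.sub h2).locallyIntegrableOn measurableSet_Ioo) fun θ hθ hc hsupp => ?_
    obtain ⟨b, hb, hθb⟩ := exists_lt_of_tsupport_subset_Ioo hc hsupp
    have key := hv.integral_mul_profile hm hα hw hθ.continuous hb hθb
    rw [integral_mul_profile_eq hα hgg hθ.continuous hb hθb,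
      integral_mul_comp_gauge hm hα hf hθ.continuous hb hθb] at key
    have i1 := integrableOn_mul_of_tsupport_subset hθ.continuous hc hsupp h1
    have i2 := integrableOn_mul_of_tsupport_subset hθ.continuous hc hsupp h2
    have e1 : ∫ s in Ioo 0 R, θ s * (s ^ (2 * α + 1) * B s) =
        ∫ s in Ioo 0 R, θ s * (s ^ (homDim m k α - 1) * A s) := by
      convert key using 3 <;> ring
    rw [← setIntegral_eq_integral_of_forall_compl_eq_zero (s := Ioo 0 R)]
    · simp_rw [smul_eq_mul, mul_sub]
      rw [integral_sub i1 i2, e1, sub_self]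
    · intro s hs
      rw [image_eq_zero_of_notMem_tsupport fun h => hs (hsupp h), zero_smul]
  have heq : EqOn (fun s => s ^ (2 * α + 1) * B s) (fun s => s ^ (homDim m k α - 1) * A s)
      (Ioo 0 R) := by
    refine Measure.eqOn_open_of_ae_eq (μ := volume) ?_ isOpen_Ioo h1 h2
    filter_upwards [(ae_restrict_iff' measurableSet_Ioo).2 hae] with s h
    linarith
  have hfin := heq hs
  simp only at hfin
  -- The weight `|z|^(2α)` at `δ_s ξ` contributes `s^(2α)`; with `s^(Q-1)` from polar coordinates
  -- and `s^(2α+1)` from the profile this leaves `s^(Q-2)`.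
  have hAs : A s = s ^ (2 * α) * ∫ ξ, v (dil α s ξ) * genZ α w (dil α s ξ) * ‖zPart ξ‖ ^ (2 * α)
      ∂(polarMeasure m k α) := by
    rw [← integral_const_mul]
    refine integral_congr_ae ?_
    filter_upwards [ae_polarMeasure_gauge hm hα, ae_polarMeasure_zPart hm hα] with ξ h1 h2
    have hz : zPart (dil α s ξ) ≠ 0 := by
      rw [zPart_dil]; exact smul_ne_zero hs.1.ne' h2
    have hmem : dil α s ξ ∈ pball m k α R := by
      show gauge α (dil α s ξ) < R
      rw [gauge_dil hα hs.1.le, h1, mul_one]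
      exact hs.2
    rw [← norm_rpow_mul_genZ hz (hw.hasFDerivAt _ hmem hz), norm_zPart_dil hs.1.le,
      Real.mul_rpow hs.1.le (norm_nonneg _)]
    ring
  rw [hAs, ← mul_assoc, ← Real.rpow_add hs.1] at hfin
  have hpos : s ^ (2 * α + 1) ≠ 0 := (Real.rpow_pos_of_pos hs.1 _).ne'
  apply mul_left_cancel₀ hpos
  rw [← mul_assoc, ← Real.rpow_add hs.1]
  convert hfin using 3
  ring

end Green

end Baouendi

namespace Baouendi
variable {m k : ℕ}

open Filter Topology Metric
open scoped NNReal ENNReal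

/-! ### Differentiation of quadratic integrals along the dilations. -/

section RadialFamily

theorem exists_compact_Ioo_nhds {R t : ℝ} (ht : t ∈ Ioo 0 R) :
    ∃ a b, 0 < a ∧ b < R ∧ a < t ∧ t < b := by
  obtain ⟨a, h1, h2⟩ := exists_between ht.1
  obtain ⟨b, h3, h4⟩ := exists_between ht.2
  exact ⟨a, b, h1, h4, h2, h3⟩

/-- A family `U s` of functions with logarithmic derivative `s ∂_s U = y s / c`, bounded on compact
subintervals of `(0, R)`. -/
structure RadialFamily {X : Type*} [MeasurableSpace X] (τ : Measure X) (R : ℝ) (U y : ℝ → X → ℝ)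
    (c : X → ℝ) : Prop where
  measU : ∀ s ∈ Ioo 0 R, AEStronglyMeasurable (U s) τ
  measY : ∀ s ∈ Ioo 0 R, AEStronglyMeasurable (y s) τ
  measC : AEStronglyMeasurable c τ
  c_mem : ∀ᵐ ξ ∂τ, c ξ ∈ Ioc 0 1
  bound : ∀ a b, 0 < a → b < R → ∃ C, 0 ≤ C ∧ ∀ᵐ ξ ∂τ, ∀ s ∈ Icc a b, |U s ξ| ≤ C ∧ |y s ξ| ≤ C
  deriv : ∀ᵐ ξ ∂τ, ∀ s ∈ Ioo 0 R, HasDerivAt (fun s => U s ξ) (y s ξ / (c ξ * s)) s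
  contY : ∀ᵐ ξ ∂τ, ∀ s ∈ Ioo 0 R, ContinuousAt (fun s => y s ξ) s

namespace RadialFamily

variable {X : Type*} [MeasurableSpace X] {τ : Measure X} {R : ℝ} {U y : ℝ → X → ℝ} {c : X → ℝ}

theorem ae_bound (h : RadialFamily τ R U y c) {s : ℝ} (hs : s ∈ Ioo 0 R) :
    ∃ C, 0 ≤ C ∧ ∀ᵐ ξ ∂τ, |U s ξ| ≤ C ∧ |y s ξ| ≤ C := by
  obtain ⟨C, hC0, hC⟩ := h.bound s s hs.1 hs.2
  exact ⟨C, hC0, hC.mono fun ξ hξ => hξ s ⟨le_rfl, le_rfl⟩⟩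

variable [IsFiniteMeasure τ]

theorem integrable_sq_U (h : RadialFamily τ R U y c) {s : ℝ} (hs : s ∈ Ioo 0 R) :
    Integrable (fun ξ => U s ξ ^ 2 * c ξ ^ 2) τ := by
  obtain ⟨C, hC0, hC⟩ := h.ae_bound hs
  refine Integrable.of_bound (((h.measU s hs).pow 2).mul (h.measC.pow 2)) (C ^ 2 * 1 ^ 2) ?_
  filter_upwards [hC, h.c_mem] with ξ h1 h2
  rw [norm_mul, norm_pow, norm_pow, Real.norm_eq_abs, Real.norm_eq_abs, abs_of_pos h2.1]
  have := h2.1.le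
  gcongr
  · exact h1.1
  · exact h2.2

theorem integrable_U_mul_y (h : RadialFamily τ R U y c) {s t : ℝ} (hs : s ∈ Ioo 0 R)
    (ht : t ∈ Ioo 0 R) : Integrable (fun ξ => U s ξ * y t ξ * c ξ) τ := by
  obtain ⟨C, hC0, hC⟩ := h.ae_bound hs
  obtain ⟨C', hC0', hC'⟩ := h.ae_bound ht
  refine Integrable.of_bound (((h.measU s hs).mul (h.measY t ht)).mul h.measC) (C * C' * 1) ?_
  filter_upwards [hC, hC', h.c_mem] with ξ h1 h1' h2
  rw [norm_mul, norm_mul, Real.norm_eq_abs, Real.norm_eq_abs, Real.norm_eq_abs, abs_of_pos h2.1]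
  have := h2.1.le
  gcongr
  · exact h1.1
  · exact h1'.2
  · exact h2.2

theorem integrable_sq_y (h : RadialFamily τ R U y c) {s : ℝ} (hs : s ∈ Ioo 0 R) :
    Integrable (fun ξ => y s ξ ^ 2) τ := by
  obtain ⟨C, hC0, hC⟩ := h.ae_bound hs
  refine Integrable.of_bound ((h.measY s hs).pow 2) (C ^ 2) ?_
  filter_upwards [hC] with ξ h1
  rw [norm_pow, Real.norm_eq_abs]
  gcongr
  exact h1.2

/-- The factor `c^2` absorbs the `1/c` in the derivative of `U`, which itself need not be bounded,
so domination by a constant is available. -/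
theorem hasDerivAt_integral_sq (h : RadialFamily τ R U y c) {t : ℝ} (ht : t ∈ Ioo 0 R) :
    HasDerivAt (fun s => ∫ ξ, U s ξ ^ 2 * c ξ ^ 2 ∂τ) (2 / t * ∫ ξ, U t ξ * y t ξ * c ξ ∂τ) t := by
  obtain ⟨a, b, ha, hb, hat, htb⟩ := exists_compact_Ioo_nhds ht
  obtain ⟨C, hC0, hC⟩ := h.bound a b ha hb
  have hsub : Ioo a b ⊆ Ioo 0 R := Ioo_subset_Ioo ha.le hb.le
  have hnh : Ioo a b ∈ 𝓝 t := Ioo_mem_nhds hat htb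
  have hm : AEStronglyMeasurable (fun ξ => 2 / t * (U t ξ * y t ξ * c ξ)) τ :=
    (((h.measU t ht).mul (h.measY t ht)).mul h.measC).const_mul _
  have key := (hasDerivAt_integral_of_dominated_loc_of_deriv_le (μ := τ)
    (F := fun s ξ => U s ξ ^ 2 * c ξ ^ 2) (F' := fun s ξ => 2 / s * (U s ξ * y s ξ * c ξ))
    (bound := fun _ => 2 / a * (C * C * 1)) hnh ?_ (h.integrable_sq_U ht) hm ?_
    (integrable_const _) ?_).2
  · rwa [integral_const_mul] at key
  · filter_upwards [hnh] with s hs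
    exact ((h.measU s (hsub hs)).pow 2).mul (h.measC.pow 2)
  · filter_upwards [hC, h.c_mem] with ξ h1 h2 s hs
    obtain ⟨h3, h4⟩ := h1 s ⟨hs.1.le, hs.2.le⟩
    have hs0 : 0 < s := ha.trans hs.1
    rw [norm_mul, norm_mul, norm_mul, Real.norm_eq_abs (U s ξ), Real.norm_eq_abs (y s ξ),
      Real.norm_of_nonneg h2.1.le, Real.norm_of_nonneg (by positivity)]
    have := h2.1.le
    have h5 := hs.1.le
    gcongr
    exact h2.2
  · filter_upwards [h.deriv, h.c_mem] with ξ h1 h2 s hs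
    have hs0 : 0 < s := ha.trans hs.1
    refine (((h1 s (hsub hs)).pow 2).mul_const (c ξ ^ 2)).congr_deriv ?_
    have := h2.1.ne'
    field_simp
    norm_num
    ring

/-- If the pairing `∫ U_s y_t c` is symmetric, its restriction to the diagonal is differentiable. -/
theorem hasDerivAt_integral_diag (h : RadialFamily τ R U y c)
    (hsymm : ∀ s ∈ Ioo 0 R, ∀ t ∈ Ioo 0 R,
      ∫ ξ, U s ξ * y t ξ * c ξ ∂τ = ∫ ξ, U t ξ * y s ξ * c ξ ∂τ)
    {t : ℝ} (ht : t ∈ Ioo 0 R) :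
    HasDerivAt (fun s => ∫ ξ, U s ξ * y s ξ * c ξ ∂τ) (2 / t * ∫ ξ, y t ξ ^ 2 ∂τ) t := by
  obtain ⟨a, b, ha, hb, hat, htb⟩ := exists_compact_Ioo_nhds ht
  obtain ⟨C, hC0, hC⟩ := h.bound a b ha hb
  have hsub : Ioo a b ⊆ Ioo 0 R := Ioo_subset_Ioo ha.le hb.le
  have hnh : Ioo a b ∈ 𝓝 t := Ioo_mem_nhds hat htb
  rw [hasDerivAt_iff_tendsto_slope, ← integral_const_mul]
  have hev : ∀ᶠ s in 𝓝[≠] t, s ∈ Ioo a b := nhdsWithin_le_nhds hnh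
  -- Expanding `(U s - U t)(y s + y t)`, the two mixed terms have equal integrals by `hsymm` and
  -- cancel. The whole increment then falls on `U`, and `y` only has to be continuous in `s`.
  have hslope : ∀ᶠ s in 𝓝[≠] t,
      ∫ ξ, (s - t)⁻¹ * ((U s ξ - U t ξ) * c ξ * (y s ξ + y t ξ)) ∂τ =
      slope (fun s => ∫ ξ, U s ξ * y s ξ * c ξ ∂τ) t s := by
    filter_upwards [hev] with s hs
    have hs' := hsub hs
    rw [integral_const_mul, slope_def_field, div_eq_inv_mul]
    congr 1
    have e : ∀ ξ, (U s ξ - U t ξ) * c ξ * (y s ξ + y t ξ) =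
        (U s ξ * y s ξ * c ξ + U s ξ * y t ξ * c ξ) - (U t ξ * y s ξ * c ξ + U t ξ * y t ξ * c ξ) :=
      fun ξ => by ring
    simp_rw [e]
    have i1 : Integrable (fun ξ => U s ξ * y s ξ * c ξ + U s ξ * y t ξ * c ξ) τ :=
      (h.integrable_U_mul_y hs' hs').add (h.integrable_U_mul_y hs' ht)
    have i2 : Integrable (fun ξ => U t ξ * y s ξ * c ξ + U t ξ * y t ξ * c ξ) τ :=
      (h.integrable_U_mul_y ht hs').add (h.integrable_U_mul_y ht ht)
    rw [integral_sub i1 i2,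
      integral_add (h.integrable_U_mul_y hs' hs') (h.integrable_U_mul_y hs' ht),
      integral_add (h.integrable_U_mul_y ht hs') (h.integrable_U_mul_y ht ht), hsymm s hs' t ht]
    ring
  refine Tendsto.congr' hslope ?_
  refine tendsto_integral_filter_of_dominated_convergence (fun _ => C / a * (C + C)) ?_ ?_
    (integrable_const _) ?_
  · filter_upwards [hev] with s hs
    exact (((((h.measU s (hsub hs)).sub (h.measU t ht)).mul h.measC).mul
      ((h.measY s (hsub hs)).add (h.measY t ht)))).const_mul _
  · filter_upwards [hev, self_mem_nhdsWithin] with s hs hst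
    filter_upwards [hC, h.c_mem, h.deriv] with ξ h1 h2 h3
    have hne : s - t ≠ 0 := sub_ne_zero.2 hst
    -- The mean value bound blows up like `1/c`; the factor `c` of the integrand compensates exactly
    -- and makes the dominating function constant.
    have hmv : ‖U s ξ - U t ξ‖ ≤ C / (c ξ * a) * ‖s - t‖ := by
      refine (convex_Ioo a b).norm_image_sub_le_of_norm_hasDerivWithin_le
        (f := fun s => U s ξ) (f' := fun s => y s ξ / (c ξ * s))
        (fun x hx => (h3 x (hsub hx)).hasDerivWithinAt) (fun x hx => ?_) ⟨hat, htb⟩ hs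
      have hx0 : 0 < x := ha.trans hx.1
      have hc0 := h2.1
      have hxa := hx.1.le
      rw [norm_div, Real.norm_eq_abs (y x ξ), Real.norm_of_nonneg (by positivity)]
      have := (h1 x ⟨hx.1.le, hx.2.le⟩).2
      gcongr
    have hc0 := h2.1
    have hy : ‖y s ξ + y t ξ‖ ≤ C + C :=
      (norm_add_le _ _).trans (add_le_add (h1 s ⟨hs.1.le, hs.2.le⟩).2
        (h1 t ⟨hat.le, htb.le⟩).2)
    rw [norm_mul, norm_mul, norm_mul, ← mul_assoc, norm_inv, Real.norm_of_nonneg hc0.le]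
    refine mul_le_mul ?_ hy (norm_nonneg _) (by positivity)
    calc ‖s - t‖⁻¹ * (‖U s ξ - U t ξ‖ * c ξ)
        ≤ ‖s - t‖⁻¹ * (C / (c ξ * a) * ‖s - t‖ * c ξ) := by gcongr
      _ = C / a := by
        have : ‖s - t‖ ≠ 0 := norm_ne_zero_iff.2 hne
        field_simp
  · filter_upwards [h.c_mem, h.deriv, h.contY] with ξ h2 h3 h4
    have l1 : Tendsto (fun s => (s - t)⁻¹ * (U s ξ - U t ξ)) (𝓝[≠] t) (𝓝 (y t ξ / (c ξ * t))) := by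
      have := (hasDerivAt_iff_tendsto_slope.1 (h3 t ht))
      refine this.congr fun s => ?_
      rw [slope_def_field, div_eq_inv_mul]
    have l2 : Tendsto (fun s => y s ξ) (𝓝[≠] t) (𝓝 (y t ξ)) :=
      (h4 t ht).tendsto.mono_left nhdsWithin_le_nhds
    have l3 := (l1.mul_const (c ξ)).mul (l2.add_const (y t ξ))
    have hc0 := h2.1.ne'
    have ht0 := ht.1.ne'
    have e : y t ξ / (c ξ * t) * c ξ * (y t ξ + y t ξ) = 2 / t * y t ξ ^ 2 := by
      field_simp
      ring
    rw [e] at l3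
    refine l3.congr fun s => ?_
    ring

end RadialFamily

end RadialFamily

/-! ### Dilates of solutions and the generator `Z_α`. -/

section Dilates

variable {α R : ℝ}

/-- The dilation as a continuous linear map. -/
def dilLin (α l : ℝ) : Space m k →L[ℝ] Space m k :=
  LinearMap.toContinuousLinearMap
    { toFun := dil α l
      map_add' := fun p q => by
        ext j
        rcases j with i | j <;> simp [mul_add]
      map_smul' := fun c p => by
        ext j
        rcases j with i | j <;> simp [mul_left_comm] }

theorem dilLin_apply (l : ℝ) (p : Space m k) : dilLin α l p = dil α l p := rfl

/-- The factor by which `dil α l` scales the coordinate `j`. -/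
def dilFactor (α l : ℝ) : Fin m ⊕ Fin k → ℝ := Sum.elim (fun _ => l) (fun _ => l ^ (α + 1))

theorem dil_single (l : ℝ) (j : Fin m ⊕ Fin k) :
    dil α l (EuclideanSpace.single j 1) = dilFactor α l j • EuclideanSpace.single j 1 := by
  ext i
  rcases j with j | j <;> rcases i with i | i <;>
    simp +contextual [dilFactor]

/-- This expresses that `X_j` is homogeneous of degree one: `X_j (v ∘ δ_l) = l · (X_j v) ∘ δ_l`. -/
theorem dilFactor_mul_coeff {l : ℝ} (hl : 0 < l) (j : Fin m ⊕ Fin k) (p : Space m k) :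
    dilFactor α l j * coeff α j p = l * coeff α j (dil α l p) := by
  rcases j with i | j
  · rfl
  · simp only [dilFactor, coeff, Sum.elim_inr]
    rw [norm_zPart_dil hl.le, Real.mul_rpow hl.le (norm_nonneg _), Real.rpow_add hl, Real.rpow_one]
    ring

theorem lineDeriv_comp_dil (v : Space m k → ℝ) (l : ℝ) (p : Space m k) (j : Fin m ⊕ Fin k) :
    partialD j (fun x => v (dil α l x)) p = dilFactor α l j * partialD j v (dil α l p) := by
  rw [partialD, partialD, ← smul_eq_mul, ← lineDeriv_smul, ← dil_single]
  unfold lineDeriv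
  congr 1
  ext t
  show v (dil α l (p + t • EuclideanSpace.single j 1)) = _
  rw [← dilLin_apply, ← dilLin_apply, ← dilLin_apply, map_add, map_smul]

/-- A generator commutes with its flow: each scaling factor of a derivative is absorbed by the
coordinate multiplying it. -/
theorem genZ_comp_dil (v : Space m k → ℝ) (l : ℝ) (p : Space m k) :
    genZ α (fun x => v (dil α l x)) p = genZ α v (dil α l p) := by
  simp only [genZ, lineDeriv_comp_dil, dilFactor, Sum.elim_inl, Sum.elim_inr, dil_inl, dil_inr]
  congr 1
  · exact Finset.sum_congr rfl fun i _ => by ring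
  · congr 1
    exact Finset.sum_congr rfl fun i _ => by ring

/-- All `X_j` scale by the same factor `l`, so every second-order term scales by `l^2` and their sum
remains zero. The dilates are needed as a pair in Green's identity. -/
theorem Solves.comp_dil {v : Space m k → ℝ} {G L : Fin m ⊕ Fin k → Space m k → ℝ} (hα : 0 < α)
    (h : Solves α R v G L) {l : ℝ} (hl : 0 < l) :
    Solves α (R / l) (fun p => v (dil α l p)) (fun j p => l * G j (dil α l p))
      (fun j p => l ^ 2 * L j (dil α l p)) := by
  have hmaps : MapsTo (dil α l) (pball m k α (R / l)) (pball m k α R) := by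
    intro p hp
    show gauge α (dil α l p) < R
    rw [gauge_dil hα hl.le, mul_comm]
    exact (lt_div_iff₀ hl).1 hp
  have hc : ∀ f : Space m k → ℝ, ContinuousOn f (pball m k α R) →
      ContinuousOn (fun p => f (dil α l p)) (pball m k α (R / l)) := fun f hf =>
    ContinuousOn.comp hf (continuous_dil l).continuousOn hmaps
  have hzd : ∀ p : Space m k, zPart p ≠ 0 → zPart (dil α l p) ≠ 0 := fun p hz => by
    rw [zPart_dil]; exact smul_ne_zero hl.ne' hz
  have hfac : ∀ (j : Fin m ⊕ Fin k) (p : Space m k), zPart p ≠ 0 → ∀ x : ℝ,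
      dilFactor α l j * (x / coeff α j (dil α l p)) = l * x / coeff α j p := by
    intro j p hz x
    have h1 := coeff_ne_zero (α := α) j hz
    have h2 := coeff_ne_zero (α := α) j (hzd p hz)
    have h3 := dilFactor_mul_coeff (α := α) hl j p
    field_simp
    linear_combination x * h3
  refine ⟨hc v h.cont, fun j => continuousOn_const.mul (hc _ (h.contG j)),
    fun j => continuousOn_const.mul (hc _ (h.contL j)), fun p hp hz => ?_, fun j p hp hz => ?_,
    fun p hp => ?_⟩
  · have h1 := (h.hasFDerivAt _ (hmaps hp) (hzd p hz)).comp p (dilLin α l).hasFDerivAt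
    refine h1.congr_fderiv ?_
    rw [eq_coordForm (ContinuousLinearMap.comp _ _)]
    congr 1
    ext j
    rw [ContinuousLinearMap.comp_apply, dilLin_apply, dil_single, map_smul, coordForm_single,
      smul_eq_mul, hfac j p hz]
  · have h1 := (h.hasLineDerivAt j _ (hmaps hp) (hzd p hz)).smul (dilFactor α l j)
    rw [← dil_single, smul_eq_mul, hfac j p hz] at h1
    unfold HasLineDerivAt at h1 ⊢
    have h2 := h1.const_mul l
    have e : l * (l * L j (dil α l p) / coeff α j p) =
      l ^ 2 * L j (dil α l p) / coeff α j p := by ring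
    rw [e] at h2
    refine h2.congr_of_eventuallyEq (Eventually.of_forall fun t => ?_)
    simp only
    rw [← dilLin_apply, ← dilLin_apply, ← dilLin_apply, map_add, map_smul]
  · rw [← Finset.mul_sum, h.sum_eq_zero _ (hmaps hp), mul_zero]

theorem hasDerivAt_dil {l : ℝ} (hl : 0 < l) (p : Space m k) :
    HasDerivAt (fun s => dil α s p)
      (WithLp.toLp 2 (Sum.elim (fun i => p (Sum.inl i))
        (fun j => (α + 1) * l ^ α * p (Sum.inr j))) : Space m k) l := by
  have h : HasDerivAt (fun s : ℝ => fun j : Fin m ⊕ Fin k =>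
      Sum.elim (fun _ => s) (fun _ => s ^ (α + 1)) j * p j)
      (Sum.elim (fun i => p (Sum.inl i)) (fun j => (α + 1) * l ^ α * p (Sum.inr j))) l := by
    refine hasDerivAt_pi.2 fun j => ?_
    rcases j with i | j
    · simpa using (hasDerivAt_id l).mul_const (p (Sum.inl i))
    · have h : HasDerivAt (fun s : ℝ => s ^ (α + 1) * p (Sum.inr j))
          ((α + 1) * l ^ (α + 1 - 1) * p (Sum.inr j)) l :=
        (Real.hasDerivAt_rpow_const (Or.inl hl.ne')).mul_const _
      rwa [add_sub_cancel_right] at h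
  exact (PiLp.hasFDerivAt_toLp (𝕜 := ℝ) 2 _).comp_hasDerivAt l h

/-- The velocity of the orbit `s ↦ δ_s p` is `1/s` times the vector field `Z_α` at `δ_s p`; the rest
is the chain rule off `z = 0`. -/
theorem Solves.hasDerivAt_comp_dil (hα : 0 < α) {v : Space m k → ℝ}
    {G L : Fin m ⊕ Fin k → Space m k → ℝ} (h : Solves α R v G L) {p : Space m k}
    (hz : zPart p ≠ 0) {l : ℝ} (hl : 0 < l) (hp : dil α l p ∈ pball m k α R) :
    HasDerivAt (fun s => v (dil α s p)) (genZ α v (dil α l p) / l) l := by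
  have hz' : zPart (dil α l p) ≠ 0 := by rw [zPart_dil]; exact smul_ne_zero hl.ne' hz
  have hd := h.hasFDerivAt _ hp hz'
  have hpd : ∀ j, G j (dil α l p) / coeff α j (dil α l p) = partialD j v (dil α l p) := by
    intro j
    rw [partialD, hd.differentiableAt.lineDeriv_eq_fderiv, hd.fderiv, coordForm_single]
  simp_rw [hpd] at hd
  refine (hd.comp_hasDerivAt l (hasDerivAt_dil hl p)).congr_deriv ?_
  rw [coordForm_apply, Fintype.sum_sum_type, genZ, add_div, Finset.sum_div, mul_div_assoc,
    Finset.sum_div, Finset.mul_sum]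
  congr 1
  · refine Finset.sum_congr rfl fun i _ => ?_
    simp only [Sum.elim_inl, dil_inl]
    field_simp
  · refine Finset.sum_congr rfl fun j _ => ?_
    simp only [Sum.elim_inr, dil_inr]
    rw [Real.rpow_add hl, Real.rpow_one]
    field_simp

/-- The components of the continuous function `|z| ^ α Z_α v`. -/
def halfFlux (α : ℝ) (G : Fin m ⊕ Fin k → Space m k → ℝ) (p : Space m k) : ℝ :=
  ∑ i, G (Sum.inl i) p * (‖zPart p‖ ^ α * p (Sum.inl i)) +
    ∑ j, G (Sum.inr j) p * (2 * (α + 1) * p (Sum.inr j))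

theorem flux_eq_mul_halfFlux (hα : 0 < α) (G : Fin m ⊕ Fin k → Space m k → ℝ) (p : Space m k) :
    flux α G p = ‖zPart p‖ ^ α * halfFlux α G p := by
  have h2 : ‖zPart p‖ ^ (2 * α) = ‖zPart p‖ ^ α * ‖zPart p‖ ^ α := by
    rw [← Real.rpow_add_of_nonneg (norm_nonneg _) hα.le hα.le]; congr 1; ring
  rw [flux, halfFlux, Fintype.sum_sum_type, mul_add, Finset.mul_sum, Finset.mul_sum]
  congr 1
  · refine Finset.sum_congr rfl fun i _ => ?_
    simp only [fluxCoeff]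
    rw [h2]
    ring
  · refine Finset.sum_congr rfl fun j _ => ?_
    simp only [fluxCoeff]
    ring

theorem Solves.continuousOn_halfFlux (hα : 0 < α) {w : Space m k → ℝ}
    {G L : Fin m ⊕ Fin k → Space m k → ℝ} (h : Solves α R w G L) :
    ContinuousOn (halfFlux α G) (pball m k α R) := by
  have h2 : Continuous fun p : Space m k => ‖zPart p‖ ^ α :=
    continuous_zPart.norm.rpow_const fun _ => Or.inr hα.le
  refine ContinuousOn.add ?_ ?_
  · refine continuousOn_finsetSum _ fun j _ => (h.contG _).mul (Continuous.continuousOn ?_)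
    fun_prop
  · refine continuousOn_finsetSum _ fun j _ => (h.contG _).mul (Continuous.continuousOn ?_)
    fun_prop

theorem Solves.norm_rpow_mul_genZ_eq_halfFlux (hα : 0 < α) {w : Space m k → ℝ}
    {G L : Fin m ⊕ Fin k → Space m k → ℝ} (h : Solves α R w G L) {p : Space m k}
    (hp : p ∈ pball m k α R) (hz : zPart p ≠ 0) :
    ‖zPart p‖ ^ α * genZ α w p = halfFlux α G p := by
  have h1 := norm_rpow_mul_genZ hz (h.hasFDerivAt p hp hz)
  have hn := norm_pos_iff.2 hz
  have h2 : ‖zPart p‖ ^ (2 * α) = ‖zPart p‖ ^ α * ‖zPart p‖ ^ α := by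
    rw [← Real.rpow_add hn]; congr 1; ring
  rw [flux_eq_mul_halfFlux hα, h2, mul_assoc] at h1
  exact mul_left_cancel₀ (Real.rpow_pos_of_pos hn _).ne' h1

end Dilates

end Baouendi

namespace Baouendi
variable {m k : ℕ}

open Filter Topology Metric
open scoped NNReal ENNReal

/-! ### The Weiss functional in polar coordinates. -/

section Weiss

variable {α R : ℝ} {u : Space m k → ℝ} {G L : Fin m ⊕ Fin k → Space m k → ℝ}

theorem norm_zPart_le_gauge (hα : 0 < α) (p : Space m k) : ‖zPart p‖ ≤ gauge α p := by
  have h1 : ‖zPart p‖ ^ (2 * (α + 1)) ≤ gauge α p ^ (2 * (α + 1)) := by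
    rw [gauge_rpow hα, gaugePow]
    exact le_add_of_nonneg_right (by positivity)
  exact (Real.rpow_le_rpow_iff (norm_nonneg _) (gauge_nonneg _ _) (by positivity)).1 h1

theorem Solves.mono {R' : ℝ} (h : Solves α R u G L) (hR : R' ≤ R) : Solves α R' u G L := by
  have hs : pball m k α R' ⊆ pball m k α R := fun p (hp : gauge α p < R') => hp.trans_le hR
  exact ⟨h.cont.mono hs, fun j => (h.contG j).mono hs, fun j => (h.contL j).mono hs,
    fun p hp => h.hasFDerivAt p (hs hp), fun j p hp => h.hasLineDerivAt j p (hs hp),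
    fun p hp => h.sum_eq_zero p (hs hp)⟩

/-- The product of `|z| ^ α` and `Z_α u` at `δ_s ξ`. -/
def radialY (α : ℝ) (G : Fin m ⊕ Fin k → Space m k → ℝ) (s : ℝ) (ξ : Space m k) : ℝ :=
  s ^ (-α) * halfFlux α G (dil α s ξ)

theorem dil_mem_pball (hα : 0 < α) {s : ℝ} (hs : s ∈ Ioo 0 R) {ξ : Space m k}
    (hξ : gauge α ξ = 1) : dil α s ξ ∈ pball m k α R := by
  show gauge α (dil α s ξ) < R
  rw [gauge_dil hα hs.1.le, hξ, mul_one]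
  exact hs.2

theorem zPart_dil_ne_zero {s : ℝ} (hs : 0 < s) {ξ : Space m k} (hz : zPart ξ ≠ 0) :
    zPart (dil α s ξ) ≠ 0 := by
  rw [zPart_dil]; exact smul_ne_zero hs.ne' hz

/-- The factor `s^(-α)` in `radialY` replaces `|z(δ_s ξ)|^α` by `|z(ξ)|^α`, a weight independent of
`s`. -/
theorem Solves.norm_rpow_mul_genZ_dil (hα : 0 < α) (h : Solves α R u G L) {s : ℝ}
    (hs : s ∈ Ioo 0 R) {ξ : Space m k} (hξ : gauge α ξ = 1) (hz : zPart ξ ≠ 0) :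
    ‖zPart ξ‖ ^ α * genZ α u (dil α s ξ) = radialY α G s ξ := by
  rw [radialY, ← h.norm_rpow_mul_genZ_eq_halfFlux hα (dil_mem_pball hα hs hξ)
    (zPart_dil_ne_zero hs.1 hz), norm_zPart_dil hs.1.le, Real.mul_rpow hs.1.le (norm_nonneg _),
    ← mul_assoc, ← mul_assoc, ← Real.rpow_add hs.1, neg_add_cancel, Real.rpow_zero, one_mul]

/-- The weight `|z|^α` is almost everywhere in `(0, 1]` on the unit pseudo-sphere, because `|z| ≤
ρ_α = 1`. The uniform bounds come from compactness and the continuity of `u` and `halfFlux`. -/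
theorem Solves.radialFamily (hm : 1 ≤ m) (hα : 0 < α) (h : Solves α R u G L) :
    RadialFamily (polarMeasure m k α) R (fun s ξ => u (dil α s ξ)) (radialY α G)
      (fun ξ => ‖zPart ξ‖ ^ α) := by
  have hτ : ∀ᵐ ξ ∂(polarMeasure m k α), gauge α ξ ≤ 1 :=
    (ae_polarMeasure_gauge hm hα).mono fun ξ h => h.le
  have hH := h.continuousOn_halfFlux hα
  refine ⟨fun s hs => aestronglyMeasurable_comp_dil hα h.cont hτ hs,
    fun s hs => (aestronglyMeasurable_comp_dil hα hH hτ hs).const_mul _, ?_, ?_, ?_, ?_, ?_⟩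
  · exact (continuous_zPart.norm.rpow_const fun _ => Or.inr hα.le).aestronglyMeasurable
  · filter_upwards [ae_polarMeasure_gauge hm hα, ae_polarMeasure_zPart hm hα] with ξ h1 h2
    refine ⟨Real.rpow_pos_of_pos (norm_pos_iff.2 h2) _, Real.rpow_le_one (norm_nonneg _) ?_ hα.le⟩
    rw [← h1]
    exact norm_zPart_le_gauge hα ξ
  · intro a b ha hb
    obtain ⟨C, hC0, hC⟩ := exists_bound_of_continuousOn hα hb h.cont
    obtain ⟨C', hC0', hC'⟩ := exists_bound_of_continuousOn hα hb hH
    refine ⟨max C (a ^ (-α) * C'), le_max_of_le_left hC0, ?_⟩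
    filter_upwards [ae_polarMeasure_gauge hm hα] with ξ h1 s hs
    have hs0 : 0 < s := ha.trans_le hs.1
    have hg : gauge α (dil α s ξ) ≤ b := by
      rw [gauge_dil hα hs0.le, h1, mul_one]
      exact hs.2
    refine ⟨(hC _ hg).trans (le_max_left _ _), le_max_of_le_right ?_⟩
    rw [radialY, abs_mul, abs_of_pos (Real.rpow_pos_of_pos hs0 _)]
    exact mul_le_mul (Real.rpow_le_rpow_of_nonpos ha hs.1 (by linarith)) (hC' _ hg)
      (abs_nonneg _) (by positivity)
  · filter_upwards [ae_polarMeasure_gauge hm hα, ae_polarMeasure_zPart hm hα] with ξ h1 h2 s hs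
    have hc := (Real.rpow_pos_of_pos (norm_pos_iff.2 h2) α).ne'
    refine (h.hasDerivAt_comp_dil hα h2 hs.1 (dil_mem_pball hα hs h1)).congr_deriv ?_
    rw [← h.norm_rpow_mul_genZ_dil hα hs h1 h2]
    have := hs.1.ne'
    field_simp
  · filter_upwards [ae_polarMeasure_gauge hm hα] with ξ h1 s hs
    have hd : Continuous fun s : ℝ => dil α s ξ :=
      (continuous_dil_uncurry hα).comp (continuous_id.prodMk continuous_const)
    exact (Real.continuousAt_rpow_const _ _ (Or.inl hs.1.ne')).mul
      (ContinuousAt.comp (f := fun s : ℝ => dil α s ξ)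
      (hH.continuousAt ((isOpen_pball hα R).mem_nhds (dil_mem_pball hα hs h1))) hd.continuousAt)

theorem norm_rpow_two_mul (ξ : Space m k) :
    ‖zPart ξ‖ ^ (2 * α) = (‖zPart ξ‖ ^ α) ^ 2 := by
  rw [mul_comm, Real.rpow_mul (norm_nonneg _)]
  norm_cast

theorem Solves.integral_mul_genZ (hm : 1 ≤ m) (hα : 0 < α) (h : Solves α R u G L)
    (f : Space m k → ℝ) {t : ℝ} (ht : t ∈ Ioo 0 R) :
    ∫ ξ, f ξ * genZ α u (dil α t ξ) * ‖zPart ξ‖ ^ (2 * α) ∂(polarMeasure m k α) =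
      ∫ ξ, f ξ * radialY α G t ξ * ‖zPart ξ‖ ^ α ∂(polarMeasure m k α) := by
  refine integral_congr_ae ?_
  filter_upwards [ae_polarMeasure_gauge hm hα, ae_polarMeasure_zPart hm hα] with ξ h1 h2
  rw [← h.norm_rpow_mul_genZ_dil hα ht h1 h2, norm_rpow_two_mul]
  ring

/-- Since `s, t < R`, both `u ∘ δ_s` and `u ∘ δ_t` solve the equation in a pseudo-ball of radius
greater than `1`. Green's identity on the unit pseudo-ball equates each side with the integral of
`⟨∇_α (u ∘ δ_s), ∇_α (u ∘ δ_t)⟩`, which is symmetric. -/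
theorem Solves.integral_symm (hm : 1 ≤ m) (hα : 0 < α) (h : Solves α R u G L) {s t : ℝ}
    (hs : s ∈ Ioo 0 R) (ht : t ∈ Ioo 0 R) :
    ∫ ξ, u (dil α s ξ) * radialY α G t ξ * ‖zPart ξ‖ ^ α ∂(polarMeasure m k α) =
      ∫ ξ, u (dil α t ξ) * radialY α G s ξ * ‖zPart ξ‖ ^ α ∂(polarMeasure m k α) := by
  set R' := min (R / s) (R / t)
  have hR' : (1 : ℝ) ∈ Ioo 0 R' :=
    ⟨one_pos, lt_min ((one_lt_div hs.1).2 hs.2) ((one_lt_div ht.1).2 ht.2)⟩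
  have h1 := (h.comp_dil hα hs.1).mono (min_le_left (R / s) (R / t))
  have h2 := (h.comp_dil hα ht.1).mono (min_le_right (R / s) (R / t))
  have e1 := h1.green hm hα h2 hR'
  have e2 := h2.green hm hα h1 hR'
  simp only [Real.one_rpow, one_mul, genZ_comp_dil, dil_one] at e1 e2
  rw [← h.integral_mul_genZ hm hα _ ht, ← h.integral_mul_genZ hm hα _ hs, ← e1, ← e2]
  congr 1
  ext p
  exact Finset.sum_congr rfl fun j _ => mul_comm _ _

variable (α G u) in
/-- The integral of `u Z_α u ψ_α` over the pseudo-sphere of radius `s` in polar coordinates. -/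
def radialFlux (s : ℝ) : ℝ :=
  ∫ ξ, u (dil α s ξ) * radialY α G s ξ * ‖zPart ξ‖ ^ α ∂(polarMeasure m k α)

variable (α u) in
/-- The integral of `u ^ 2 ψ_α` over the pseudo-sphere of radius `s` in polar coordinates. -/
def radialHeight (s : ℝ) : ℝ :=
  ∫ ξ, u (dil α s ξ) ^ 2 * (‖zPart ξ‖ ^ α) ^ 2 ∂(polarMeasure m k α)

variable (α G u) in
/-- The integral of `(Z_α u - κ u) ^ 2 ψ_α` over the pseudo-sphere of radius `s` in polar
coordinates. -/
def radialDefect (κ s : ℝ) : ℝ :=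
  ∫ ξ, (radialY α G s ξ - κ * (u (dil α s ξ) * ‖zPart ξ‖ ^ α)) ^ 2 ∂(polarMeasure m k α)

theorem height_eq (hm : 1 ≤ m) (hα : 0 < α) {s : ℝ} (hs : 0 < s) :
    height α u s = s ^ (homDim m k α - 1) * radialHeight α u s := by
  rw [height, integral_psphere_mul_weight hm hα hs (fun p => u p ^ 2), radialHeight]
  simp_rw [norm_rpow_two_mul]

theorem Solves.setIntegral_sum_sq (hm : 1 ≤ m) (hα : 0 < α) (h : Solves α R u G L) {s : ℝ}
    (hs : s ∈ Ioo 0 R) : ∫ p in pball m k α s, ∑ j, G j p ^ 2 =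
      s ^ (homDim m k α - 2) * radialFlux α u G s := by
  simp_rw [sq]
  rw [h.green hm hα h hs, h.integral_mul_genZ hm hα _ hs, radialFlux]

theorem Solves.defect_ae_eq (hm : 1 ≤ m) (hα : 0 < α) (h : Solves α R u G L) (κ : ℝ) {s : ℝ}
    (hs : s ∈ Ioo 0 R) :
    (fun ξ => (genZ α u (dil α s ξ) - κ * u (dil α s ξ)) ^ 2 * ‖zPart ξ‖ ^ (2 * α))
      =ᵐ[polarMeasure m k α]
      fun ξ => (radialY α G s ξ - κ * (u (dil α s ξ) * ‖zPart ξ‖ ^ α)) ^ 2 := by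
  filter_upwards [ae_polarMeasure_gauge hm hα, ae_polarMeasure_zPart hm hα] with ξ h1 h2
  rw [← h.norm_rpow_mul_genZ_dil hα hs h1 h2, norm_rpow_two_mul]
  ring

theorem Solves.psphere_defect (hm : 1 ≤ m) (hα : 0 < α) (h : Solves α R u G L) (κ : ℝ) {s : ℝ}
    (hs : s ∈ Ioo 0 R) :
    ∫ p in psphere m k α s, (genZ α u p - κ * u p) ^ 2 * weight α p ∂(surfaceMeasure m k) =
      s ^ (homDim m k α - 1) * radialDefect α u G κ s := by
  rw [integral_psphere_mul_weight hm hα hs.1 (fun p => (genZ α u p - κ * u p) ^ 2),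
    integral_congr_ae (h.defect_ae_eq hm hα κ hs), radialDefect]

theorem Solves.integrable_defect (hm : 1 ≤ m) (hα : 0 < α) (h : Solves α R u G L) (κ : ℝ) {s : ℝ}
    (hs : s ∈ Ioo 0 R) :
    Integrable (fun ξ => (radialY α G s ξ - κ * (u (dil α s ξ) * ‖zPart ξ‖ ^ α)) ^ 2)
      (polarMeasure m k α) ∧
    radialDefect α u G κ s = ∫ ξ, radialY α G s ξ ^ 2 ∂(polarMeasure m k α) -
      2 * κ * radialFlux α u G s + κ ^ 2 * radialHeight α u s := by
  have := isFiniteMeasure_polarMeasure (m := m) (k := k) hα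
  have hf := h.radialFamily hm hα
  have i1 := hf.integrable_sq_y hs
  have i2 := (hf.integrable_U_mul_y hs hs).const_mul (2 * κ)
  have i3 := (hf.integrable_sq_U hs).const_mul (κ ^ 2)
  have e : (fun ξ => (radialY α G s ξ - κ * (u (dil α s ξ) * ‖zPart ξ‖ ^ α)) ^ 2) =
      fun ξ => radialY α G s ξ ^ 2 - 2 * κ * (u (dil α s ξ) * radialY α G s ξ * ‖zPart ξ‖ ^ α) +
        κ ^ 2 * (u (dil α s ξ) ^ 2 * (‖zPart ξ‖ ^ α) ^ 2) := by
    ext ξ; ring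
  have i12 : Integrable (fun ξ => radialY α G s ξ ^ 2 -
      2 * κ * (u (dil α s ξ) * radialY α G s ξ * ‖zPart ξ‖ ^ α)) (polarMeasure m k α) :=
    i1.sub i2
  constructor
  · rw [e]
    exact i12.add i3
  · rw [radialDefect, e, integral_add i12 i3, integral_sub i1 i2, integral_const_mul,
      integral_const_mul, radialFlux, radialHeight]

theorem radialDefect_nonneg (κ s : ℝ) : 0 ≤ radialDefect α u G κ s :=
  integral_nonneg fun _ => sq_nonneg _

/-- The derivative of the Weiss functional in polar coordinates. -/
theorem Solves.hasDerivAt_radial (hm : 1 ≤ m) (hα : 0 < α) (h : Solves α R u G L) (κ : ℝ) {r : ℝ}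
    (hr : r ∈ Ioo 0 R) :
    HasDerivAt (fun s => s ^ (-2 * κ) * (radialFlux α u G s - κ * radialHeight α u s))
      (2 * r ^ (-2 * κ - 1) * radialDefect α u G κ r) r := by
  have := isFiniteMeasure_polarMeasure (m := m) (k := k) hα
  have hf := h.radialFamily hm hα
  have d1 : HasDerivAt (radialFlux α u G) _ r :=
    hf.hasDerivAt_integral_diag (fun s hs t ht => h.integral_symm hm hα hs ht) hr
  have d2 : HasDerivAt (radialHeight α u) (2 / r * radialFlux α u G r) r :=
    hf.hasDerivAt_integral_sq hr
  have d3 : HasDerivAt (fun s : ℝ => s ^ (-2 * κ)) (-2 * κ * r ^ (-2 * κ - 1)) r :=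
    Real.hasDerivAt_rpow_const (Or.inl hr.1.ne')
  refine (d3.mul (d1.sub (d2.const_mul κ))).congr_deriv ?_
  -- Let `Φ`, `h`, `Y` be the values at `r` of the flux, the height and `∫ y^2`. The product rule
  -- gives `-2κ r^(-2κ-1) (Φ - κ h) + r^(-2κ) (2/r) (Y - κ Φ)`, which is `2 r^(-2κ-1) (Y - 2κ Φ +
  -- κ^2 h)`, the expanded defect.
  rw [(h.integrable_defect hm hα κ hr).2]
  have e : r ^ (-2 * κ) = r ^ (-2 * κ - 1) * r := by
    rw [Real.rpow_sub hr.1, Real.rpow_one, div_mul_cancel₀ _ hr.1.ne']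
  simp only [Pi.sub_apply]
  rw [e]
  have := hr.1.ne'
  field_simp
  ring

/-- A vanishing defect forces the equation almost everywhere on each pseudo-sphere, hence almost
everywhere in `B_R`. The exceptional set off `z = 0` is open, by the continuity of `halfFlux`, and
an open null set is empty. -/
theorem Solves.genZ_eq_of_defect_eq_zero (hm : 1 ≤ m) (hα : 0 < α) (h : Solves α R u G L) {κ : ℝ}
    (h0 : ∀ s ∈ Ioo 0 R, radialDefect α u G κ s = 0) {p : Space m k}
    (hp : p ∈ pball m k α R) (hz : zPart p ≠ 0) : genZ α u p = κ * u p := by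
  set Ω : Set (Space m k) := pball m k α R ∩ {p | zPart p ≠ 0}
  have hΩ : IsOpen Ω := (isOpen_pball hα R).inter isOpen_zPart_ne_zero
  set g : Space m k → ℝ := fun p => halfFlux α G p - κ * (u p * ‖zPart p‖ ^ α) with hg
  have hgc : ContinuousOn g Ω := by
    have hc : Continuous fun p : Space m k => ‖zPart p‖ ^ α :=
      continuous_zPart.norm.rpow_const fun _ => Or.inr hα.le
    exact ((h.continuousOn_halfFlux hα).sub (continuousOn_const.mul
      (h.cont.mul hc.continuousOn))).mono inter_subset_left
  have hgeq : ∀ p ∈ Ω, g p = ‖zPart p‖ ^ α * (genZ α u p - κ * u p) := by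
    intro p hp
    rw [hg]
    simp only
    rw [← h.norm_rpow_mul_genZ_eq_halfFlux hα hp.1 hp.2]
    ring
  set N : Set (Space m k) := Ω ∩ g ⁻¹' {0}ᶜ
  have hN : IsOpen N := hgc.isOpen_inter_preimage hΩ isOpen_compl_singleton
  have hvol : volume N = 0 := by
    refine volume_eq_zero_of_polar hm hα hN.measurableSet fun s hs => ?_
    rw [measure_eq_zero_iff_ae_notMem]
    rcases lt_or_ge s R with hsR | hsR
    · have hs' : s ∈ Ioo 0 R := ⟨hs, hsR⟩
      have hz := (integral_eq_zero_iff_of_nonneg (fun _ => sq_nonneg _)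
        (h.integrable_defect hm hα κ hs').1).1 (h0 s hs')
      filter_upwards [hz, ae_polarMeasure_gauge hm hα, ae_polarMeasure_zPart hm hα]
        with ξ h1 h2 h3 hmem
      have h4 : radialY α G s ξ - κ * (u (dil α s ξ) * ‖zPart ξ‖ ^ α) = 0 := by
        simpa using h1
      refine hmem.2 ?_
      rw [mem_singleton_iff, hgeq _ hmem.1]
      rw [← h.norm_rpow_mul_genZ_dil hα hs' h2 h3] at h4
      have h5 : ‖zPart ξ‖ ^ α * (genZ α u (dil α s ξ) - κ * u (dil α s ξ)) = 0 := by
        linear_combination h4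
      have h6 := (mul_eq_zero.1 h5).resolve_left
        (Real.rpow_pos_of_pos (norm_pos_iff.2 h3) _).ne'
      rw [h6, mul_zero]
    · filter_upwards [ae_polarMeasure_gauge hm hα] with ξ h1 hmem
      have h2 : gauge α (dil α s ξ) < R := hmem.1.1
      rw [gauge_dil hα hs.le, h1, mul_one] at h2
      exact h2.not_ge hsR
  have hNe : N = ∅ := (hN.measure_eq_zero_iff _).1 hvol
  have hpΩ : p ∈ Ω := ⟨hp, hz⟩
  have hgp : g p = 0 := by
    by_contra hne
    have : p ∈ N := ⟨hpΩ, hne⟩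
    rw [hNe] at this
    exact this
  rw [hgeq p hpΩ] at hgp
  have := (mul_eq_zero.1 hgp).resolve_left (Real.rpow_pos_of_pos (norm_pos_iff.2 hz) _).ne'
  linarith

/-- Euler's equation makes `s^(-κ) u(δ_s p)` constant along the part of the orbit in `B_R`, which is
connected: it is `0 < s < R / ρ_α(p)`. Points with `z = 0` follow by continuity, since their
complement has full measure. -/
theorem Solves.homogeneous_of_genZ_eq (hm : 1 ≤ m) (hα : 0 < α) (h : Solves α R u G L) {κ : ℝ}
    (hZ : ∀ p ∈ pball m k α R, zPart p ≠ 0 → genZ α u p = κ * u p) :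
    IsHomogeneousOn α κ (pball m k α R) u := by
  have main : ∀ p ∈ pball m k α R, zPart p ≠ 0 → ∀ l : ℝ, 0 < l → dil α l p ∈ pball m k α R →
      u (dil α l p) = l ^ κ * u p := by
    intro p hp hz l hl hlp
    have hp0 : p ≠ 0 := fun h => hz (by rw [h]; rfl)
    have hg := gauge_pos hα hp0
    set I : Set ℝ := Ioo 0 (R / gauge α p)
    have hmem : ∀ s : ℝ, 0 < s → (dil α s p ∈ pball m k α R ↔ s ∈ I) := by
      intro s hs
      show gauge α (dil α s p) < R ↔ _
      rw [gauge_dil hα hs.le, ← lt_div_iff₀ hg]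
      exact ⟨fun h => ⟨hs, h⟩, fun h => h.2⟩
    have hd : ∀ s ∈ I, HasDerivAt (fun s => s ^ (-κ) * u (dil α s p)) 0 s := by
      intro s hs
      have hm1 := (hmem s hs.1).2 hs
      have d1 : HasDerivAt (fun s : ℝ => s ^ (-κ)) (-κ * s ^ (-κ - 1)) s :=
        Real.hasDerivAt_rpow_const (Or.inl hs.1.ne')
      refine (d1.mul (h.hasDerivAt_comp_dil hα hz hs.1 hm1)).congr_deriv ?_
      rw [hZ _ hm1 (zPart_dil_ne_zero hs.1 hz), Real.rpow_sub hs.1, Real.rpow_one]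
      ring
    have hconst := isOpen_Ioo.is_const_of_deriv_eq_zero isPreconnected_Ioo
      (fun s hs => (hd s hs).differentiableAt.differentiableWithinAt)
      (fun s hs => (hd s hs).deriv) ((hmem l hl).1 hlp)
      ((hmem 1 one_pos).1 (by rwa [dil_one]))
    simp only [Real.one_rpow, one_mul, dil_one] at hconst
    rw [← hconst, ← mul_assoc, ← Real.rpow_add hl, add_neg_cancel, Real.rpow_zero, one_mul]
  intro p hp l hl hlp
  set W : Set (Space m k) := pball m k α R ∩ dil α l ⁻¹' pball m k α R
  have hW : IsOpen W := (isOpen_pball hα R).inter ((isOpen_pball hα R).preimage (continuous_dil l))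
  have c1 : ContinuousOn (fun p => u (dil α l p)) W :=
    ContinuousOn.comp h.cont (continuous_dil l).continuousOn fun p hp => hp.2
  have c2 : ContinuousOn (fun p => l ^ κ * u p) W :=
    continuousOn_const.mul (h.cont.mono inter_subset_left)
  refine Measure.eqOn_open_of_ae_eq (μ := volume) ?_ hW c1 c2 ⟨hp, hlp⟩
  filter_upwards [ae_restrict_mem hW.measurableSet, ae_restrict_of_ae (ae_zPart_ne_zero hm)]
    with x hx hxz using main x hx.1 hxz l hl hx.2

/-- Differentiate the homogeneity relation in the dilation factor at `1`. -/
theorem Solves.genZ_eq_of_homogeneous (hα : 0 < α) (h : Solves α R u G L) {κ : ℝ}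
    (hom : IsHomogeneousOn α κ (pball m k α R) u) {p : Space m k} (hp : p ∈ pball m k α R)
    (hz : zPart p ≠ 0) : genZ α u p = κ * u p := by
  have d1 := h.hasDerivAt_comp_dil hα hz one_pos (by rwa [dil_one])
  rw [dil_one, div_one] at d1
  have d2 : HasDerivAt (fun s : ℝ => s ^ κ * u p) (κ * 1 ^ (κ - 1) * u p) 1 :=
    (Real.hasDerivAt_rpow_const (Or.inl one_ne_zero)).mul_const _
  rw [Real.one_rpow, mul_one] at d2
  refine d1.unique (d2.congr_of_eventuallyEq ?_)
  have hd : Continuous fun s : ℝ => dil α s p :=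
    (continuous_dil_uncurry hα).comp (continuous_id.prodMk continuous_const)
  have hmem : ∀ᶠ s in 𝓝 (1 : ℝ), dil α s p ∈ pball m k α R :=
    hd.continuousAt.eventually ((isOpen_pball hα R).mem_nhds
      (show dil α 1 p ∈ pball m k α R by rwa [dil_one]))
  filter_upwards [hmem, lt_mem_nhds one_pos] with s h1 h2 using hom p hp s h2 h1

theorem Solves.radialDefect_eq_zero_of_homogeneous (hm : 1 ≤ m) (hα : 0 < α)
    (h : Solves α R u G L) {κ : ℝ} (hom : IsHomogeneousOn α κ (pball m k α R) u) {s : ℝ}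
    (hs : s ∈ Ioo 0 R) : radialDefect α u G κ s = 0 := by
  rw [radialDefect]
  refine integral_eq_zero_of_ae ?_
  filter_upwards [ae_polarMeasure_gauge hm hα, ae_polarMeasure_zPart hm hα] with ξ h1 h2
  rw [← h.norm_rpow_mul_genZ_dil hα hs h1 h2, h.genZ_eq_of_homogeneous hα hom
    (dil_mem_pball hα hs h1) (zPart_dil_ne_zero hs.1 h2)]
  simp only [Pi.zero_apply]
  ring

end Weiss

end Baouendi

end

/-! ### The monotonicity formula and the case of constancy. -/

theorem theoremT (m k : ℕ) (hm : 1 ≤ m) (hk : 1 ≤ k) (α : ℝ) (hα : 0 < α) (R : ℝ) (hR : 0 < R)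
    (u : Baouendi.Space m k → ℝ) (hu : Baouendi.IsSolution α (Baouendi.pball m k α R) u)
    (κ : ℝ) (hκ : 0 ≤ κ) :
    (∀ r ∈ Set.Ioo 0 R,
      MeasureTheory.IntegrableOn (Baouendi.alphaGradSq α (Baouendi.pball m k α R) u)
        (Baouendi.pball m k α r) ∧
      MeasureTheory.IntegrableOn (fun p => u p ^ 2 * Baouendi.weight α p)
        (Baouendi.psphere m k α r) (Baouendi.surfaceMeasure m k) ∧
      MeasureTheory.IntegrableOn (fun p => (Baouendi.genZ α u p - κ * u p) ^ 2 * Baouendi.weight α p)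
        (Baouendi.psphere m k α r) (Baouendi.surfaceMeasure m k) ∧
      HasDerivAt (Baouendi.weiss α R κ u)
        (2 / r ^ (Baouendi.homDim m k α + 2 * κ) *
          ∫ p in Baouendi.psphere m k α r,
            (Baouendi.genZ α u p - κ * u p) ^ 2 * Baouendi.weight α p
            ∂(Baouendi.surfaceMeasure m k)) r) ∧
    MonotoneOn (Baouendi.weiss α R κ u) (Set.Ioo 0 R) ∧
    ((∃ c : ℝ, ∀ r ∈ Set.Ioo 0 R, Baouendi.weiss α R κ u r = c) ↔
      Baouendi.IsHomogeneousOn α κ (Baouendi.pball m k α R) u) := by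
  open Baouendi in
  have h := hu.solves hα
  set G : Fin m ⊕ Fin k → Space m k → ℝ := fun j => weakX α (pball m k α R) j u
  have := isFiniteMeasure_polarMeasure (m := m) (k := k) hα
  have hf := h.radialFamily hm hα
  -- The factors `s^(Q-2)` of the Dirichlet integral and `s^(Q-1)` of the height cancel against the
  -- normalizations.
  have hweiss : ∀ s ∈ Ioo 0 R, weiss α R κ u s =
      s ^ (-2 * κ) * (radialFlux α u G s - κ * radialHeight α u s) := by
    intro s hs
    have e1 : dirichlet α R u s = s ^ (homDim m k α - 2) * radialFlux α u G s :=
      h.setIntegral_sum_sq hm hα hs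
    have hp1 := (Real.rpow_pos_of_pos hs.1 (homDim m k α - 2)).ne'
    have hp2 := (Real.rpow_pos_of_pos hs.1 (homDim m k α - 1)).ne'
    have hp3 := (Real.rpow_pos_of_pos hs.1 (2 * κ)).ne'
    rw [weiss, e1, height_eq hm hα hs.1, Real.rpow_add hs.1, Real.rpow_add hs.1,
      show -2 * κ = -(2 * κ) by ring, Real.rpow_neg hs.1.le]
    field_simp
  have hder : ∀ r ∈ Ioo 0 R,
      HasDerivAt (weiss α R κ u) (2 * r ^ (-2 * κ - 1) * radialDefect α u G κ r) r := by
    intro r hr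
    refine (h.hasDerivAt_radial hm hα κ hr).congr_of_eventuallyEq ?_
    filter_upwards [Ioo_mem_nhds hr.1 hr.2] with s hs using hweiss s hs
  refine ⟨fun r hr => ⟨?_, ?_, ?_, ?_⟩, ?_, ?_, fun hom => ?_⟩
  · have hc : ContinuousOn (alphaGradSq α (pball m k α R) u) (pball m k α R) :=
      continuousOn_finsetSum _ fun j _ => (h.contG j).pow 2
    exact ((hc.mono fun p (hp : gauge α p ≤ r) => hp.trans_lt hr.2).integrableOn_compact
      (isCompact_gauge_le hα r)).mono_set fun p (hp : gauge α p < r) => hp.le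
  · refine integrableOn_psphere_mul_weight hm hα hr.1 (fun p => u p ^ 2) ?_
    simp_rw [norm_rpow_two_mul]
    exact hf.integrable_sq_U hr
  · exact integrableOn_psphere_mul_weight hm hα hr.1 (fun p => (genZ α u p - κ * u p) ^ 2)
      ((h.integrable_defect hm hα κ hr).1.congr (h.defect_ae_eq hm hα κ hr).symm)
  · refine (hder r hr).congr_deriv ?_
    rw [h.psphere_defect hm hα κ hr, ← mul_assoc]
    congr 1
    rw [div_mul_eq_mul_div, mul_div_assoc, ← Real.rpow_sub hr.1]
    congr 2
    ring
  · refine monotoneOn_of_deriv_nonneg (convex_Ioo 0 R)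
      (fun s hs => (hder s hs).continuousAt.continuousWithinAt) ?_ ?_
    · rw [interior_Ioo]
      exact fun s hs => (hder s hs).differentiableAt.differentiableWithinAt
    · rw [interior_Ioo]
      intro s hs
      rw [(hder s hs).deriv]
      have := radialDefect_nonneg (α := α) (u := u) (G := G) κ s
      have := Real.rpow_pos_of_pos hs.1 (-2 * κ - 1)
      positivity
  -- Constancy makes the derivative zero at every radius, and its prefactor is positive; so the
  -- defect vanishes on every pseudo-sphere.
  · rintro ⟨c, hc⟩
    refine h.homogeneous_of_genZ_eq hm hα fun p hp hz =>
      h.genZ_eq_of_defect_eq_zero hm hα (fun s hs => ?_) hp hz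
    have d0 : HasDerivAt (weiss α R κ u) 0 s := by
      refine (hasDerivAt_const s c).congr_of_eventuallyEq ?_
      filter_upwards [Ioo_mem_nhds hs.1 hs.2] with r hr using hc r hr
    have e := (hder s hs).unique d0
    have hpos : 2 * s ^ (-2 * κ - 1) ≠ 0 := by
      have := Real.rpow_pos_of_pos hs.1 (-2 * κ - 1)
      positivity
    exact (mul_eq_zero.1 e).resolve_left hpos
  -- Any radius in `(0, R)` serves as reference: the derivative vanishes throughout the interval.
  · refine ⟨weiss α R κ u (R / 2), fun r hr => ?_⟩
    have hd0 : ∀ s ∈ Ioo 0 R, HasDerivAt (weiss α R κ u) 0 s := by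
      intro s hs
      have := hder s hs
      rwa [h.radialDefect_eq_zero_of_homogeneous hm hα hom hs, mul_zero] at this
    exact isOpen_Ioo.is_const_of_deriv_eq_zero isPreconnected_Ioo
      (fun s hs => (hd0 s hs).differentiableAt.differentiableWithinAt)
      (fun s hs => (hd0 s hs).deriv) hr ⟨by linarith, by linarith⟩
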